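/- Fix an integer $N\ge 0$ and let $\mathcal M_{2N+1}$ be the set of polynomials $f(\zeta)=\sum_{k=0}^{N}a_k\zeta^{k+1}$ with $a_0>0$, $a_1,\dots,a_N\in\mathbb C$, that are univalent in a neighbourhood of the closed unit disk $\overline{\mathbb D}$. Put $\Omega=f(\mathbb D)$ and let $M_k=\frac1\pi\int_\Omega z^k\,dm$ be its harmonic moments. Then $(M_0;M_1,\dots,M_N)\in\mathbb R\times\mathbb C^N$ are smooth local coordinates near every point of $\mathcal M_{2N+1}$; in such coordinates, with values in an open set $U$, write $f=f(\zeta;M)$ and $\Omega=\Omega_M$. Let $\partial/\partial M_0$ be the real partial derivative and, for $1\le k\le N$, let $\frac{\partial}{\partial M_k}=\frac12\big(\frac{\partial}{\partial\operatorname{Re}M_k}-i\frac{\partial}{\partial\operatorname{Im}M_k}\big)$. Put $$\{F,H\}=\zeta\frac{\partial F}{\partial\zeta}\frac{\partial H}{\partial M_0}-\zeta\frac{\partial H}{\partial\zeta}\frac{\partial F}{\partial M_0}.$$ Let $S(z;M)$ be the Schwarz function of $\partial\Omega_M$: it is holomorphic near $\partial\Omega_M$ with $S(z;M)=\bar z$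 on $\partial\Omega_M$. Let $$W(z;M)=M_0\log z-\sum_{k=1}^{N}\frac{M_k}{k\,z^{k}}+R(z;M)$$ be a primitive in $z$ of $S$ near $\partial\Omega_M$, with $R(\cdot\,;M)$ holomorphic near $\overline{\Omega_M}$, on a domain which is open in $(z,M)$. Normalize $W$ by $\operatorname{Re}W(z;M)=\frac12|z|^2$ on $\partial\Omega_M$, and by the condition that $\operatorname{Im}R(0;M)$ is a smooth function of $M_1,\dots,M_N$ alone (for instance $0$). Let $G=g+i\,{*g}$ be the complex Green's function of $\Omega_M$, continued analytically across $\partial\Omega_M$, where $g$ is the Green's function of $\Omega_M$ with pole at $0$ and the additive constant in the conjugate function $*g$ is fixed by requiring $G(z;M)+\log z$ to be real at $z=0$. Such $S$, $W$ and $G$ exist. Define $$H_0(\zeta;M)=G(f(\zeta;M);M),\qquad H_k(\zeta;M)=-\frac{\partial W}{\partial M_k}(z;M)\Big|_{z=f(\zeta;M)}\quad(1\le k\le N),$$ where the derivative of $W$ is taken with $z$ fixed. Here $W$ and $G$ are multivalued, and everything below holds for the branches of $W$ and $G$ given by one and the same arbitrary local branch of $\log z$. Then, for every $M\in U$ and every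 $\zeta\neq0$ in a neighbourhood of $\overline{\mathbb D}$, all the derivatives that occur below exist, and: 1. $\dfrac{\partial f}{\partial M_k}=\{f,H_k\}$ for $1\le k\le N$; 2. $G(z;M)=-\dfrac{\partial W}{\partial M_0}(z;M)$ at $z=f(\zeta;M)$, and $H_0(\zeta;M)=-\log\zeta$, that is, $e^{-H_0(\zeta;M)}=\zeta$; 3. $\dfrac{\partial\varphi}{\partial M_0}=\{\varphi,H_0\}$ for every function $\varphi(\zeta;M)$ that is complex differentiable in $\zeta$ and real differentiable in $M$ at the point in question. -/

import Mathlib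

open scoped Topology ContDiff

namespace MomentEvolution

noncomputable section

/-- The real coordinate space `ℝ × ℂ^N` of real dimension `2N+1`.  It is used both for the
coefficients `(a₀; a₁, …, a_N)` and for the moments `(M₀; M₁, …, M_N)`. -/
abbrev Coord (N : ℕ) : Type := ℝ × (Fin N → ℂ)

/-- The polynomial `a₀ ζ + a₁ ζ² + ⋯ + a_N ζ^(N+1)`. -/
def polyMap {N : ℕ} (a : Coord N) (ζ : ℂ) : ℂ :=
  (a.1 : ℂ) * ζ + ∑ j : Fin N, a.2 j * ζ ^ ((j : ℕ) + 2)

/-- The polynomials with `a₀ > 0` that are univalent in a full neighbourhood of the closed unit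
disk: the manifold of dimension `2N+1`. -/
def IsAdmissible {N : ℕ} (a : Coord N) : Prop :=
  0 < a.1 ∧ ∃ V : Set ℂ, IsOpen V ∧ Metric.closedBall 0 1 ⊆ V ∧ Set.InjOn (polyMap a) V

/-- The domain `Ω = f(𝔻)`. -/
def imageDomain {N : ℕ} (a : Coord N) : Set ℂ :=
  polyMap a '' Metric.ball 0 1

/-- The harmonic moment `M_k = (1/π) ∫_Ω z^k dm`. -/
def harmonicMoment (Ω : Set ℂ) (k : ℕ) : ℂ :=
  (1 / (Real.pi : ℂ)) * ∫ z in Ω, z ^ k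

/-- The moments `(M₀; M₁, …, M_N)` of the domain `f(𝔻)` (`M₀` is real). -/
def momentMap {N : ℕ} (a : Coord N) : Coord N :=
  ((harmonicMoment (imageDomain a) 0).re, fun j => harmonicMoment (imageDomain a) ((j : ℕ) + 1))

/-- The moments as local coordinates: on the open set `U` of moment space, `a` is a smooth local
inverse of the map from coefficients to moments, so that `f(ζ;M) = polyMap (a M) ζ`. -/
structure IsMomentChart {N : ℕ} (U : Set (Coord N)) (a : Coord N → Coord N) : Prop where
  isOpen : IsOpen U
  admissible : ∀ M ∈ U, IsAdmissible (a M)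
  moments : ∀ M ∈ U, momentMap (a M) = M
  smooth : ContDiffOn ℝ ∞ a U

/-- `∂F/∂M₀`, where `M₀` is a real coordinate. -/
def dM0 {N : ℕ} (F : Coord N → ℂ) (M : Coord N) : ℂ :=
  fderiv ℝ F M (1, 0)

/-- The Wirtinger derivative `∂F/∂M_{k+1} = (1/2)(∂F/∂Re M_{k+1} - i ∂F/∂Im M_{k+1})`. -/
def dMoment {N : ℕ} (k : Fin N) (F : Coord N → ℂ) (M : Coord N) : ℂ :=
  (1 / 2) * (fderiv ℝ F M (0, Pi.single k 1) - Complex.I * fderiv ℝ F M (0, Pi.single k Complex.I))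

/-- The Poisson bracket
`{F, G} = ζ (∂F/∂ζ) (∂G/∂M₀) - ζ (∂G/∂ζ) (∂F/∂M₀)`. -/
def poissonBracket {N : ℕ} (F G : ℂ → Coord N → ℂ) (ζ : ℂ) (M : Coord N) : ℂ :=
  ζ * deriv (fun ξ => F ξ M) ζ * dM0 (G ζ) M - ζ * deriv (fun ξ => G ξ M) ζ * dM0 (F ζ) M

/-- `ℓ` is a holomorphic branch of the logarithm on the open set `O`. -/
structure IsLogBranch (O : Set ℂ) (ℓ : ℂ → ℂ) : Prop where
  isOpen : IsOpen O
  holo : DifferentiableOn ℂ ℓ O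
  exp_eq : ∀ z ∈ O, Complex.exp (ℓ z) = z

/-- `S` is a Schwarz function of `∂Ω`: holomorphic in a neighbourhood of `∂Ω`, with
`S(z) = conj z` on `∂Ω`. -/
def IsSchwarzFunction (Ω : Set ℂ) (S : ℂ → ℂ) : Prop :=
  ∃ V : Set ℂ, IsOpen V ∧ frontier Ω ⊆ V ∧ DifferentiableOn ℂ S V ∧
    ∀ z ∈ frontier Ω, S z = starRingEnd ℂ z

/-- `𝒟` is an open set of pairs `(z, M)` which contains the closure of `Ω_M` for each `M ∈ U`. -/
def IsDomainNhd {N : ℕ} (U : Set (Coord N)) (a : Coord N → Coord N)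
    (𝒟 : Set (ℂ × Coord N)) : Prop :=
  IsOpen 𝒟 ∧ ∀ M ∈ U, ∀ z ∈ closure (imageDomain (a M)), (z, M) ∈ 𝒟

/-- The branch, given by the branch `ℓ` of the logarithm, of the multivalued function
`W(z;M) = M₀ log z - ∑_{k=1}^N M_k / (k z^k) + R(z;M)`.
Here `R(z;M) = C(M) + ∑_{k>0} M_{-k} z^k / k` is the part that is holomorphic in `Ω`, so that the
constant `C(M)` is `R(0;M)`. -/
def potential {N : ℕ} (ℓ : ℂ → ℂ) (R : ℂ → Coord N → ℂ) (z : ℂ) (M : Coord N) : ℂ :=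
  (M.1 : ℂ) * ℓ z - ∑ k : Fin N, M.2 k / ((((k : ℕ) + 1 : ℕ) : ℂ) * z ^ ((k : ℕ) + 1)) + R z M

/-- `W = potential ℓ R` is the normalized primitive of the Schwarz functions `S(·;M)`. -/
structure IsSchwarzPrimitive {N : ℕ} (U : Set (Coord N)) (a : Coord N → Coord N)
    (𝒟 : Set (ℂ × Coord N)) (S R : ℂ → Coord N → ℂ) : Prop where
  holo : ∀ M ∈ U, DifferentiableOn ℂ (fun z => R z M) {z | (z, M) ∈ 𝒟}
  /-- `∂W/∂z = S` near `∂Ω`, for every branch of `W`. -/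
  primitive : ∀ M ∈ U, ∃ V : Set ℂ, IsOpen V ∧ frontier (imageDomain (a M)) ⊆ V ∧
    ∀ (O : Set ℂ) (ℓ : ℂ → ℂ), IsLogBranch O ℓ → ∀ z ∈ O ∩ V,
      HasDerivAt (fun z' => potential ℓ R z' M) (S z M) z
  /-- The real part `w` of `W` is normalized by `u = |z|²/4 - w/2 = 0` on `∂Ω`. -/
  normalized : ∀ M ∈ U, ∀ (O : Set ℂ) (ℓ : ℂ → ℂ), IsLogBranch O ℓ →
    ∀ z ∈ O ∩ frontier (imageDomain (a M)), ‖z‖ ^ 2 / 4 - (potential ℓ R z M).re / 2 = 0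
  /-- The imaginary part of the constant `C(M)` is a smooth function which does not depend
  on `M₀`. -/
  imag : ∃ c : (Fin N → ℂ) → ℝ, ContDiffOn ℝ ∞ (fun M : Coord N => c M.2) U ∧
    ∀ M ∈ U, (R 0 M).im = c M.2

/-- `g` is the Green's function of `Ω` with pole at `p ∈ Ω`. -/
def IsGreenFunction (Ω : Set ℂ) (p : ℂ) (g : ℂ → ℝ) : Prop :=
  (∃ h : ℂ → ℝ, InnerProductSpace.HarmonicOnNhd h Ω ∧
    ∀ z ∈ Ω, z ≠ p → g z = -Real.log ‖z - p‖ + h z) ∧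
  ∀ b ∈ frontier Ω, Filter.Tendsto g (𝓝[Ω] b) (𝓝 0)

/-- The branch of `-log z + Γ(z;M)` given by the branch `ℓ` of the logarithm. -/
def greenBranch {N : ℕ} (ℓ : ℂ → ℂ) (Γ : ℂ → Coord N → ℂ) (z : ℂ) (M : Coord N) : ℂ :=
  -ℓ z + Γ z M

/-- `G = greenBranch ℓ Γ` is the complex Green's function `g + i *g` of `Ω_M` with pole at `0`
(continued analytically across `∂Ω`), where the additive constant in the conjugate `*g` is fixed
by requiring `G(z;M) + log z` to be real at `z = 0`. -/
structure IsComplexGreen {N : ℕ} (U : Set (Coord N)) (a : Coord N → Coord N)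
    (𝒟 : Set (ℂ × Coord N)) (Γ : ℂ → Coord N → ℂ) : Prop where
  holo : ∀ M ∈ U, DifferentiableOn ℂ (fun z => Γ z M) {z | (z, M) ∈ 𝒟}
  re_eq : ∀ M ∈ U, ∃ g : ℂ → ℝ, IsGreenFunction (imageDomain (a M)) 0 g ∧
    ∀ (O : Set ℂ) (ℓ : ℂ → ℂ), IsLogBranch O ℓ →
      ∀ z ∈ O ∩ imageDomain (a M), (greenBranch ℓ Γ z M).re = g z
  imag : ∀ M ∈ U, (Γ 0 M).im = 0

/-- The conformal map `f(ζ;M)`. -/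
def confMap {N : ℕ} (a : Coord N → Coord N) (ζ : ℂ) (M : Coord N) : ℂ :=
  polyMap (a M) ζ

/-- `H₀(ζ;M) = G(f(ζ;M);M)`. -/
def hamiltonianZero {N : ℕ} (a : Coord N → Coord N) (G : ℂ → Coord N → ℂ)
    (ζ : ℂ) (M : Coord N) : ℂ :=
  G (confMap a ζ M) M

/-- `H_{k+1}(ζ;M) = -∂W(z;M)/∂M_{k+1}` at `z = f(ζ;M)`; the derivative is taken with `z` fixed. -/
def hamiltonian {N : ℕ} (a : Coord N → Coord N) (W : ℂ → Coord N → ℂ) (k : Fin N)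
    (ζ : ℂ) (M : Coord N) : ℂ :=
  -dMoment k (W (confMap a ζ M)) M

end

end MomentEvolution

open MomentEvolution

/-! ### Complex analysis on disks: mean values, logarithms, removal of poles, univalence -/

namespace MomentEvolution

open Complex Metric Set Filter Real

/-! Write S(ζ) = conj f(1/conj ζ) for the Schwarz function in the uniformizing coordinate, f_v and
S_v for the changes of f and S when the coefficients move in direction v, and B_v = ζ(f' S_v - f_v
S') (`variation`). On the unit circle B_v = 2 Re(ζ f' conj f_v). The moment M_k is the circle
average of f^k ζf' conj f, and its derivative in direction v is the average of f^k B_v, because the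
two integrands differ by an exact term (`momentFun_smooth`).

B_v is a Laurent polynomial with a pole of order at most N at 0, and f has a simple zero there.
Averaging against f^k for k ≤ N is therefore triangular in the coefficients of ζ^0, ..., ζ^(-N). If
all these averages vanish, the function extends to 0 with value 0, and being real on the circle it
is zero (`eq_zero_of_circleAverage_pow_mul_eq_zero`). This principle has two uses. If all moments
are stationary in direction v, then B_v = 0, so f_v/(ζf') has real part 0 on the circle; it is
constant, and its value v_0/a_0 at 0 is real, so v = 0, and the inverse function theorem gives the
coordinates. In the direction ∂/∂M_0 the principle applied to B - 1 gives the string equation B = 1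
(`IsMomentChart.variation_eq_one`).

In the uniformizing coordinate W = M_0 log ζ + L + C, where L is the mean-zero Laurent polynomial
`laurentPot` and C(M) is `normConst`. The boundary normalization gives Re C and averaging over the
circle gives Im C, so C is smooth even though no regularity of R in M is assumed. At fixed z the
derivative of W in direction v is v.1 log ζ + D_v with D_v = ∂_v(L + C) - S f_v (`momentDeriv`), and
ζD_v' = B_v - v.1. For ∂/∂M_0 the string equation makes D constant and the normalization makes it 0.
Hence ∂W/∂M_0 = log ζ, while uniqueness of the Green's function gives G = -log ζ; the evolution of
an arbitrary φ follows at once.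

For H_k, symmetry of the second derivatives of L, C and f, combined with D = 0 in direction M_0,
gives ∂D_v/∂M_0 = S_v f_0 - S_0 f_v, the index 0 standing for ∂/∂M_0. In the bracket {f, D_v} the
terms with S_v cancel and -f_v B_0 = -f_v remains.

For existence, S, W and G are written down in ζ and carried over by the inverse of f. The same
triangular argument shows that the regular part of W has no pole at 0. -/

theorem circleAverage_eq_center {F : ℂ → ℂ} {ρ : ℝ} (hρ : 1 < ρ)
    (hF : DifferentiableOn ℂ F (ball 0 ρ)) : circleAverage F 0 1 = F 0 := by
  apply DiffContOnCl.circleAverage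
  apply DifferentiableOn.diffContOnCl
  rw [abs_one, closure_ball (0 : ℂ) one_ne_zero]
  exact hF.mono (closedBall_subset_ball hρ)

theorem eqOn_ball_of_eventuallyEq {F G : ℂ → ℂ} {ρ : ℝ} {z : ℂ}
    (hF : DifferentiableOn ℂ F (ball 0 ρ)) (hG : DifferentiableOn ℂ G (ball 0 ρ))
    (hz : z ∈ ball (0 : ℂ) ρ) (h : F =ᶠ[𝓝 z] G) : EqOn F G (ball 0 ρ) :=
  (hF.analyticOnNhd isOpen_ball).eqOn_of_preconnected_of_eventuallyEq
    (hG.analyticOnNhd isOpen_ball) (convex_ball _ _).isPreconnected hz h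

/-- The maximum principle for exp F and exp(-F) gives Re F = 0 on the unit disk, so F is constant
there, and by the identity theorem on the larger disk. -/
theorem eq_center_of_re_sphere_eq_zero {F : ℂ → ℂ} {ρ : ℝ} (hρ : 1 < ρ)
    (hF : DifferentiableOn ℂ F (ball 0 ρ)) (h : ∀ ζ : ℂ, ‖ζ‖ = 1 → (F ζ).re = 0) :
    ∀ ζ ∈ ball (0 : ℂ) ρ, F ζ = F 0 ∧ (F ζ).re = 0 := by
  have key : ∀ G : ℂ → ℂ, DifferentiableOn ℂ G (ball 0 ρ) → (∀ ζ : ℂ, ‖ζ‖ = 1 → (G ζ).re = 0) →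
      ∀ ζ ∈ ball (0 : ℂ) 1, (G ζ).re ≤ 0 := by
    intro G hG h1 ζ hζ
    have hd : DiffContOnCl ℂ (fun z => exp (G z)) (ball 0 1) := by
      apply DifferentiableOn.diffContOnCl
      rw [closure_ball (0 : ℂ) one_ne_zero]
      exact (hG.mono (closedBall_subset_ball hρ)).cexp
    have := norm_le_of_forall_mem_frontier_norm_le (isBounded_ball) hd (C := 1) (fun z hz => by
      rw [frontier_ball (0 : ℂ) one_ne_zero, mem_sphere_zero_iff_norm] at hz
      rw [norm_exp, h1 z hz, Real.exp_zero]) (subset_closure hζ)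
    rwa [norm_exp, Real.exp_le_one_iff] at this
  have hre : ∀ ζ ∈ ball (0 : ℂ) 1, (F ζ).re = 0 := by
    intro ζ hζ
    have h1 := key F hF h ζ hζ
    have h2 := key (fun z => -F z) hF.neg (fun z hz => by simp [h z hz]) ζ hζ
    simp at h2
    linarith
  have hsub : ball (0 : ℂ) 1 ⊆ ball 0 ρ := ball_subset_ball hρ.le
  obtain ⟨c, hc⟩ := ((hF.mono hsub).analyticOnNhd isOpen_ball).eq_const_of_re_eq_const
    (c₀ := 0) hre isOpen_ball ((convex_ball _ _).isConnected ⟨0, by simp⟩)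
  have h0 : (0 : ℂ) ∈ ball (0 : ℂ) 1 := by simp
  have hF0 : F 0 = c := hc 0 h0
  have heq : EqOn F (fun _ => F 0) (ball 0 ρ) :=
    eqOn_ball_of_eventuallyEq hF (differentiableOn_const _) (hsub h0) (by
      filter_upwards [isOpen_ball.mem_nhds h0] with z hz
      rw [hF0]; exact hc z hz)
  intro ζ hζ
  refine ⟨heq hζ, ?_⟩
  rw [heq hζ]; exact hre 0 h0

/-- Λ is the primitive of u'/u with value c at 0; then u exp(-Λ) has derivative zero and equals 1 at
0. -/
theorem exists_log_on_ball {u : ℂ → ℂ} {ρ : ℝ} (hρ : 0 < ρ) (hu : DifferentiableOn ℂ u (ball 0 ρ))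
    (h0 : ∀ ζ ∈ ball (0 : ℂ) ρ, u ζ ≠ 0) {c : ℂ} (hc : exp c = u 0) :
    ∃ Λ : ℂ → ℂ, DifferentiableOn ℂ Λ (ball 0 ρ) ∧ Λ 0 = c ∧
      ∀ ζ ∈ ball (0 : ℂ) ρ, exp (Λ ζ) = u ζ := by
  have hd : DifferentiableOn ℂ (fun ζ => deriv u ζ / u ζ) (ball 0 ρ) :=
    (hu.deriv isOpen_ball).div hu h0
  obtain ⟨Λ, hΛ0, hΛ⟩ := hd.isExactOn_ball.with_val_at 0 c
  have hΛd : DifferentiableOn ℂ Λ (ball 0 ρ) :=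
    fun z hz => (hΛ z hz).differentiableAt.differentiableWithinAt
  refine ⟨Λ, hΛd, hΛ0, ?_⟩
  have hder : ∀ z ∈ ball (0 : ℂ) ρ, HasDerivAt (fun z => u z * exp (-Λ z)) 0 z := by
    intro z hz
    have h1 := (hu.differentiableAt (isOpen_ball.mem_nhds hz)).hasDerivAt
    have := h0 z hz
    refine (HasDerivAt.fun_mul h1 ((hΛ z hz).fun_neg.cexp)).congr_deriv ?_
    field_simp
    ring
  intro ζ hζ
  have := (convex_ball (0 : ℂ) ρ).is_const_of_fderivWithin_eq_zero (𝕜 := ℂ)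
    (f := fun z => u z * exp (-Λ z))
    (fun z hz => (hder z hz).differentiableAt.differentiableWithinAt) (fun z hz => by
      have := ((hder z hz).hasFDerivAt.hasFDerivWithinAt (s := ball 0 ρ)).fderivWithin
        (isOpen_ball.uniqueDiffWithinAt hz)
      rw [this]; ext; simp) hζ (mem_ball_self hρ)
  simp only [hΛ0, ← hc, ← Complex.exp_add, add_neg_cancel, Complex.exp_zero] at this
  rw [Complex.exp_neg, mul_inv_eq_one₀ (Complex.exp_ne_zero _)] at this
  exact this.symm

/-- The triangular step. For k = n the powers of ζ cancel and the mean value property gives u(0)^n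
q(0) = 0, hence q(0) = 0. Dividing q by ζ lowers n by one and keeps the conditions for smaller k. -/
theorem exists_eq_pow_mul_of_circleAverage_eq_zero {u : ℂ → ℂ} {ρ : ℝ} (hρ : 1 < ρ)
    (hu : DifferentiableOn ℂ u (ball 0 ρ)) (hu0 : u 0 ≠ 0) (n : ℕ) :
    ∀ q : ℂ → ℂ, DifferentiableOn ℂ q (ball 0 ρ) →
    (∀ k ≤ n, circleAverage (fun ζ => (ζ * u ζ) ^ k * (q ζ / ζ ^ n)) 0 1 = 0) →
    ∃ p : ℂ → ℂ, DifferentiableOn ℂ p (ball 0 ρ) ∧ ∀ ζ ∈ ball (0 : ℂ) ρ, q ζ = ζ ^ (n + 1) * p ζ := by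
  have hball : ball (0 : ℂ) ρ ∈ 𝓝 (0 : ℂ) := ball_mem_nhds _ (by linarith)
  have step : ∀ (n : ℕ) (q : ℂ → ℂ), DifferentiableOn ℂ q (ball 0 ρ) →
      circleAverage (fun ζ => (ζ * u ζ) ^ n * (q ζ / ζ ^ n)) 0 1 = 0 →
      ∃ p : ℂ → ℂ, DifferentiableOn ℂ p (ball 0 ρ) ∧ ∀ ζ, q ζ = ζ * p ζ := by
    intro n q hq h
    have h1 : circleAverage (fun ζ => (ζ * u ζ) ^ n * (q ζ / ζ ^ n)) 0 1
        = circleAverage (fun ζ => u ζ ^ n * q ζ) 0 1 := by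
      apply circleAverage_congr_sphere
      intro z hz
      have : z ≠ 0 := by rintro rfl; simp at hz
      simp only []
      rw [mul_pow]; field_simp
    rw [h1, circleAverage_eq_center (F := fun ζ => u ζ ^ n * q ζ) hρ ((hu.pow n).mul hq)] at h
    have hq0 : q 0 = 0 := by simpa [hu0] using h
    refine ⟨dslope q 0, (differentiableOn_dslope hball).2 hq, fun ζ => ?_⟩
    have := sub_smul_dslope q 0 ζ
    simpa [hq0] using this.symm
  induction n with
  | zero =>
    intro q hq h
    obtain ⟨p, hp, hqp⟩ := step 0 q hq (h 0 le_rfl)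
    exact ⟨p, hp, fun ζ _ => by simpa using hqp ζ⟩
  | succ n ih =>
    intro q hq h
    obtain ⟨p, hp, hqp⟩ := step (n + 1) q hq (h _ le_rfl)
    obtain ⟨p', hp', hpp⟩ := ih p hp (fun k hk => by
      refine Eq.trans ?_ (h k (by omega))
      apply circleAverage_congr_sphere
      intro z hz
      have : z ≠ 0 := by rintro rfl; simp at hz
      simp only [hqp z]
      rw [pow_succ]; field_simp)
    exact ⟨p', hp', fun ζ hζ => by rw [hqp, hpp ζ hζ]; ring⟩

theorem isPreconnected_ball_diff_zero (ρ : ℝ) : IsPreconnected (ball (0 : ℂ) ρ \ {0}) := by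
  have : ball (0 : ℂ) ρ \ {0} =
      (fun p : ℝ × ℝ => (p.1 : ℂ) * exp (p.2 * I)) '' (Ioo 0 ρ ×ˢ univ) := by
    ext z
    constructor
    · rintro ⟨hz, hz0⟩
      refine ⟨(‖z‖, arg z), ⟨⟨norm_pos_iff.2 hz0, mem_ball_zero_iff.1 hz⟩, mem_univ _⟩, ?_⟩
      exact norm_mul_exp_arg_mul_I z
    · rintro ⟨⟨r, θ⟩, ⟨⟨h1, h2⟩, -⟩, rfl⟩
      refine ⟨?_, ?_⟩
      · simpa [abs_of_pos h1] using h2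
      · simp at h1 ⊢; exact h1.ne'
  rw [this]
  apply IsPreconnected.image
  · exact ((convex_Ioo _ _).prod convex_univ).isPreconnected
  · fun_prop

theorem eq_of_hasDerivAt_zero_punctured {F : ℂ → ℂ} {ρ : ℝ}
    (h : ∀ z ∈ ball (0 : ℂ) ρ, z ≠ 0 → HasDerivAt F 0 z) {z w : ℂ}
    (hz : z ∈ ball (0 : ℂ) ρ) (hz0 : z ≠ 0) (hw : w ∈ ball (0 : ℂ) ρ) (hw0 : w ≠ 0) : F z = F w := by
  have ho : IsOpen (ball (0 : ℂ) ρ \ {0}) := isOpen_ball.sdiff isClosed_singleton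
  exact ho.is_const_of_deriv_eq_zero (isPreconnected_ball_diff_zero ρ)
    (fun x hx => (h x hx.1 hx.2).differentiableAt.differentiableWithinAt)
    (fun x hx => (h x hx.1 hx.2).deriv) ⟨hz, hz0⟩ ⟨hw, hw0⟩

/-- At a critical point f - f(x) is a constant times the n-th power of a local coordinate with n ≥
2, so f takes equal values at points whose coordinates differ by an n-th root of unity. -/
theorem deriv_ne_zero_of_injOn {f : ℂ → ℂ} {V : Set ℂ} (hV : IsOpen V)
    (hf : DifferentiableOn ℂ f V) (hinj : InjOn f V) {x : ℂ} (hx : x ∈ V) : deriv f x ≠ 0 := by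
  intro hd
  have han : AnalyticAt ℂ (fun z => f z - f x) x :=
    ((hf.analyticOnNhd hV) x hx).sub analyticAt_const
  have hne : ¬ ∀ᶠ z in 𝓝 x, f z - f x = 0 := by
    intro h
    have h' : ∀ᶠ z in 𝓝[≠] x, z ∈ V ∧ f z - f x = 0 :=
      by
      filter_upwards [nhdsWithin_le_nhds (hV.mem_nhds hx), nhdsWithin_le_nhds h] with z h1 h2
      exact ⟨h1, h2⟩
    obtain ⟨z, ⟨hzV, hz⟩, hzx⟩ := (h'.and self_mem_nhdsWithin).exists
    exact hzx (hinj hzV hx (sub_eq_zero.1 hz))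
  obtain ⟨n, g, hg, hgx, hfg⟩ := han.exists_eventuallyEq_pow_smul_nonzero_iff.2 hne
  have hn0 : n ≠ 0 := by
    rintro rfl
    have := hfg.self_of_nhds
    simp at this
    exact hgx this.symm
  have hn1 : n ≠ 1 := by
    rintro rfl
    have h1 : HasDerivAt (fun z => (z - x) ^ 1 • g z) (g x) x := by
      have := HasDerivAt.fun_mul (((hasDerivAt_id x).sub_const x)) hg.differentiableAt.hasDerivAt
      simpa using this
    have h2 := (h1.congr_of_eventuallyEq hfg).deriv
    rw [deriv_sub_const, hd] at h2
    exact hgx h2.symm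
  -- The local coordinate: an n-th root of (f - f x)/g x, with derivative 1 at x and therefore
  -- locally onto a neighbourhood of 0.
  set w : ℂ → ℂ := fun z => (z - x) * exp (log (g z / g x) / n) with hw
  have hgd : HasStrictDerivAt (fun z => g z / g x) (deriv g x / g x) x :=
    hg.hasStrictDerivAt.div_const _
  have hwd : HasStrictDerivAt w 1 x := by
    have h1 := HasStrictDerivAt.fun_mul ((hasStrictDerivAt_id x).sub_const x)
      (HasStrictDerivAt.cexp ((HasStrictDerivAt.clog hgd (by simp [div_self hgx])).div_const
        (n : ℂ)))
    simpa [div_self hgx] using h1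
  have hcont : ContinuousAt (fun z => g z / g x) x := hgd.hasDerivAt.continuousAt
  have hslit : ∀ᶠ z in 𝓝 x, g z / g x ≠ 0 :=
    hcont.eventually_ne (by simp [hgx])
  have hpow : ∀ᶠ z in 𝓝 x, z ∈ V ∧ f z - f x = g x * w z ^ n := by
    filter_upwards [hfg, hslit, hV.mem_nhds hx] with z hz hz' hzV
    refine ⟨hzV, ?_⟩
    rw [hz, hw]
    simp only [smul_eq_mul, mul_pow, ← Complex.exp_nat_mul]
    rw [mul_div_cancel₀ _ (by exact_mod_cast hn0), exp_log hz']
    field_simp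
  have hmap : map w (𝓝 x) = 𝓝 0 := by
    have := hwd.map_nhds_eq one_ne_zero
    simpa [hw] using this
  have himg : w '' {z | z ∈ V ∧ f z - f x = g x * w z ^ n} ∈ 𝓝 (0 : ℂ) := by
    rw [← hmap]; exact image_mem_map hpow
  obtain ⟨ε, hε, hball⟩ := Metric.mem_nhds_iff.1 himg
  have hprim : IsPrimitiveRoot (exp (2 * π * I / n)) n := Complex.isPrimitiveRoot_exp n hn0
  have hmem : ∀ c : ℂ, ‖c‖ = 1 → ((ε / 2 : ℝ) : ℂ) * c ∈ ball (0 : ℂ) ε := by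
    intro c hc
    rw [mem_ball_zero_iff, norm_mul, hc, mul_one, norm_real, Real.norm_of_nonneg (by linarith)]
    linarith
  obtain ⟨z₁, ⟨h1V, h1⟩, hz₁⟩ := hball (hmem 1 (by simp))
  obtain ⟨z₂, ⟨h2V, h2⟩, hz₂⟩ := hball (hmem (exp (2 * π * I / n)) (hprim.norm'_eq_one hn0))
  have hfe : f z₁ = f z₂ := by
    rw [hz₁, mul_pow, one_pow] at h1
    rw [hz₂, mul_pow, hprim.pow_eq_one] at h2
    linear_combination h1 - h2
  have hzz := hinj h1V h2V hfe
  rw [← hzz, hz₁] at hz₂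
  have hε' : ((ε / 2 : ℝ) : ℂ) ≠ 0 := by exact_mod_cast (by linarith : ε / 2 ≠ 0)
  exact hprim.ne_one (by omega) (mul_left_cancel₀ hε' hz₂).symm

end MomentEvolution

/-! ### Differentiation under the integral sign -/

namespace MomentEvolution

open Complex Metric Set Filter Real MeasureTheory

section Parametric

universe u

theorem hasFDerivAt_intervalIntegral_of_contDiffOn {E F : Type*} [NormedAddCommGroup E]
    [NormedSpace ℝ E] [NormedAddCommGroup F] [NormedSpace ℝ F] {U : Set E} (hU : IsOpen U)
    {φ : E × ℝ → F} (hφ : ContDiffOn ℝ 1 φ (U ×ˢ univ)) (a b : ℝ) {x : E} (hx : x ∈ U) :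
    HasFDerivAt (fun y => ∫ θ in a..b, φ (y, θ))
      (∫ θ in a..b, (fderiv ℝ φ (x, θ)).comp (ContinuousLinearMap.inl ℝ E ℝ)) x := by
  have hO : IsOpen (U ×ˢ (univ : Set ℝ)) := hU.prod isOpen_univ
  have hcont : ContinuousOn (fun p => (fderiv ℝ φ p).comp (ContinuousLinearMap.inl ℝ E ℝ))
      (U ×ˢ univ) :=
    (hφ.continuousOn_fderiv_of_isOpen hO le_rfl).clm_comp continuousOn_const
  have hslice : ∀ y ∈ U, Continuous fun θ => φ (y, θ) := fun y hy =>
    hφ.continuousOn.comp_continuous (by fun_prop) fun θ => ⟨hy, mem_univ _⟩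
  have hslice' : Continuous fun θ => (fderiv ℝ φ (x, θ)).comp (ContinuousLinearMap.inl ℝ E ℝ) :=
    hcont.comp_continuous (f := fun θ : ℝ => (x, θ)) (by fun_prop) fun θ => ⟨hx, mem_univ _⟩
  obtain ⟨C, hC⟩ := (isCompact_uIcc (a := a) (b := b)).exists_bound_of_continuousOn
    hslice'.continuousOn
  set n : Set (E × ℝ) := {p ∈ U ×ˢ (univ : Set ℝ) |
    ‖(fderiv ℝ φ p).comp (ContinuousLinearMap.inl ℝ E ℝ)‖ < C + 1} with hn
  have hnO : IsOpen n := hcont.norm.isOpen_inter_preimage hO isOpen_Iio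
  -- Compactness of the interval of integration turns the bound on the slice over x into one bound
  -- valid for all nearby parameters: the dominating function.
  obtain ⟨V, W, hV, -, hxV, hW, hVW⟩ := generalized_tube_lemma (isCompact_singleton (x := x))
    (isCompact_uIcc (a := a) (b := b)) hnO (by
      rintro ⟨y, θ⟩ ⟨hy, hθ⟩
      obtain rfl : y = x := hy
      exact ⟨⟨hx, mem_univ _⟩, (hC θ hθ).trans_lt (lt_add_one C)⟩)
  apply intervalIntegral.hasFDerivAt_integral_of_dominated_of_fderiv_le (bound := fun _ => C + 1)
    (F' := fun y θ => (fderiv ℝ φ (y, θ)).comp (ContinuousLinearMap.inl ℝ E ℝ))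
    (hV.mem_nhds (hxV rfl))
  · filter_upwards [hU.mem_nhds hx] with y hy
    exact (hslice y hy).aestronglyMeasurable
  · exact (hslice x hx).intervalIntegrable _ _
  · exact hslice'.aestronglyMeasurable
  · refine Eventually.of_forall fun θ hθ y hy => ?_
    have hm : (y, θ) ∈ V ×ˢ W := ⟨hy, hW (uIoc_subset_uIcc hθ)⟩
    exact (hVW hm).2.le
  · exact intervalIntegrable_const
  · refine Eventually.of_forall fun θ hθ y hy => ?_
    have hm : (y, θ) ∈ V ×ˢ W := ⟨hy, hW (uIoc_subset_uIcc hθ)⟩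
    have hmem := (hVW hm).1
    have h1 : HasFDerivAt φ (fderiv ℝ φ (y, θ)) (y, θ) :=
      ((hφ.contDiffAt (hO.mem_nhds hmem)).differentiableAt one_ne_zero).hasFDerivAt
    exact h1.comp y ((hasFDerivAt_id y).prodMk (hasFDerivAt_const θ y))

/-- Induction on the order, with the target space quantified inside, since the derivative takes
values in E →L[ℝ] F. E and F share a universe so that this space is again an admissible target. -/
theorem contDiffOn_intervalIntegral {E : Type u} [NormedAddCommGroup E]
    [NormedSpace ℝ E] {U : Set E} (hU : IsOpen U) (a b : ℝ) (n : ℕ) :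
    ∀ {F : Type u} [NormedAddCommGroup F] [NormedSpace ℝ F] {φ : E × ℝ → F},
      ContDiffOn ℝ ∞ φ (U ×ˢ univ) → ContDiffOn ℝ n (fun y => ∫ θ in a..b, φ (y, θ)) U := by
  have hO : IsOpen (U ×ˢ (univ : Set ℝ)) := hU.prod isOpen_univ
  induction n with
  | zero =>
    intro F _ _ φ hφ
    refine contDiffOn_zero.2 fun x hx => ?_
    exact (hasFDerivAt_intervalIntegral_of_contDiffOn hU (hφ.of_le (by simp)) a b
      hx).continuousAt.continuousWithinAt
  | succ n ih =>
    intro F _ _ φ hφ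
    have hd := fun x (hx : x ∈ U) => hasFDerivAt_intervalIntegral_of_contDiffOn hU
      (hφ.of_le (by simp)) a b hx
    push_cast
    rw [contDiffOn_succ_iff_fderiv_of_isOpen hU]
    refine ⟨fun x hx => (hd x hx).differentiableAt.differentiableWithinAt, by simp, ?_⟩
    refine ContDiffOn.congr (ih (φ := fun p => (fderiv ℝ φ p).comp
      (ContinuousLinearMap.inl ℝ E ℝ)) ?_) fun x hx => (hd x hx).fderiv
    exact (hφ.fderiv_of_isOpen hO (by simp)).clm_comp contDiffOn_const

end Parametric

theorem circleAverage_hasFDerivAt {E : Type} [NormedAddCommGroup E] [NormedSpace ℝ E] {U : Set E}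
    (hU : IsOpen U) {φ : E → ℂ → ℂ}
    (hφ : ContDiffOn ℝ ∞ (fun p : E × ℝ => φ p.1 (circleMap 0 1 p.2)) (U ×ˢ univ)) :
    ContDiffOn ℝ ∞ (fun y => circleAverage (φ y) 0 1) U ∧
    ∀ x ∈ U, ∀ v, fderiv ℝ (fun y => circleAverage (φ y) 0 1) x v =
      circleAverage (fun ζ => fderiv ℝ (fun y => φ y ζ) x v) 0 1 := by
  have hO : IsOpen (U ×ˢ (univ : Set ℝ)) := hU.prod isOpen_univ
  refine ⟨?_, ?_⟩
  · refine contDiffOn_infty.2 fun n => ?_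
    exact (contDiffOn_intervalIntegral hU 0 (2 * π) n hφ).const_smul _
  · intro x hx v
    have h1 := (hasFDerivAt_intervalIntegral_of_contDiffOn hU (hφ.of_le (by simp)) 0 (2 * π)
      hx)
    have h2 : ∀ θ : ℝ, HasFDerivAt (fun y => φ y (circleMap 0 1 θ))
        ((fderiv ℝ (fun p : E × ℝ => φ p.1 (circleMap 0 1 p.2)) (x, θ)).comp
          (ContinuousLinearMap.inl ℝ E ℝ)) x := by
      intro θ
      have h1 : HasFDerivAt (fun p : E × ℝ => φ p.1 (circleMap 0 1 p.2)) _ (x, θ) :=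
        ((hφ.contDiffAt (hO.mem_nhds (x := (x, θ)) ⟨hx, mem_univ θ⟩)).differentiableAt
          (by simp)).hasFDerivAt
      have h2 : HasFDerivAt (fun y : E => (y, θ)) (ContinuousLinearMap.inl ℝ E ℝ) x :=
        (hasFDerivAt_id x).prodMk (hasFDerivAt_const θ x)
      exact HasFDerivAt.comp (f := fun y : E => (y, θ)) x h1 h2
    have hint : IntervalIntegrable (fun θ =>
        (fderiv ℝ (fun p : E × ℝ => φ p.1 (circleMap 0 1 p.2)) (x, θ)).comp
          (ContinuousLinearMap.inl ℝ E ℝ)) volume 0 (2 * π) := by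
      apply Continuous.intervalIntegrable
      have hc := ((hφ.continuousOn_fderiv_of_isOpen hO (by simp)).clm_comp
        (continuousOn_const (c := ContinuousLinearMap.inl ℝ E ℝ)))
      exact hc.comp_continuous (f := fun θ : ℝ => (x, θ)) (by fun_prop) fun θ => ⟨hx, mem_univ _⟩
    have h3 := (h1.const_smul (2 * π)⁻¹).fderiv
    have h4 : fderiv ℝ (fun y => circleAverage (φ y) 0 1) x = _ := h3
    rw [h4, smul_apply, ContinuousLinearMap.intervalIntegral_apply hint,
      circleAverage]
    congr 1
    apply intervalIntegral.integral_congr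
    intro θ _
    simp only [(h2 θ).fderiv]

end MomentEvolution

/-! ### The polynomials, their Schwarz functions, and averages over the circle -/

namespace MomentEvolution

open Complex Metric Set Filter Real MeasureTheory

variable {N : ℕ}

/-- All coefficients `a₀, …, a_N` as complex numbers. -/
noncomputable def coef (a : Coord N) : Fin (N + 1) → ℂ := Fin.cons (a.1 : ℂ) a.2

/-- The derivative of `polyMap a`. -/
noncomputable def polyDeriv (a : Coord N) (ζ : ℂ) : ℂ :=
  ∑ j : Fin (N + 1), coef a j * (((j : ℕ) + 1) * ζ ^ (j : ℕ))

/-- The quotient `polyMap a ζ / ζ`. -/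
noncomputable def polyQuot (a : Coord N) (ζ : ℂ) : ℂ :=
  ∑ j : Fin (N + 1), coef a j * ζ ^ (j : ℕ)

/-- The Schwarz function in the uniformizing coordinate: `conj (f (1 / conj ζ))`. -/
noncomputable def schwarz (a : Coord N) (ζ : ℂ) : ℂ :=
  ∑ j : Fin (N + 1), starRingEnd ℂ (coef a j) * (ζ⁻¹) ^ ((j : ℕ) + 1)

/-- The derivative of `schwarz a`. -/
noncomputable def schwarzDeriv (a : Coord N) (ζ : ℂ) : ℂ :=
  -∑ j : Fin (N + 1), starRingEnd ℂ (coef a j) * (((j : ℕ) + 1) * (ζ⁻¹) ^ ((j : ℕ) + 2))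

@[simp] theorem coef_zero (a : Coord N) : coef a 0 = a.1 := rfl

@[simp] theorem coef_succ (a : Coord N) (j : Fin N) : coef a j.succ = a.2 j := rfl

@[simp] theorem coef_add (a b : Coord N) (j : Fin (N + 1)) : coef (a + b) j = coef a j + coef b j := by
  refine Fin.cases ?_ (fun i => ?_) j <;> simp

@[simp] theorem coef_smul (c : ℝ) (a : Coord N) (j : Fin (N + 1)) :
    coef (c • a) j = c * coef a j := by
  refine Fin.cases ?_ (fun i => ?_) j <;> simp

theorem coef_injective : Function.Injective (coef (N := N)) := by
  intro a b h
  refine Prod.ext ?_ (funext fun j => ?_)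
  · simpa using congrFun h 0
  · exact congrFun h j.succ

theorem polyMap_eq_sum (a : Coord N) (ζ : ℂ) :
    polyMap a ζ = ∑ j : Fin (N + 1), coef a j * ζ ^ ((j : ℕ) + 1) := by
  rw [Fin.sum_univ_succ]; simp [polyMap]

theorem polyMap_eq_mul (a : Coord N) (ζ : ℂ) : polyMap a ζ = ζ * polyQuot a ζ := by
  rw [polyMap_eq_sum, polyQuot, Finset.mul_sum]
  exact Finset.sum_congr rfl fun j _ => by ring

@[simp] theorem polyMap_zero (a : Coord N) : polyMap a 0 = 0 := by simp [polyMap_eq_mul]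

@[simp] theorem polyQuot_zero (a : Coord N) : polyQuot a 0 = a.1 := by
  rw [polyQuot, Fin.sum_univ_succ]; simp

@[simp] theorem polyDeriv_zero (a : Coord N) : polyDeriv a 0 = a.1 := by
  rw [polyDeriv, Fin.sum_univ_succ]; simp

theorem hasDerivAt_polyMap (a : Coord N) (ζ : ℂ) : HasDerivAt (polyMap a) (polyDeriv a ζ) ζ := by
  have : polyMap a = fun z => ∑ j : Fin (N + 1), coef a j * z ^ ((j : ℕ) + 1) :=
    funext (polyMap_eq_sum a)
  rw [this]
  refine (HasDerivAt.fun_sum (A' := fun j : Fin (N + 1) => coef a j * (((j : ℕ) + 1) * ζ ^ (j : ℕ)))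
    fun j _ => ?_)
  simpa using (hasDerivAt_pow ((j : ℕ) + 1) ζ).const_mul (coef a j)

theorem hasDerivAt_schwarz (a : Coord N) {ζ : ℂ} (hζ : ζ ≠ 0) :
    HasDerivAt (schwarz a) (schwarzDeriv a ζ) ζ := by
  unfold schwarz schwarzDeriv
  rw [← Finset.sum_neg_distrib]
  refine (HasDerivAt.fun_sum fun j _ => ?_)
  refine (((hasDerivAt_inv hζ).fun_pow ((j : ℕ) + 1)).const_mul
    (starRingEnd ℂ (coef a j))).congr_deriv ?_
  simp only [Nat.add_sub_cancel, pow_add, inv_pow]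
  push_cast
  ring

theorem differentiable_polyMap (a : Coord N) : Differentiable ℂ (polyMap a) :=
  fun ζ => (hasDerivAt_polyMap a ζ).differentiableAt

theorem differentiable_polyDeriv (a : Coord N) : Differentiable ℂ (polyDeriv a) := by
  unfold polyDeriv; fun_prop

theorem differentiable_polyQuot (a : Coord N) : Differentiable ℂ (polyQuot a) := by
  unfold polyQuot; fun_prop

/-- `schwarz a` is a polynomial in 1/ζ of degree at most N + 1, which bounds its pole at 0. -/
theorem differentiable_pow_mul_schwarz (a : Coord N) :
    ∃ P : ℂ → ℂ, Differentiable ℂ P ∧ ∀ ζ ≠ 0, ζ ^ (N + 1) * schwarz a ζ = P ζ := by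
  refine ⟨fun ζ => ∑ j : Fin (N + 1), starRingEnd ℂ (coef a j) * ζ ^ (N - (j : ℕ)), by fun_prop, ?_⟩
  intro ζ hζ
  simp only [schwarz, Finset.mul_sum]
  refine Finset.sum_congr rfl fun j _ => ?_
  have hj : N + 1 = (N - (j : ℕ)) + ((j : ℕ) + 1) := by have := j.2; omega
  have h2 : ζ ^ (N + 1) = ζ ^ (N - (j : ℕ)) * ζ ^ ((j : ℕ) + 1) := by rw [← pow_add, ← hj]
  rw [h2, inv_pow]
  field_simp

theorem conj_eq_inv {ζ : ℂ} (hζ : ‖ζ‖ = 1) : starRingEnd ℂ ζ = ζ⁻¹ := by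
  rw [Complex.inv_def, Complex.normSq_eq_norm_sq, hζ]; simp

theorem ne_zero_of_norm_eq_one {ζ : ℂ} (hζ : ‖ζ‖ = 1) : ζ ≠ 0 := by
  rintro rfl; simp at hζ

theorem schwarz_eq_conj (a : Coord N) {ζ : ℂ} (hζ : ‖ζ‖ = 1) :
    schwarz a ζ = starRingEnd ℂ (polyMap a ζ) := by
  simp [schwarz, polyMap_eq_sum, conj_eq_inv hζ]

theorem mul_schwarzDeriv_eq_conj (a : Coord N) {ζ : ℂ} (hζ : ‖ζ‖ = 1) :
    ζ * schwarzDeriv a ζ = -starRingEnd ℂ (ζ * polyDeriv a ζ) := by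
  have h0 := ne_zero_of_norm_eq_one hζ
  simp only [schwarzDeriv, polyDeriv, map_mul, map_sum, map_pow, map_add, map_natCast, map_one,
    conj_eq_inv hζ, mul_neg, Finset.mul_sum]
  congr 1
  refine Finset.sum_congr rfl fun j _ => ?_
  simp only [pow_add, inv_pow]
  field_simp

section Linear

theorem polyMap_add (a b : Coord N) (ζ : ℂ) : polyMap (a + b) ζ = polyMap a ζ + polyMap b ζ := by
  simp [polyMap_eq_sum, add_mul, Finset.sum_add_distrib]

theorem polyMap_smul (c : ℝ) (a : Coord N) (ζ : ℂ) : polyMap (c • a) ζ = c * polyMap a ζ := by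
  simp [polyMap_eq_sum, mul_assoc, Finset.mul_sum]

theorem polyDeriv_add (a b : Coord N) (ζ : ℂ) :
    polyDeriv (a + b) ζ = polyDeriv a ζ + polyDeriv b ζ := by
  simp [polyDeriv, add_mul, Finset.sum_add_distrib]

theorem polyDeriv_smul (c : ℝ) (a : Coord N) (ζ : ℂ) :
    polyDeriv (c • a) ζ = c * polyDeriv a ζ := by
  simp [polyDeriv, mul_assoc, Finset.mul_sum]

theorem schwarz_add (a b : Coord N) (ζ : ℂ) : schwarz (a + b) ζ = schwarz a ζ + schwarz b ζ := by
  simp [schwarz, add_mul, Finset.sum_add_distrib]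

theorem schwarz_smul (c : ℝ) (a : Coord N) (ζ : ℂ) : schwarz (c • a) ζ = c * schwarz a ζ := by
  simp [schwarz, mul_assoc, Finset.mul_sum]

/-- `coef` as a continuous real-linear map. -/
noncomputable def coefL (j : Fin (N + 1)) : Coord N →L[ℝ] ℂ :=
  LinearMap.toContinuousLinearMap
    { toFun := fun a => coef a j
      map_add' := fun a b => coef_add a b j
      map_smul' := fun c a => by simp }

/-- `polyMap` as a continuous real-linear map of the coefficients. -/
noncomputable def polyMapL (ζ : ℂ) : Coord N →L[ℝ] ℂ :=
  LinearMap.toContinuousLinearMap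
    { toFun := fun a => polyMap a ζ
      map_add' := fun a b => polyMap_add a b ζ
      map_smul' := fun c a => by simp [polyMap_smul] }

/-- `polyDeriv` as a continuous real-linear map of the coefficients. -/
noncomputable def polyDerivL (ζ : ℂ) : Coord N →L[ℝ] ℂ :=
  LinearMap.toContinuousLinearMap
    { toFun := fun a => polyDeriv a ζ
      map_add' := fun a b => polyDeriv_add a b ζ
      map_smul' := fun c a => by simp [polyDeriv_smul] }

/-- `schwarz` as a continuous real-linear map of the coefficients. -/
noncomputable def schwarzL (ζ : ℂ) : Coord N →L[ℝ] ℂ :=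
  LinearMap.toContinuousLinearMap
    { toFun := fun a => schwarz a ζ
      map_add' := fun a b => schwarz_add a b ζ
      map_smul' := fun c a => by simp [schwarz_smul] }

@[simp] theorem coefL_apply (j : Fin (N + 1)) (a : Coord N) : coefL j a = coef a j := rfl
@[simp] theorem polyMapL_apply (ζ : ℂ) (a : Coord N) : polyMapL ζ a = polyMap a ζ := rfl
@[simp] theorem polyDerivL_apply (ζ : ℂ) (a : Coord N) : polyDerivL ζ a = polyDeriv a ζ := rfl
@[simp] theorem schwarzL_apply (ζ : ℂ) (a : Coord N) : schwarzL ζ a = schwarz a ζ := rfl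

end Linear

section Smooth

@[fun_prop]
theorem contDiff_coef {n : WithTop ℕ∞} (j : Fin (N + 1)) :
    ContDiff ℝ n (fun a : Coord N => coef a j) := (coefL j).contDiff

theorem contDiff_polyMap {n : WithTop ℕ∞} :
    ContDiff ℝ n (fun p : Coord N × ℂ => polyMap p.1 p.2) := by
  simp only [polyMap_eq_sum]
  refine ContDiff.sum fun j _ => ?_
  exact ((contDiff_coef j).comp contDiff_fst).mul (contDiff_snd.pow _)

theorem contDiff_polyQuot {n : WithTop ℕ∞} :
    ContDiff ℝ n (fun p : Coord N × ℂ => polyQuot p.1 p.2) := by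
  unfold polyQuot
  refine ContDiff.sum fun j _ => ?_
  exact ((contDiff_coef j).comp contDiff_fst).mul (contDiff_snd.pow _)

theorem contDiff_polyDeriv {n : WithTop ℕ∞} :
    ContDiff ℝ n (fun p : Coord N × ℂ => polyDeriv p.1 p.2) := by
  unfold polyDeriv
  refine ContDiff.sum fun j _ => ?_
  exact ((contDiff_coef j).comp contDiff_fst).mul (contDiff_const.mul (contDiff_snd.pow _))

end Smooth

theorem circleIntegrable_of_continuousOn {F : ℂ → ℂ} (hF : ContinuousOn F (sphere 0 1)) :
    CircleIntegrable F 0 1 := hF.circleIntegrable zero_le_one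

/-- The average of ζF' is the contour integral of dF divided by 2πi. All integrations by parts on
the circle go through this. -/
theorem circleAverage_mul_deriv_eq_zero {F F' : ℂ → ℂ}
    (h : ∀ ζ : ℂ, ‖ζ‖ = 1 → HasDerivAt F (F' ζ) ζ) :
    circleAverage (fun ζ => ζ * F' ζ) 0 1 = 0 := by
  rw [circleAverage_eq_circleIntegral one_ne_zero]
  have h1 : (∮ z in C(0, 1), (z - 0)⁻¹ • (z * F' z)) = ∮ z in C(0, 1), F' z := by
    apply circleIntegral.integral_congr zero_le_one
    intro z hz
    have : z ≠ 0 := ne_zero_of_norm_eq_one (by simpa using hz)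
    simp [this]
  rw [h1, circleIntegral.integral_eq_zero_of_hasDerivWithinAt (f := F) zero_le_one, smul_zero]
  intro z hz
  exact (h z (by simpa using hz)).hasDerivWithinAt

theorem circleAverage_zpow {n : ℤ} (hn : n ≠ 0) : circleAverage (fun ζ : ℂ => ζ ^ n) 0 1 = 0 := by
  have hn' : (n : ℂ) ≠ 0 := by exact_mod_cast hn
  have := circleAverage_mul_deriv_eq_zero (F := fun ζ => ζ ^ n / n)
    (F' := fun ζ => ζ ^ (n - 1)) (fun ζ hζ => by
      refine ((hasDerivAt_zpow n ζ (Or.inl (ne_zero_of_norm_eq_one hζ))).div_const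
        (n : ℂ)).congr_deriv ?_
      field_simp)
  refine Eq.trans ?_ this
  apply circleAverage_congr_sphere
  intro ζ hζ
  have h0 : ζ ≠ 0 := ne_zero_of_norm_eq_one (by simpa using hζ)
  simp only []
  rw [zpow_sub_one₀ h0]; field_simp

end MomentEvolution

/-! ### Harmonic moments as circle averages -/

namespace MomentEvolution

open Complex Metric Set Filter Real MeasureTheory

variable {N : ℕ}

theorem circleAverage_pow_mul_conj_pow_of_ne {i j : ℕ} (h : i ≠ j) :
    circleAverage (fun ζ : ℂ => ζ ^ i * starRingEnd ℂ ζ ^ j) 0 1 = 0 := by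
  have hn : (i : ℤ) - j ≠ 0 := by omega
  refine Eq.trans ?_ (circleAverage_zpow hn)
  apply circleAverage_congr_sphere
  intro ζ hζ
  have h1 : ‖ζ‖ = 1 := by simpa using hζ
  simp only [conj_eq_inv h1, zpow_sub₀ (ne_zero_of_norm_eq_one h1), zpow_natCast, inv_pow,
    div_eq_mul_inv]

/-- In polar coordinates the radial factor is 1/(i + j + 2). It may be replaced by 1/(2(j + 1))
because the angular factor vanishes unless i = j. -/
theorem integral_ball_pow_mul_conj_pow (i j : ℕ) :
    ∫ z in ball (0 : ℂ) 1, z ^ i * starRingEnd ℂ z ^ j =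
      (π / (j + 1) : ℂ) * circleAverage (fun ζ : ℂ => ζ ^ i * starRingEnd ℂ ζ ^ j) 0 1 := by
  set e : ℝ → ℂ := fun θ => circleMap 0 1 θ with he
  have h1 : ∫ z in ball (0 : ℂ) 1, z ^ i * starRingEnd ℂ z ^ j =
      ∫ p in Ioi (0 : ℝ) ×ˢ Ioo (-π) π,
        ((Iio (1 : ℝ)).indicator (fun r => ((r ^ (i + j + 1) : ℝ) : ℂ)) p.1) *
          (e p.2 ^ i * starRingEnd ℂ (e p.2) ^ j) := by
    rw [← integral_indicator measurableSet_ball, ← Complex.integral_comp_polarCoord_symm]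
    change ∫ p in Ioi (0 : ℝ) ×ˢ Ioo (-π) π, _ = _
    apply setIntegral_congr_fun (measurableSet_Ioi.prod measurableSet_Ioo)
    rintro ⟨r, θ⟩ ⟨hr, -⟩
    have hr' : 0 < r := hr
    have hz : Complex.polarCoord.symm (r, θ) = r * e θ := by
      simp [he, circleMap, Complex.exp_mul_I]
    have hn : ‖(r : ℂ) * e θ‖ = r := by simp [he, abs_of_pos hr']
    simp only [hz]
    by_cases h : r < 1
    · rw [indicator_of_mem (by rw [mem_ball_zero_iff, hn]; exact h), indicator_of_mem (by exact h)]
      simp only [map_mul, conj_ofReal, real_smul]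
      push_cast
      ring
    · rw [indicator_of_notMem (by rw [mem_ball_zero_iff, hn]; exact h),
        indicator_of_notMem (by exact h)]
      simp
  have h2 : ∫ r in Ioi (0 : ℝ), ((Iio (1 : ℝ)).indicator (fun r => ((r ^ (i + j + 1) : ℝ) : ℂ)) r)
      = 1 / (i + j + 2) := by
    rw [setIntegral_indicator measurableSet_Iio, Ioi_inter_Iio, ← integral_Ioc_eq_integral_Ioo,
      ← intervalIntegral.integral_of_le zero_le_one, intervalIntegral.integral_ofReal, integral_pow]
    push_cast
    ring
  have h3 : ∫ θ in Ioo (-π) π, (e θ ^ i * starRingEnd ℂ (e θ) ^ j) =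
      2 * π * circleAverage (fun ζ : ℂ => ζ ^ i * starRingEnd ℂ ζ ^ j) 0 1 := by
    rw [circleAverage_eq_integral_add (-π),
      intervalIntegral.integral_comp_add_right
        (fun θ => circleMap 0 1 θ ^ i * starRingEnd ℂ (circleMap 0 1 θ) ^ j), zero_add,
      show 2 * π + -π = π by ring, intervalIntegral.integral_of_le (by linarith [pi_pos]),
      integral_Ioc_eq_integral_Ioo]
    rw [real_smul]
    push_cast
    have : (π : ℂ) ≠ 0 := by exact_mod_cast pi_ne_zero
    field_simp
    rfl
  rw [h1, Measure.volume_eq_prod, setIntegral_prod_mul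
    (fun r : ℝ => (Iio (1 : ℝ)).indicator (fun r => ((r ^ (i + j + 1) : ℝ) : ℂ)) r)
    (fun θ : ℝ => e θ ^ i * starRingEnd ℂ (e θ) ^ j), h2, h3]
  by_cases hij : i = j
  · subst hij
    have : (i : ℂ) + 1 ≠ 0 := by exact_mod_cast Nat.succ_ne_zero i
    rw [show (i : ℂ) + i + 2 = 2 * (i + 1) by ring]
    field_simp
  · rw [circleAverage_pow_mul_conj_pow_of_ne hij]; simp

/-- Green's formula on the disk, conj f' being the ∂/∂(conj z)-derivative of conj f; it is checked
on monomials. -/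
theorem integral_ball_mul_conj_polyDeriv (P : Polynomial ℂ) (a : Coord N) :
    (1 / (π : ℂ)) * ∫ z in ball (0 : ℂ) 1, P.eval z * starRingEnd ℂ (polyDeriv a z) =
      circleAverage (fun ζ => P.eval ζ * (ζ * starRingEnd ℂ (polyMap a ζ))) 0 1 := by
  have hπ : (π : ℂ) ≠ 0 := by exact_mod_cast pi_ne_zero
  have e1 : ∀ z : ℂ, P.eval z * starRingEnd ℂ (polyDeriv a z) =
      ∑ i ∈ Finset.range (P.natDegree + 1), ∑ j : Fin (N + 1),
        (P.coeff i * starRingEnd ℂ (coef a j) * ((j : ℕ) + 1)) *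
          (z ^ i * starRingEnd ℂ z ^ (j : ℕ)) := by
    intro z
    rw [Polynomial.eval_eq_sum_range, polyDeriv, map_sum, Finset.sum_mul_sum]
    refine Finset.sum_congr rfl fun i _ => Finset.sum_congr rfl fun j _ => ?_
    simp only [map_mul, map_pow, map_add, map_natCast, map_one]
    ring
  have e2 : ∀ z ∈ sphere (0 : ℂ) |1|, P.eval z * (z * starRingEnd ℂ (polyMap a z)) =
      ∑ i ∈ Finset.range (P.natDegree + 1), ∑ j : Fin (N + 1),
        (P.coeff i * starRingEnd ℂ (coef a j)) * (z ^ i * starRingEnd ℂ z ^ (j : ℕ)) := by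
    intro z hz
    have hz1 : ‖z‖ = 1 := by simpa using hz
    rw [Polynomial.eval_eq_sum_range, polyMap_eq_sum, map_sum, Finset.mul_sum, Finset.sum_mul_sum]
    refine Finset.sum_congr rfl fun i _ => Finset.sum_congr rfl fun j _ => ?_
    simp only [map_mul, map_pow, conj_eq_inv hz1, pow_succ]
    have := ne_zero_of_norm_eq_one hz1
    field_simp
  have hint : ∀ i j : ℕ, IntegrableOn (fun z : ℂ => z ^ i * starRingEnd ℂ z ^ j)
      (ball (0 : ℂ) 1) := fun i j =>
    (ContinuousOn.integrableOn_compact (isCompact_closedBall _ _)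
      (by fun_prop)).mono_set ball_subset_closedBall
  have hint' : ∀ i j : ℕ, CircleIntegrable (fun z : ℂ => z ^ i * starRingEnd ℂ z ^ j) 0 1 :=
    fun i j => circleIntegrable_of_continuousOn (by fun_prop)
  rw [circleAverage_congr_sphere e2]
  simp_rw [e1]
  have hint2 : ∀ i ∈ Finset.range (P.natDegree + 1), ∀ j : Fin (N + 1), IntegrableOn (fun z : ℂ =>
      P.coeff i * starRingEnd ℂ (coef a j) * ((j : ℕ) + 1) *
        (z ^ i * starRingEnd ℂ z ^ (j : ℕ))) (ball (0 : ℂ) 1) := fun i _ j =>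
    (hint i j).const_mul _
  rw [integral_finsetSum _ fun i hi => integrable_finsetSum _ fun j _ => hint2 i hi j,
    Finset.mul_sum]
  rw [circleAverage_fun_sum fun i _ => ?_]
  · refine Finset.sum_congr rfl fun i hi => ?_
    rw [integral_finsetSum _ fun j _ => hint2 i hi j, Finset.mul_sum,
      circleAverage_fun_sum fun j _ => ?_]
    · refine Finset.sum_congr rfl fun j _ => ?_
      rw [integral_const_mul, integral_ball_pow_mul_conj_pow]
      have := circleAverage_fun_smul (c := 0) (R := 1) (a := P.coeff i * starRingEnd ℂ (coef a j))
        (f := fun z : ℂ => z ^ i * starRingEnd ℂ z ^ (j : ℕ))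
      simp only [smul_eq_mul] at this
      rw [this]
      have hj : ((j : ℕ) : ℂ) + 1 ≠ 0 := by exact_mod_cast Nat.succ_ne_zero (j : ℕ)
      field_simp
    · exact circleIntegrable_of_continuousOn (by fun_prop)
  · exact circleIntegrable_of_continuousOn (by fun_prop)

/-- The moments as functions of the coefficients. -/
noncomputable def momentFun (k : ℕ) (a : Coord N) : ℂ :=
  circleAverage (fun ζ => polyMap a ζ ^ k * (ζ * polyDeriv a ζ) * starRingEnd ℂ (polyMap a ζ)) 0 1

/-- Change of variables by f has real Jacobian |f'|² = f' conj f'. This leaves the polynomial f^k f'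
times conj f', to which Green's formula applies. -/
theorem harmonicMoment_eq_momentFun {a : Coord N} (ha : InjOn (polyMap a) (ball 0 1)) (k : ℕ) :
    harmonicMoment (imageDomain a) k = momentFun k a := by
  have hd : ∀ z ∈ ball (0 : ℂ) 1, HasFDerivWithinAt (polyMap a)
      ((ContinuousLinearMap.toSpanSingleton ℂ (polyDeriv a z)).restrictScalars ℝ) (ball 0 1) z :=
    fun z _ => ((hasDerivAt_polyMap a z).hasFDerivAt.restrictScalars ℝ).hasFDerivWithinAt
  rw [harmonicMoment, imageDomain,
    integral_image_eq_integral_abs_det_fderiv_smul volume measurableSet_ball hd ha]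
  obtain ⟨P, hP⟩ : ∃ P : Polynomial ℂ, ∀ z, P.eval z = polyMap a z ^ k * polyDeriv a z := by
    refine ⟨(∑ j : Fin (N + 1), Polynomial.C (coef a j) * Polynomial.X ^ ((j : ℕ) + 1)) ^ k *
      ∑ j : Fin (N + 1), Polynomial.C (coef a j * ((j : ℕ) + 1)) * Polynomial.X ^ (j : ℕ),
      fun z => ?_⟩
    simp [polyMap_eq_sum, polyDeriv, Polynomial.eval_finsetSum, mul_assoc]
  have h1 : ∀ z, |((ContinuousLinearMap.toSpanSingleton ℂ (polyDeriv a z)).restrictScalars ℝ).det| •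
      polyMap a z ^ k = P.eval z * starRingEnd ℂ (polyDeriv a z) := by
    intro z
    have : ((ContinuousLinearMap.toSpanSingleton ℂ (polyDeriv a z)).restrictScalars ℝ).det =
        Complex.normSq (polyDeriv a z) := by
      simp [ContinuousLinearMap.det, LinearMap.det_restrictScalars, Complex.normSq_eq_norm_sq,
        Algebra.norm_complex_apply]
    rw [this, abs_of_nonneg (Complex.normSq_nonneg _), hP, real_smul, Complex.normSq_eq_conj_mul_self]
    ring
  simp_rw [h1]
  rw [integral_ball_mul_conj_polyDeriv, momentFun]
  congr 1
  funext ζ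
  rw [hP]; ring

end MomentEvolution

/-! ### First variation of the moments -/

namespace MomentEvolution

open Complex Metric Set Filter Real MeasureTheory

variable {N : ℕ}

/-- `ζ (f' g_v - f_v g')`, where `f = polyMap a`, `g = schwarz a`, and `f_v`, `g_v` are their
variations in the direction `v`. -/
noncomputable def variation (a v : Coord N) (ζ : ℂ) : ℂ :=
  ζ * (polyDeriv a ζ * schwarz v ζ - polyMap v ζ * schwarzDeriv a ζ)

theorem variation_eq_on_circle (a v : Coord N) {ζ : ℂ} (hζ : ‖ζ‖ = 1) :
    variation a v ζ = ζ * polyDeriv a ζ * starRingEnd ℂ (polyMap v ζ) +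
      polyMap v ζ * starRingEnd ℂ (ζ * polyDeriv a ζ) := by
  have h1 := schwarz_eq_conj v hζ
  have h2 := mul_schwarzDeriv_eq_conj a hζ
  rw [variation, ← h1]
  linear_combination (-polyMap v ζ) * h2

theorem variation_im_on_circle (a v : Coord N) {ζ : ℂ} (hζ : ‖ζ‖ = 1) :
    (variation a v ζ).im = 0 := by
  rw [variation_eq_on_circle a v hζ]
  simp; ring

theorem exists_differentiable_variation (a v : Coord N) :
    ∃ q : ℂ → ℂ, Differentiable ℂ q ∧ ∀ ζ ≠ 0, q ζ = ζ ^ N * variation a v ζ := by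
  obtain ⟨P, hP, hPζ⟩ := differentiable_pow_mul_schwarz v
  refine ⟨fun ζ => polyDeriv a ζ * P ζ - polyQuot v ζ * -∑ j : Fin (N + 1),
    starRingEnd ℂ (coef a j) * (((j : ℕ) + 1) * ζ ^ (N - (j : ℕ))), ?_, ?_⟩
  · have := differentiable_polyDeriv a
    have := differentiable_polyQuot v
    fun_prop
  · intro ζ hζ
    have h2 : ζ ^ (N + 2) * schwarzDeriv a ζ = -∑ j : Fin (N + 1),
        starRingEnd ℂ (coef a j) * (((j : ℕ) + 1) * ζ ^ (N - (j : ℕ))) := by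
      rw [schwarzDeriv, mul_neg, Finset.mul_sum]
      congr 1
      refine Finset.sum_congr rfl fun j _ => ?_
      have hj : N + 2 = (N - (j : ℕ)) + ((j : ℕ) + 2) := by have := j.2; omega
      have h2 : ζ ^ (N + 2) = ζ ^ (N - (j : ℕ)) * ζ ^ ((j : ℕ) + 2) := by rw [← pow_add, ← hj]
      rw [h2, inv_pow]
      field_simp
    simp only []
    rw [← hPζ ζ hζ, ← h2, variation, polyMap_eq_mul]
    ring

/-- The averages remove the pole of order at most N and the constant term, so B = ζp with p
holomorphic. Then iB has zero real part on the circle and value 0 at the centre, hence vanishes. The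
radius is chosen to exceed ‖ζ‖. -/
theorem eq_zero_of_circleAverage_pow_mul_eq_zero {a : Coord N} (ha : a.1 ≠ 0) {B q : ℂ → ℂ}
    (hq : Differentiable ℂ q) (hqB : ∀ ζ ≠ 0, q ζ = ζ ^ N * B ζ)
    (him : ∀ ζ : ℂ, ‖ζ‖ = 1 → (B ζ).im = 0)
    (havg : ∀ k ≤ N, circleAverage (fun ζ => polyMap a ζ ^ k * B ζ) 0 1 = 0) {ζ : ℂ} (hζ : ζ ≠ 0) :
    B ζ = 0 := by
  obtain ⟨ρ, hρ1, hρζ⟩ : ∃ ρ : ℝ, 1 < ρ ∧ ‖ζ‖ < ρ :=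
    ⟨max 1 ‖ζ‖ + 1, by linarith [le_max_left 1 ‖ζ‖], by linarith [le_max_right 1 ‖ζ‖]⟩
  obtain ⟨p, hp, hqp⟩ := exists_eq_pow_mul_of_circleAverage_eq_zero hρ1
    (differentiable_polyQuot a).differentiableOn (by simpa using ha) N q hq.differentiableOn
    (fun k hk => by
      refine Eq.trans ?_ (havg k hk)
      apply circleAverage_congr_sphere
      intro z hz
      have h0 : z ≠ 0 := ne_zero_of_norm_eq_one (by simpa using hz)
      simp only [← polyMap_eq_mul, hqB z h0]
      field_simp)
  have hB : ∀ z ∈ ball (0 : ℂ) ρ, z ≠ 0 → B z = z * p z := by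
    intro z hz h0
    have := hqp z hz
    rw [hqB z h0, pow_succ, mul_assoc] at this
    exact mul_left_cancel₀ (pow_ne_zero N h0) this
  have hF : DifferentiableOn ℂ (fun z => I * (z * p z)) (ball 0 ρ) :=
    (differentiableOn_id.mul hp).const_mul I
  have hmem : ζ ∈ ball (0 : ℂ) ρ := by simpa using hρζ
  have := (eq_center_of_re_sphere_eq_zero hρ1 hF (fun z hz => by
    rw [← hB z (by simpa [hz] using hρ1) (ne_zero_of_norm_eq_one hz)]
    simp [him z hz]) ζ hmem).1
  rw [hB ζ hmem hζ]
  simpa using this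

theorem exists_ball_subset {V : Set ℂ} (hV : IsOpen V) (h : closedBall (0 : ℂ) 1 ⊆ V) :
    ∃ ρ : ℝ, 1 < ρ ∧ ball (0 : ℂ) ρ ⊆ V := by
  obtain ⟨δ, hδ, hsub⟩ := (isCompact_closedBall (0 : ℂ) 1).exists_thickening_subset_open hV h
  refine ⟨δ + 1, by linarith, ?_⟩
  rwa [thickening_closedBall hδ zero_le_one] at hsub

theorem polyDeriv_ne_zero_of_injOn {a : Coord N} {V : Set ℂ} (hV : IsOpen V)
    (h : InjOn (polyMap a) V) {ζ : ℂ} (hζ : ζ ∈ V) : polyDeriv a ζ ≠ 0 := by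
  have := deriv_ne_zero_of_injOn hV (differentiable_polyMap a).differentiableOn h hζ
  rwa [(hasDerivAt_polyMap a ζ).deriv] at this

theorem polyQuot_ne_zero_of_injOn {a : Coord N} (ha : a.1 ≠ 0) {V : Set ℂ} (h0 : (0 : ℂ) ∈ V)
    (h : InjOn (polyMap a) V) {ζ : ℂ} (hζ : ζ ∈ V) : polyQuot a ζ ≠ 0 := by
  intro hu
  have hz : ζ = 0 := h hζ h0 (by simp [polyMap_eq_mul, hu])
  rw [hz, polyQuot_zero] at hu
  exact ha (by exact_mod_cast hu)

theorem IsAdmissible.exists_ball {a : Coord N} (ha : IsAdmissible a) :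
    ∃ ρ : ℝ, 1 < ρ ∧ InjOn (polyMap a) (ball 0 ρ) := by
  obtain ⟨_, V, hV, hsub, hinj⟩ := ha
  obtain ⟨ρ, hρ, hρV⟩ := exists_ball_subset hV hsub
  exact ⟨ρ, hρ, hinj.mono hρV⟩

theorem eq_zero_of_polyQuot_eq_zero {v : Coord N} (h : ∀ ζ ∈ ball (0 : ℂ) 1, polyQuot v ζ = 0) :
    v = 0 := by
  set P : Polynomial ℂ := ∑ j : Fin (N + 1), Polynomial.monomial (j : ℕ) (coef v j) with hP
  have hPe : ∀ z, P.eval z = polyQuot v z := fun z => by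
    simp [hP, polyQuot, Polynomial.eval_finsetSum]
  have hP0 : P = 0 := by
    apply Polynomial.eq_zero_of_infinite_isRoot
    refine Set.Infinite.mono (s := ball (0 : ℂ) 1) (fun z hz => ?_) ?_
    · exact (hPe z).trans (h z hz)
    · exact infinite_of_mem_nhds (0 : ℂ) (ball_mem_nhds _ one_pos)
  apply coef_injective
  funext j
  have : P.coeff (j : ℕ) = coef v j := by
    simp only [hP, Polynomial.finsetSum_coeff, Polynomial.coeff_monomial]
    rw [Finset.sum_eq_single j]
    · simp
    · intro b _ hb; rw [if_neg]; exact fun h => hb (Fin.ext h)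
    · simp
  rw [← this, hP0]
  refine Fin.cases ?_ (fun i => ?_) j <;> simp

/-- Vanishing of B_v on the circle says Re(f_v/(ζf')) = 0 there. This quotient is holomorphic in the
disk since f' has no zeros, so it is an imaginary constant. Its value at 0 is v_0/a_0, which is
real: the normalization of a_0 excludes rotations. -/
theorem eq_zero_of_variation_eq_zero {a v : Coord N} (ha : IsAdmissible a)
    (h : ∀ ζ : ℂ, ‖ζ‖ = 1 → variation a v ζ = 0) : v = 0 := by
  obtain ⟨ρ, hρ, hinj⟩ := ha.exists_ball
  have hd : ∀ ζ ∈ ball (0 : ℂ) ρ, polyDeriv a ζ ≠ 0 := fun ζ hζ =>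
    polyDeriv_ne_zero_of_injOn isOpen_ball hinj hζ
  have hF : DifferentiableOn ℂ (fun ζ => polyQuot v ζ / polyDeriv a ζ) (ball 0 ρ) :=
    (differentiable_polyQuot v).differentiableOn.div (differentiable_polyDeriv a).differentiableOn hd
  have key := eq_center_of_re_sphere_eq_zero hρ hF (fun ζ hζ => by
    have h0 := ne_zero_of_norm_eq_one hζ
    have hd1 := hd ζ (by simpa [hζ] using hρ)
    have h1 := h ζ hζ
    rw [variation_eq_on_circle a v hζ] at h1
    have h2 : polyQuot v ζ / polyDeriv a ζ = polyMap v ζ / (ζ * polyDeriv a ζ) := by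
      rw [polyMap_eq_mul]; field_simp
    set w := ζ * polyDeriv a ζ with hw
    have hw0 : w ≠ 0 := mul_ne_zero h0 hd1
    have h3 : (w * starRingEnd ℂ (polyMap v ζ) + polyMap v ζ * starRingEnd ℂ w).re = 0 := by
      rw [h1]; rfl
    rw [h2, Complex.div_re]
    simp at h3
    have hns : Complex.normSq w ≠ 0 := by simpa using hw0
    field_simp
    linarith)
  have h00 : (0 : ℂ) ∈ ball (0 : ℂ) ρ := by simp; linarith
  have hzero : polyQuot v 0 / polyDeriv a 0 = 0 := by
    have h1 := (key 0 h00).2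
    simp only [polyQuot_zero, polyDeriv_zero] at h1 ⊢
    rw [← ofReal_div, ofReal_re] at h1
    rw [← ofReal_div, h1, ofReal_zero]
  apply eq_zero_of_polyQuot_eq_zero
  intro ζ hζ
  have hζρ : ζ ∈ ball (0 : ℂ) ρ := ball_subset_ball hρ.le hζ
  have h1 := (key ζ hζρ).1
  rw [hzero, div_eq_zero_iff] at h1
  exact h1.resolve_right (hd ζ hζρ)

theorem contDiff_comp_circleMap {F : Coord N → ℂ → ℂ}
    (hF : ContDiff ℝ ∞ (fun p : Coord N × ℂ => F p.1 p.2)) :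
    ContDiff ℝ ∞ (fun p : Coord N × ℝ => F p.1 (circleMap 0 1 p.2)) :=
  hF.comp (contDiff_fst.prodMk ((contDiff_circleMap 0 1).comp contDiff_snd))

theorem contDiff_conj {E : Type*} [NormedAddCommGroup E] [NormedSpace ℝ E] {F : E → ℂ}
    (hF : ContDiff ℝ ∞ F) : ContDiff ℝ ∞ (fun x => starRingEnd ℂ (F x)) :=
  Complex.conjCLE.contDiff.comp hF

theorem continuousOn_variation (a v : Coord N) : ContinuousOn (variation a v) (sphere 0 1) := by
  have c2 := (differentiable_polyMap v).continuous
  have c3 := (differentiable_polyDeriv a).continuous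
  refine ContinuousOn.congr (f := fun ζ =>
    (ζ * polyDeriv a ζ * starRingEnd ℂ (polyMap v ζ) +
      polyMap v ζ * starRingEnd ℂ (ζ * polyDeriv a ζ))) (by fun_prop) fun ζ hζ => ?_
  rw [variation_eq_on_circle a v (by simpa using hζ)]

/-- Differentiation under the integral produces a term with f_v'; integration by parts on the circle
turns it into the term of B_v with S'. -/
theorem momentFun_smooth (k : ℕ) : ContDiff ℝ ∞ (momentFun (N := N) k) ∧
    ∀ a v : Coord N, fderiv ℝ (momentFun k) a v =
      circleAverage (fun ζ => polyMap a ζ ^ k * variation a v ζ) 0 1 := by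
  set φ : Coord N → ℂ → ℂ := fun a ζ =>
    polyMap a ζ ^ k * (ζ * polyDeriv a ζ) * starRingEnd ℂ (polyMap a ζ) with hφ
  have hsm : ContDiff ℝ ∞ (fun p : Coord N × ℝ => φ p.1 (circleMap 0 1 p.2)) := by
    apply contDiff_comp_circleMap (F := φ)
    exact ((contDiff_polyMap.pow k).mul (contDiff_snd.mul contDiff_polyDeriv)).mul
      (contDiff_conj contDiff_polyMap)
  obtain ⟨h1, h2⟩ := circleAverage_hasFDerivAt (E := Coord N) (φ := φ) isOpen_univ hsm.contDiffOn
  refine ⟨contDiffOn_univ.1 h1, fun a v => ?_⟩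
  refine (h2 a (mem_univ a) v).trans ?_
  have hder : ∀ ζ : ℂ, fderiv ℝ (fun y : Coord N =>
      polyMap y ζ ^ k * (ζ * polyDeriv y ζ) * starRingEnd ℂ (polyMap y ζ)) a v =
      (k * polyMap a ζ ^ (k - 1) * polyMap v ζ * (ζ * polyDeriv a ζ) +
        polyMap a ζ ^ k * (ζ * polyDeriv v ζ)) * starRingEnd ℂ (polyMap a ζ) +
      polyMap a ζ ^ k * (ζ * polyDeriv a ζ) * starRingEnd ℂ (polyMap v ζ) := by
    intro ζ
    have e1 : HasFDerivAt (fun y : Coord N => polyMap y ζ) (polyMapL ζ) a :=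
      (polyMapL ζ).hasFDerivAt
    have e2 : HasFDerivAt (fun y : Coord N => polyDeriv y ζ) (polyDerivL ζ) a :=
      (polyDerivL ζ).hasFDerivAt
    have e3 : HasFDerivAt (fun y : Coord N => starRingEnd ℂ (polyMap y ζ))
        ((Complex.conjCLE : ℂ →L[ℝ] ℂ).comp (polyMapL ζ)) a :=
      Complex.conjCLE.hasFDerivAt.comp a e1
    have e4 := HasFDerivAt.fun_mul (HasFDerivAt.fun_mul (e1.pow k)
      (HasFDerivAt.const_mul e2 ζ)) e3
    rw [e4.fderiv]
    simp
    ring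
  simp_rw [hφ, hder]
  rw [← sub_eq_zero, ← circleAverage_fun_sub]
  -- The difference of the two integrands is ζ d/dζ of f^k f_v S.
  · have hz := circleAverage_mul_deriv_eq_zero
      (F := fun ζ => polyMap a ζ ^ k * polyMap v ζ * schwarz a ζ)
      (F' := fun ζ => (k * polyMap a ζ ^ (k - 1) * polyDeriv a ζ * polyMap v ζ +
        polyMap a ζ ^ k * polyDeriv v ζ) * schwarz a ζ +
        polyMap a ζ ^ k * polyMap v ζ * schwarzDeriv a ζ)
      (fun ζ hζ => HasDerivAt.fun_mul (HasDerivAt.fun_mul ((hasDerivAt_polyMap a ζ).fun_pow k)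
        (hasDerivAt_polyMap v ζ)) (hasDerivAt_schwarz a (ne_zero_of_norm_eq_one hζ)))
    refine Eq.trans ?_ hz
    apply circleAverage_congr_sphere
    intro ζ hζ
    have hζ1 : ‖ζ‖ = 1 := by simpa using hζ
    simp only [← schwarz_eq_conj _ hζ1, variation]
    ring
  · apply circleIntegrable_of_continuousOn
    have c1 := (differentiable_polyMap a).continuous
    have c2 := (differentiable_polyMap v).continuous
    have c3 := (differentiable_polyDeriv a).continuous
    have c4 := (differentiable_polyDeriv v).continuous
    fun_prop
  · exact circleIntegrable_of_continuousOn (((differentiable_polyMap a).continuous.pow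
      k).continuousOn.mul (continuousOn_variation a v))

end MomentEvolution

/-! ### Openness of univalence; the moments as local coordinates -/

namespace MomentEvolution

open Complex Metric Set Filter Real MeasureTheory

variable {N : ℕ}

/-- The difference quotient `(f x - f y) / (x - y)` of `f = polyMap a`. -/
noncomputable def diffQuot (a : Coord N) (x y : ℂ) : ℂ :=
  ∑ j : Fin (N + 1), coef a j *
    ∑ i ∈ Finset.range ((j : ℕ) + 1), x ^ i * y ^ ((j : ℕ) + 1 - 1 - i)

theorem diffQuot_mul_sub (a : Coord N) (x y : ℂ) :
    diffQuot a x y * (x - y) = polyMap a x - polyMap a y := by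
  rw [diffQuot, polyMap_eq_sum, polyMap_eq_sum, ← Finset.sum_sub_distrib, Finset.sum_mul]
  refine Finset.sum_congr rfl fun j _ => ?_
  rw [mul_assoc, geom_sum₂_mul, mul_sub]

theorem diffQuot_self (a : Coord N) (x : ℂ) : diffQuot a x x = polyDeriv a x := by
  refine Finset.sum_congr rfl fun j _ => ?_
  rw [geom_sum₂_self]; simp

theorem continuous_diffQuot :
    Continuous fun p : (ℂ × ℂ) × Coord N => diffQuot p.2 p.1.1 p.1.2 := by
  have : ∀ j : Fin (N + 1), Continuous fun a : Coord N => coef a j := fun j => (coefL j).continuous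
  unfold diffQuot
  fun_prop

/-- Univalence near a closed disk amounts to nonvanishing of the difference quotient on the product
of two closed disks, where the diagonal value is f'. By compactness this persists under small
changes of the coefficients, at the cost of a smaller radius. -/
theorem eventually_injOn_ball {b : Coord N} {ρ ρ' : ℝ} (h : InjOn (polyMap b) (ball 0 ρ))
    (hρ : ρ' < ρ) : ∀ᶠ a in 𝓝 b, InjOn (polyMap a) (ball 0 ρ') := by
  have hK : IsCompact (closedBall (0 : ℂ) ρ' ×ˢ closedBall (0 : ℂ) ρ') :=
    (isCompact_closedBall _ _).prod (isCompact_closedBall _ _)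
  have hn : IsOpen {p : (ℂ × ℂ) × Coord N | diffQuot p.2 p.1.1 p.1.2 ≠ 0} :=
    isOpen_ne_fun continuous_diffQuot continuous_const
  have hsub : closedBall (0 : ℂ) ρ' ⊆ ball 0 ρ := closedBall_subset_ball hρ
  obtain ⟨V, W, -, hW, hV, hbW, hVW⟩ := generalized_tube_lemma hK (isCompact_singleton (x := b)) hn
    (by
      rintro ⟨⟨x, y⟩, a⟩ ⟨⟨hx, hy⟩, ha⟩
      obtain rfl : a = b := ha
      by_cases hxy : x = y
      · subst hxy
        simp only [mem_ofPred_eq, diffQuot_self]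
        exact polyDeriv_ne_zero_of_injOn isOpen_ball h (hsub hx)
      · intro h0
        have := diffQuot_mul_sub a x y
        simp only at h0
        rw [h0, zero_mul] at this
        exact hxy (h (hsub hx) (hsub hy) (sub_eq_zero.1 this.symm)))
  filter_upwards [hW.mem_nhds (hbW rfl)] with a ha x hx y hy hxy
  have hm : ((x, y), a) ∈ V ×ˢ W :=
    ⟨hV ⟨ball_subset_closedBall hx, ball_subset_closedBall hy⟩, ha⟩
  have h1 := diffQuot_mul_sub a x y
  rw [hxy, sub_self, mul_eq_zero] at h1
  exact sub_eq_zero.1 (h1.resolve_left (hVW hm))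

theorem isAdmissible_of_injOn_ball {a : Coord N} {ρ : ℝ} (h0 : 0 < a.1) (hρ : 1 < ρ)
    (h : InjOn (polyMap a) (ball 0 ρ)) : IsAdmissible a :=
  ⟨h0, ball 0 ρ, isOpen_ball, closedBall_subset_ball hρ, h⟩

theorem isOpen_isAdmissible : IsOpen {a : Coord N | IsAdmissible a} := by
  rw [isOpen_iff_mem_nhds]
  intro b hb
  obtain ⟨ρ, hρ, hinj⟩ := hb.exists_ball
  obtain ⟨ρ', h1, h2⟩ := exists_between hρ
  have hpos : ∀ᶠ a : Coord N in 𝓝 b, 0 < a.1 := continuous_fst.continuousAt.eventually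
    (isOpen_Ioi.mem_nhds hb.1)
  filter_upwards [eventually_injOn_ball hinj h2, hpos] with a ha ha0
  exact isAdmissible_of_injOn_ball ha0 h1 ha

theorem im_circleAverage_eq_zero {F : ℂ → ℂ} (hF : CircleIntegrable F 0 1)
    (h : ∀ ζ : ℂ, ‖ζ‖ = 1 → (F ζ).im = 0) : (circleAverage F 0 1).im = 0 := by
  have h1 := Complex.imCLM.circleAverage_comp_comm hF
  have h2 : circleAverage (Complex.imCLM ∘ F) 0 1 = 0 :=
    circleAverage_const_on_circle fun z hz => h z (by simpa using hz)
  rw [h2] at h1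
  exact h1.symm

theorem circleIntegrable_variation (a v : Coord N) : CircleIntegrable (variation a v) 0 1 :=
  circleIntegrable_of_continuousOn (continuousOn_variation a v)

/-- The moments `(M₀; M₁, …, M_N)` as a smooth function of all coefficients. -/
noncomputable def smoothMoments (a : Coord N) : Coord N :=
  ((momentFun 0 a).re, fun j => momentFun ((j : ℕ) + 1) a)

theorem momentMap_eq_smoothMoments {a : Coord N} (ha : IsAdmissible a) :
    momentMap a = smoothMoments a := by
  obtain ⟨ρ, hρ, hinj⟩ := ha.exists_ball
  have h := harmonicMoment_eq_momentFun (hinj.mono (ball_subset_ball hρ.le))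
  simp only [momentMap, smoothMoments, h]

theorem contDiff_smoothMoments : ContDiff ℝ ∞ (smoothMoments (N := N)) := by
  refine ContDiff.prodMk ?_ (contDiff_pi.2 fun j => (momentFun_smooth _).1)
  exact Complex.reCLM.contDiff.comp (momentFun_smooth 0).1

theorem fderiv_smoothMoments (a v : Coord N) : fderiv ℝ smoothMoments a v =
    ((circleAverage (variation a v) 0 1).re,
      fun j : Fin N => circleAverage (fun ζ => polyMap a ζ ^ ((j : ℕ) + 1) * variation a v ζ) 0 1) := by
  have hd : ∀ k, HasFDerivAt (momentFun (N := N) k) (fderiv ℝ (momentFun k) a) a := fun k =>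
    ((momentFun_smooth k).1.differentiable (by simp)).differentiableAt.hasFDerivAt
  have h1 : HasFDerivAt (smoothMoments (N := N))
      ((Complex.reCLM.comp (fderiv ℝ (momentFun 0) a)).prod
        (ContinuousLinearMap.pi fun j : Fin N => fderiv ℝ (momentFun ((j : ℕ) + 1)) a)) a :=
    (Complex.reCLM.hasFDerivAt.comp a (hd 0)).prodMk
      (hasFDerivAt_pi.2 fun j => hd ((j : ℕ) + 1))
  rw [h1.fderiv]
  refine Prod.ext ?_ (funext fun j => ?_)
  · simp [(momentFun_smooth 0).2]
  · simp [(momentFun_smooth _).2]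

/-- A direction in which all moments are stationary has B_v orthogonal to f^k for every k ≤ N; hence
B_v = 0, and then v = 0. -/
theorem fderiv_smoothMoments_injective {a : Coord N} (ha : IsAdmissible a) :
    Function.Injective (fderiv ℝ smoothMoments a) := by
  rw [injective_iff_map_eq_zero]
  intro v hv
  rw [fderiv_smoothMoments] at hv
  obtain ⟨q, hq, hqζ⟩ := exists_differentiable_variation a v
  refine eq_zero_of_variation_eq_zero ha fun ζ hζ =>
    eq_zero_of_circleAverage_pow_mul_eq_zero ha.1.ne' hq hqζ
      (fun z hz => variation_im_on_circle a v hz) (fun k hk => ?_) (ne_zero_of_norm_eq_one hζ)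
  -- For k = 0 the coordinate records only a real part; the imaginary part of the average vanishes
  -- because B_v is real on the circle.
  rcases Nat.eq_zero_or_pos k with rfl | hk0
  · simp only [pow_zero, one_mul]
    refine Complex.ext ?_ ?_
    · exact congrArg Prod.fst hv
    · exact im_circleAverage_eq_zero (circleIntegrable_variation a v)
        fun z hz => variation_im_on_circle a v hz
  · obtain ⟨j, rfl⟩ : ∃ j, k = j + 1 := ⟨k - 1, by omega⟩
    exact congrFun (congrArg Prod.snd hv) ⟨j, by omega⟩

theorem exists_equiv_hasFDerivAt_smoothMoments {a : Coord N} (ha : IsAdmissible a) :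
    ∃ e : Coord N ≃L[ℝ] Coord N, HasFDerivAt smoothMoments (e : Coord N →L[ℝ] Coord N) a := by
  refine ⟨(LinearEquiv.ofInjectiveEndo (fderiv ℝ smoothMoments a : Coord N →ₗ[ℝ] Coord N)
    (fderiv_smoothMoments_injective ha)).toContinuousLinearEquiv, ?_⟩
  have := (contDiff_smoothMoments.differentiable (by simp)).differentiableAt.hasFDerivAt (x := a)
  exact this.congr_fderiv (ContinuousLinearMap.ext fun v => rfl)

theorem exists_momentChart {b : Coord N} (hb : IsAdmissible b) :
    ∃ (U : Set (Coord N)) (a : Coord N → Coord N),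
      IsMomentChart U a ∧ momentMap b ∈ U ∧ a (momentMap b) = b := by
  obtain ⟨e, he⟩ := exists_equiv_hasFDerivAt_smoothMoments hb
  have hc := contDiff_smoothMoments.contDiffAt (x := b)
  set Φ := hc.toOpenPartialHomeomorph smoothMoments he (by simp) with hΦ
  have hcoe : ∀ x, Φ x = smoothMoments x := fun x => rfl
  have hsrc : b ∈ Φ.source := hc.mem_toOpenPartialHomeomorph_source he (by simp)
  have hmb := momentMap_eq_smoothMoments hb
  have hleft : Φ.symm (momentMap b) = b := by rw [hmb, ← hcoe, Φ.left_inv hsrc]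
  refine ⟨Φ.target ∩ Φ.symm ⁻¹' {a | IsAdmissible a}, Φ.symm, ⟨?_, ?_, ?_, ?_⟩, ⟨?_, ?_⟩, hleft⟩
  · exact Φ.isOpen_inter_preimage_symm isOpen_isAdmissible
  · exact fun M hM => hM.2
  · intro M hM
    rw [momentMap_eq_smoothMoments hM.2, ← hcoe, Φ.right_inv hM.1]
  · intro M hM
    -- The inverse function theorem gives smoothness at the base point only; elsewhere it follows
    -- from invertibility of the Jacobian at every admissible point.
    obtain ⟨e', he'⟩ := exists_equiv_hasFDerivAt_smoothMoments hM.2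
    exact (Φ.contDiffAt_symm hM.1 he' contDiff_smoothMoments.contDiffAt).contDiffWithinAt
  · rw [hmb, ← hcoe]; exact Φ.map_source hsrc
  · rw [mem_preimage, hleft]; exact hb

end MomentEvolution

/-! ### The Laurent primitive of f'S, the area formula and the string equation -/

namespace MomentEvolution

open Complex Metric Set Filter Real MeasureTheory

variable {N : ℕ}

section Laurent

/-- The coefficients of the Laurent polynomial `laurentPot`. -/
noncomputable def laurentCoeff (j k : ℕ) : ℂ := if j = k then 0 else ((j : ℂ) + 1) / ((j : ℂ) - k)

/-- The Laurent polynomial part of the primitive of `f_a' g_b`, without constant term. -/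
noncomputable def laurentPot (a b : Coord N) (ζ : ℂ) : ℂ :=
  ∑ j : Fin (N + 1), ∑ k : Fin (N + 1), coef a j * starRingEnd ℂ (coef b k) *
    (laurentCoeff j k * (ζ ^ (j : ℕ) * (ζ⁻¹) ^ (k : ℕ)))

/-- The residue of `f_a' g_b` at `0`. -/
noncomputable def pairing (a b : Coord N) : ℂ :=
  ∑ j : Fin (N + 1), ((j : ℕ) + 1) * (coef a j * starRingEnd ℂ (coef b j))

theorem laurentCoeff_mul (j k : ℕ) :
    laurentCoeff j k * ((j : ℂ) - k) = (j + 1) - if j = k then ((j : ℂ) + 1) else 0 := by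
  unfold laurentCoeff
  split_ifs with h
  · simp
  · have : (j : ℂ) - k ≠ 0 := sub_ne_zero.2 (by exact_mod_cast h)
    field_simp
    ring

theorem hasDerivAt_pow_mul_inv_pow (j k : ℕ) {ζ : ℂ} (hζ : ζ ≠ 0) :
    HasDerivAt (fun z : ℂ => z ^ j * (z⁻¹) ^ k) (((j : ℂ) - k) * (ζ ^ j * (ζ⁻¹) ^ (k + 1))) ζ := by
  have h1 : ∀ᶠ z : ℂ in 𝓝 ζ, z ^ j * (z⁻¹) ^ k = z ^ ((j : ℤ) - k) := by
    filter_upwards [isOpen_ne.mem_nhds hζ] with z hz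
    rw [zpow_sub₀ hz, zpow_natCast, zpow_natCast, inv_pow, div_eq_mul_inv]
  refine ((hasDerivAt_zpow ((j : ℤ) - k) ζ (Or.inl hζ)).congr_of_eventuallyEq h1).congr_deriv ?_
  rw [zpow_sub_one₀ hζ, zpow_sub₀ hζ, zpow_natCast, zpow_natCast, pow_succ, inv_pow]
  push_cast
  ring

/-- Termwise integration: the monomials with j ≠ k have primitives, while those with j = k sum to
the residue term, which is left for the logarithm. -/
theorem hasDerivAt_laurentPot (a b : Coord N) {ζ : ℂ} (hζ : ζ ≠ 0) :
    HasDerivAt (laurentPot a b) (polyDeriv a ζ * schwarz b ζ - pairing a b / ζ) ζ := by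
  have h1 : HasDerivAt (laurentPot a b) (∑ j : Fin (N + 1), ∑ k : Fin (N + 1),
      coef a j * starRingEnd ℂ (coef b k) * (laurentCoeff j k *
        ((((j : ℕ) : ℂ) - (k : ℕ)) * (ζ ^ (j : ℕ) * (ζ⁻¹) ^ ((k : ℕ) + 1))))) ζ := by
    unfold laurentPot
    exact HasDerivAt.fun_sum fun j _ => HasDerivAt.fun_sum fun k _ =>
      ((hasDerivAt_pow_mul_inv_pow j k hζ).const_mul _).const_mul _
  refine h1.congr_deriv ?_
  have h2 : pairing a b / ζ = ∑ j : Fin (N + 1), ∑ k : Fin (N + 1),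
      coef a j * starRingEnd ℂ (coef b k) * ((if (j : ℕ) = (k : ℕ) then (((j : ℕ) : ℂ) + 1) else 0) *
        (ζ ^ (j : ℕ) * (ζ⁻¹) ^ ((k : ℕ) + 1))) := by
    rw [pairing, Finset.sum_div]
    refine Finset.sum_congr rfl fun j _ => ?_
    rw [Finset.sum_eq_single j]
    · simp only [if_true, pow_succ, inv_pow]
      field_simp
    · intro k _ hk
      rw [if_neg fun h => hk (Fin.ext h.symm)]; simp
    · simp
  rw [h2, polyDeriv, schwarz, Finset.sum_mul_sum, ← Finset.sum_sub_distrib]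
  refine Finset.sum_congr rfl fun j _ => ?_
  rw [← Finset.sum_sub_distrib]
  refine Finset.sum_congr rfl fun k _ => ?_
  have h3 := laurentCoeff_mul j k
  linear_combination (coef a j * starRingEnd ℂ (coef b k) *
    (ζ ^ (j : ℕ) * (ζ⁻¹) ^ ((k : ℕ) + 1))) * h3

theorem circleAverage_laurentPot (a b : Coord N) : circleAverage (laurentPot a b) 0 1 = 0 := by
  have hint : ∀ j k : ℕ, CircleIntegrable (fun z : ℂ => z ^ j * (z⁻¹) ^ k) 0 1 := fun j k => by
    apply circleIntegrable_of_continuousOn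
    intro z hz
    have : z ≠ 0 := ne_zero_of_norm_eq_one (by simpa using hz)
    exact (((continuousAt_id.pow j).mul ((continuousAt_inv₀ this).pow k))).continuousWithinAt
  have hint' : ∀ j k : Fin (N + 1), CircleIntegrable (fun z : ℂ =>
      coef a j * starRingEnd ℂ (coef b k) *
        (laurentCoeff j k * (z ^ (j : ℕ) * (z⁻¹) ^ (k : ℕ)))) 0 1 := fun j k => by
    have := ((hint j k).const_fun_smul (a := laurentCoeff j k)).const_fun_smul
      (a := coef a j * starRingEnd ℂ (coef b k))
    simpa only [smul_eq_mul] using this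
  unfold laurentPot
  rw [circleAverage_fun_sum fun j _ => CircleIntegrable.fun_sum _ fun k _ => hint' j k]
  refine Finset.sum_eq_zero fun j _ => ?_
  rw [circleAverage_fun_sum fun k _ => hint' j k]
  refine Finset.sum_eq_zero fun k _ => ?_
  simp only [← smul_eq_mul (a := coef a j * starRingEnd ℂ (coef b k)),
    ← smul_eq_mul (a := laurentCoeff j k)]
  rw [circleAverage_fun_smul, circleAverage_fun_smul]
  by_cases h : (j : ℕ) = k
  · simp [laurentCoeff, h]
  · have hz := circleAverage_zpow (n := (j : ℤ) - k) (by omega)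
    have : circleAverage (fun z : ℂ => z ^ (j : ℕ) * (z⁻¹) ^ (k : ℕ)) 0 1 = 0 := by
      refine Eq.trans ?_ hz
      apply circleAverage_congr_sphere
      intro z hz
      have hz0 : z ≠ 0 := ne_zero_of_norm_eq_one (by simpa using hz)
      simp only [zpow_sub₀ hz0, zpow_natCast, inv_pow, div_eq_mul_inv]
    rw [this]; simp

/-- The area formula: both sides are the residue of f'S at 0, as the rest of f'S is an exact
derivative. -/
theorem pairing_self_eq_momentFun (a : Coord N) : pairing a a = momentFun 0 a := by
  have h := circleAverage_mul_deriv_eq_zero (F := laurentPot a a)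
    (F' := fun ζ => polyDeriv a ζ * schwarz a ζ - pairing a a / ζ)
    fun ζ hζ => hasDerivAt_laurentPot a a (ne_zero_of_norm_eq_one hζ)
  have c1 := (differentiable_polyMap a).continuous
  have c3 := (differentiable_polyDeriv a).continuous
  have h2 : circleAverage (fun ζ => polyMap a ζ ^ 0 * (ζ * polyDeriv a ζ) *
      starRingEnd ℂ (polyMap a ζ) - pairing a a) 0 1 = 0 := by
    refine Eq.trans ?_ h
    apply circleAverage_congr_sphere
    intro ζ hζ
    have hζ1 : ‖ζ‖ = 1 := by simpa using hζ
    have h0 := ne_zero_of_norm_eq_one hζ1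
    simp only [← schwarz_eq_conj a hζ1]
    field_simp
  rw [circleAverage_fun_sub (circleIntegrable_of_continuousOn (by fun_prop))
    (circleIntegrable_of_continuousOn (by fun_prop)), circleAverage_const, sub_eq_zero] at h2
  exact h2.symm

theorem hasFDerivAt_coef_mul_conj (j k : Fin (N + 1)) (a : Coord N) :
    HasFDerivAt (fun b : Coord N => coef b j * starRingEnd ℂ (coef b k))
      (coef a j • ((Complex.conjCLE : ℂ →L[ℝ] ℂ).comp (coefL k)) +
        starRingEnd ℂ (coef a k) • coefL j) a := by
  have e1 : HasFDerivAt (fun b : Coord N => coef b j) (coefL j) a := (coefL j).hasFDerivAt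
  have e2 : HasFDerivAt (fun b : Coord N => starRingEnd ℂ (coef b k))
      ((Complex.conjCLE : ℂ →L[ℝ] ℂ).comp (coefL k)) a :=
    Complex.conjCLE.hasFDerivAt.comp a (coefL k).hasFDerivAt
  exact HasFDerivAt.fun_mul e1 e2

theorem contDiff_laurentPot_diag {n : WithTop ℕ∞} (ζ : ℂ) :
    ContDiff ℝ n (fun a : Coord N => laurentPot a a ζ) := by
  unfold laurentPot
  refine ContDiff.sum fun j _ => ContDiff.sum fun k _ => ?_
  exact ((contDiff_coef j).mul (Complex.conjCLE.contDiff.comp (contDiff_coef k))).mul contDiff_const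

theorem contDiffAt_laurentPot_diag {p : Coord N × ℂ} (hp : p.2 ≠ 0) :
    ContDiffAt ℝ ∞ (fun p : Coord N × ℂ => laurentPot p.1 p.1 p.2) p := by
  unfold laurentPot
  refine ContDiffAt.sum fun j _ => ContDiffAt.sum fun k _ => ?_
  have h1 : ContDiff ℝ ∞ (fun p : Coord N × ℂ => coef p.1 j * starRingEnd ℂ (coef p.1 k)) :=
    ((contDiff_coef j).mul (Complex.conjCLE.contDiff.comp (contDiff_coef k))).comp contDiff_fst
  have h2 : ContDiffAt ℝ ∞ (fun p : Coord N × ℂ => p.2⁻¹) p :=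
    (contDiffAt_inv ℝ hp).comp p contDiffAt_snd
  exact h1.contDiffAt.mul (contDiffAt_const.mul ((contDiffAt_snd.pow _).mul (h2.pow _)))

theorem fderiv_laurentPot_diag (a v : Coord N) (ζ : ℂ) :
    fderiv ℝ (fun b : Coord N => laurentPot b b ζ) a v = laurentPot a v ζ + laurentPot v a ζ := by
  have h : HasFDerivAt (fun b : Coord N => laurentPot b b ζ) _ a :=
    HasFDerivAt.fun_sum fun j _ => HasFDerivAt.fun_sum fun k _ =>
      (hasFDerivAt_coef_mul_conj j k a).mul_const
        (laurentCoeff j k * (ζ ^ (j : ℕ) * (ζ⁻¹) ^ (k : ℕ)))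
  rw [h.fderiv]
  simp only [laurentPot, sum_apply, ← Finset.sum_add_distrib]
  refine Finset.sum_congr rfl fun j _ => Finset.sum_congr rfl fun k _ => ?_
  simp
  ring

theorem hasFDerivAt_pairing_diag (a : Coord N) :
    DifferentiableAt ℝ (fun b : Coord N => pairing b b) a ∧
    ∀ v, fderiv ℝ (fun b : Coord N => pairing b b) a v = pairing a v + pairing v a := by
  have h : HasFDerivAt (fun b : Coord N => pairing b b) _ a :=
    HasFDerivAt.fun_sum fun j _ => (hasFDerivAt_coef_mul_conj j j a).const_mul (((j : ℕ) : ℂ) + 1)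
  refine ⟨h.differentiableAt, fun v => ?_⟩
  rw [h.fderiv]
  simp only [pairing, sum_apply, ← Finset.sum_add_distrib]
  refine Finset.sum_congr rfl fun j _ => ?_
  simp only [smul_apply, add_apply, coefL_apply, ContinuousLinearMap.comp_apply, smul_eq_mul,
    ContinuousLinearEquiv.coe_coe, conjCLE_apply]
  ring

end Laurent

section Chart

variable {U : Set (Coord N)} {a : Coord N → Coord N}

theorem IsMomentChart.contDiffAt (h : IsMomentChart U a) {M : Coord N} (hM : M ∈ U) :
    ContDiffAt ℝ ∞ a M := h.smooth.contDiffAt (h.isOpen.mem_nhds hM)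

theorem IsMomentChart.hasFDerivAt (h : IsMomentChart U a) {M : Coord N} (hM : M ∈ U) :
    HasFDerivAt a (fderiv ℝ a M) M :=
  ((h.contDiffAt hM).differentiableAt (by simp)).hasFDerivAt

theorem IsMomentChart.smoothMoments_eq (h : IsMomentChart U a) {M : Coord N} (hM : M ∈ U) :
    smoothMoments (a M) = M := by
  rw [← momentMap_eq_smoothMoments (h.admissible M hM), h.moments M hM]

theorem momentFun_zero_im {b : Coord N} : (momentFun 0 b).im = 0 := by
  rw [← pairing_self_eq_momentFun, pairing]
  simp only [im_sum]
  refine Finset.sum_eq_zero fun j _ => ?_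
  rw [Complex.mul_conj]
  rw [show ((((j : ℕ) : ℂ) + 1) * (normSq (coef b j) : ℂ)) =
    (((((j : ℕ) : ℝ) + 1) * normSq (coef b j) : ℝ) : ℂ) by push_cast; ring, ofReal_im]

theorem IsMomentChart.momentFun_zero (h : IsMomentChart U a) {M : Coord N} (hM : M ∈ U) :
    momentFun 0 (a M) = M.1 := by
  have h1 := congrArg Prod.fst (h.smoothMoments_eq hM)
  exact Complex.ext (by simpa [smoothMoments] using h1) (by simp [momentFun_zero_im])

theorem IsMomentChart.momentFun_succ (h : IsMomentChart U a) {M : Coord N} (hM : M ∈ U)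
    (j : Fin N) : momentFun ((j : ℕ) + 1) (a M) = M.2 j :=
  congrFun (congrArg Prod.snd (h.smoothMoments_eq hM)) j

theorem IsMomentChart.pairing_eq (h : IsMomentChart U a) {M : Coord N} (hM : M ∈ U) :
    pairing (a M) (a M) = M.1 := by
  rw [pairing_self_eq_momentFun, h.momentFun_zero hM]

/-- The area formula differentiated along the chart. -/
theorem IsMomentChart.pairing_fderiv (h : IsMomentChart U a) {M : Coord N} (hM : M ∈ U)
    (v : Coord N) : pairing (a M) (fderiv ℝ a M v) + pairing (fderiv ℝ a M v) (a M) = v.1 := by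
  obtain ⟨h1, h2⟩ := hasFDerivAt_pairing_diag (a M)
  have h3 := h1.hasFDerivAt.comp M (h.hasFDerivAt hM)
  have h4 : ((fun b : Coord N => pairing b b) ∘ a) =ᶠ[𝓝 M] fun M' => ((M'.1 : ℝ) : ℂ) := by
    filter_upwards [h.isOpen.mem_nhds hM] with M' hM'
    exact h.pairing_eq hM'
  have h5 : HasFDerivAt (fun M' : Coord N => ((M'.1 : ℝ) : ℂ))
      (Complex.ofRealCLM.comp (ContinuousLinearMap.fst ℝ ℝ (Fin N → ℂ))) M :=
    (Complex.ofRealCLM.comp (ContinuousLinearMap.fst ℝ ℝ (Fin N → ℂ))).hasFDerivAt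
  have h6 := (h3.congr_of_eventuallyEq h4.symm).unique h5
  have h7 := congrArg (fun L : Coord N →L[ℝ] ℂ => L v) h6
  simpa [h2] using h7

theorem IsMomentChart.fderiv_smoothMoments_apply (h : IsMomentChart U a) {M : Coord N}
    (hM : M ∈ U) (v : Coord N) : fderiv ℝ smoothMoments (a M) (fderiv ℝ a M v) = v := by
  have h1 := (contDiff_smoothMoments.differentiable (by simp)).differentiableAt.hasFDerivAt
    (x := a M)
  have h3 := h1.comp M (h.hasFDerivAt hM)
  have h4 : (smoothMoments ∘ a) =ᶠ[𝓝 M] id := by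
    filter_upwards [h.isOpen.mem_nhds hM] with M' hM'
    exact h.smoothMoments_eq hM'
  have h6 := (h3.congr_of_eventuallyEq h4.symm).unique (hasFDerivAt_id M)
  exact congrArg (fun L : Coord N →L[ℝ] Coord N => L v) h6

theorem circleAverage_polyMap_pow (b : Coord N) (k : ℕ) :
    circleAverage (fun ζ => polyMap b ζ ^ k) 0 1 = 0 ^ k := by
  rw [circleAverage_eq_center (F := fun ζ => polyMap b ζ ^ k) (ρ := 2) (by norm_num)
    ((differentiable_polyMap b).pow k).differentiableOn, polyMap_zero]

/-- The string equation. Along ∂/∂M_0 the averages of f^k B are 1 for k = 0 and 0 for 1 ≤ k ≤ N. The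
constant 1 has the same averages because f(0) = 0, so the vanishing principle applies to B - 1. -/
theorem IsMomentChart.variation_eq_one (h : IsMomentChart U a) {M : Coord N} (hM : M ∈ U) {ζ : ℂ}
    (hζ : ζ ≠ 0) : variation (a M) (fderiv ℝ a M (1, 0)) ζ = 1 := by
  set v := fderiv ℝ a M (1, 0) with hv
  obtain ⟨q, hq, hqζ⟩ := exists_differentiable_variation (a M) v
  have hD := h.fderiv_smoothMoments_apply hM (1, 0)
  rw [← hv, fderiv_smoothMoments] at hD
  rw [← sub_eq_zero]
  refine eq_zero_of_circleAverage_pow_mul_eq_zero (a := a M) (h.admissible M hM).1.ne'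
    (B := fun z => variation (a M) v z - 1)
    (q := fun z => q z - z ^ N) (hq.sub (differentiable_id.pow N)) (fun z hz => ?_) (fun z hz => ?_)
    (fun k hk => ?_) hζ
  · simp only [hqζ z hz]; ring
  · simp [variation_im_on_circle _ _ hz]
  · have hi1 : CircleIntegrable (fun z => polyMap (a M) z ^ k * variation (a M) v z) 0 1 :=
      circleIntegrable_of_continuousOn (((differentiable_polyMap (a M)).continuous.pow
        k).continuousOn.mul (continuousOn_variation (a M) v))
    have hi2 : CircleIntegrable (fun z => polyMap (a M) z ^ k) 0 1 :=
      circleIntegrable_of_continuousOn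
        ((differentiable_polyMap (a M)).continuous.pow k).continuousOn
    simp only [mul_sub, mul_one]
    rw [circleAverage_fun_sub hi1 hi2, circleAverage_polyMap_pow, sub_eq_zero]
    rcases Nat.eq_zero_or_pos k with rfl | hk0
    · simp only [pow_zero, one_mul]
      refine Complex.ext ?_ ?_
      · exact congrArg Prod.fst hD
      · simpa using im_circleAverage_eq_zero (circleIntegrable_variation (a M) v)
          fun z hz => variation_im_on_circle (a M) v hz
    · obtain ⟨j, rfl⟩ : ∃ j, k = j + 1 := ⟨k - 1, by omega⟩
      rw [zero_pow (by omega)]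
      exact congrFun (congrArg Prod.snd hD) ⟨j, by omega⟩

end Chart

end MomentEvolution

/-! ### Branches of the logarithm; W and G in the uniformizing coordinate -/

namespace MomentEvolution

open Complex Metric Set Filter Real MeasureTheory

variable {N : ℕ}

theorem exists_logBranch {w : ℂ} (hw : w ≠ 0) :
    ∃ (O : Set ℂ) (ℓ : ℂ → ℂ), IsLogBranch O ℓ ∧ w ∈ O := by
  refine ⟨{z | z / w ∈ slitPlane}, fun z => log (z / w) + log w, ⟨?_, ?_, ?_⟩, ?_⟩
  · exact isOpen_slitPlane.preimage (by fun_prop)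
  · intro z hz
    exact ((differentiableAt_id.div_const w).clog hz).add_const _ |>.differentiableWithinAt
  · intro z hz
    rw [Complex.exp_add, exp_log (slitPlane_ne_zero hz), exp_log hw, div_mul_cancel₀ _ hw]
  · simp [div_self hw]

theorem IsLogBranch.hasDerivAt {O : Set ℂ} {ℓ : ℂ → ℂ} (h : IsLogBranch O ℓ) {z : ℂ} (hz : z ∈ O) :
    HasDerivAt ℓ (1 / z) z := by
  have h1 := (h.holo.differentiableAt (h.isOpen.mem_nhds hz)).hasDerivAt
  have h2 : HasDerivAt (fun z => exp (ℓ z)) 1 z :=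
    (hasDerivAt_id z).congr_of_eventuallyEq (by
      filter_upwards [h.isOpen.mem_nhds hz] with y hy using h.exp_eq y hy)
  have h3 := h1.cexp.unique h2
  rw [h.exp_eq z hz] at h3
  have hz0 : z ≠ 0 := by rw [← h.exp_eq z hz]; exact Complex.exp_ne_zero _
  refine h1.congr_deriv ?_
  rw [eq_div_iff hz0, mul_comm]; exact h3

theorem IsLogBranch.ne_zero {O : Set ℂ} {ℓ : ℂ → ℂ} (h : IsLogBranch O ℓ) {z : ℂ} (hz : z ∈ O) :
    z ≠ 0 := by
  rw [← h.exp_eq z hz]; exact Complex.exp_ne_zero _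

theorem re_eq_log_norm_of_exp_eq {w z : ℂ} (h : exp w = z) : w.re = Real.log ‖z‖ := by
  rw [← h, norm_exp, Real.log_exp]

theorem IsLogBranch.re_eq {O : Set ℂ} {ℓ : ℂ → ℂ} (h : IsLogBranch O ℓ) {z : ℂ} (hz : z ∈ O) :
    (ℓ z).re = Real.log ‖z‖ := re_eq_log_norm_of_exp_eq (h.exp_eq z hz)

section Domain

variable {b : Coord N} {ρ : ℝ}

theorem isOpen_polyMap_image (hinj : InjOn (polyMap b) (ball 0 ρ)) {s : Set ℂ} (hs : IsOpen s)
    (hsub : s ⊆ ball 0 ρ) : IsOpen (polyMap b '' s) := by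
  rw [isOpen_iff_mem_nhds]
  rintro _ ⟨ζ, hζ, rfl⟩
  have hd : HasStrictDerivAt (polyMap b) (polyDeriv b ζ) ζ := by
    have := ((differentiable_polyMap b).analyticAt ζ).hasStrictDerivAt
    rwa [(hasDerivAt_polyMap b ζ).deriv] at this
  rw [← hd.map_nhds_eq (polyDeriv_ne_zero_of_injOn isOpen_ball hinj (hsub hζ))]
  exact image_mem_map (hs.mem_nhds hζ)

theorem closure_imageDomain (b : Coord N) :
    closure (imageDomain b) = polyMap b '' closedBall 0 1 := by
  have hc := (differentiable_polyMap b).continuous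
  apply Subset.antisymm
  · exact closure_minimal (image_mono ball_subset_closedBall)
      ((isCompact_closedBall _ _).image hc).isClosed
  · rw [← closure_ball (0 : ℂ) one_ne_zero]
    exact image_closure_subset_closure_image hc

theorem frontier_imageDomain (hρ : 1 < ρ) (hinj : InjOn (polyMap b) (ball 0 ρ)) :
    frontier (imageDomain b) = polyMap b '' sphere 0 1 := by
  have ho : IsOpen (imageDomain b) :=
    isOpen_polyMap_image hinj isOpen_ball (ball_subset_ball hρ.le)
  rw [ho.frontier_eq, closure_imageDomain, imageDomain]
  have hsub := closedBall_subset_ball (x := (0 : ℂ)) hρ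
  rw [← (hinj.mono hsub).image_sdiff_subset ball_subset_closedBall]
  congr 1
  exact closedBall_sdiff_ball

end Domain

/-- The principal part `∑ M_k / (k z^k)`. -/
noncomputable def principal (M : Coord N) (z : ℂ) : ℂ :=
  ∑ k : Fin N, M.2 k / ((((k : ℕ) + 1 : ℕ) : ℂ) * z ^ ((k : ℕ) + 1))

/-- Minus the derivative of `principal`. -/
noncomputable def principalDeriv (M : Coord N) (z : ℂ) : ℂ :=
  ∑ k : Fin N, M.2 k / z ^ ((k : ℕ) + 2)

theorem potential_eq (ℓ : ℂ → ℂ) (R : ℂ → Coord N → ℂ) (z : ℂ) (M : Coord N) :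
    potential ℓ R z M = M.1 * ℓ z - principal M z + R z M := rfl

theorem hasDerivAt_principal (M : Coord N) {z : ℂ} (hz : z ≠ 0) :
    HasDerivAt (principal M) (-principalDeriv M z) z := by
  unfold principal principalDeriv
  rw [← Finset.sum_neg_distrib]
  refine HasDerivAt.fun_sum fun k _ => ?_
  have hk : (((k : ℕ) + 1 : ℕ) : ℂ) ≠ 0 := by exact_mod_cast Nat.succ_ne_zero (k : ℕ)
  have h1 := ((hasDerivAt_pow ((k : ℕ) + 1) z).const_mul (((k : ℕ) + 1 : ℕ) : ℂ)).fun_inv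
    (mul_ne_zero hk (pow_ne_zero _ hz))
  simp only [div_eq_mul_inv]
  refine (h1.const_mul (M.2 k)).congr_deriv ?_
  simp only [Nat.add_sub_cancel, pow_succ]
  field_simp

section Regular

/-- The part of the potential which is regular in the domain, in the uniformizing coordinate and
up to an additive constant; `Λ` is a logarithm of `polyQuot b`. -/
noncomputable def regularPart (b M : Coord N) (Λ : ℂ → ℂ) (ζ : ℂ) : ℂ :=
  -M.1 * Λ ζ + laurentPot b b ζ + principal M (polyMap b ζ)

/-- The derivative of `regularPart`. -/
noncomputable def regularDeriv (b M : Coord N) (ζ : ℂ) : ℂ :=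
  polyDeriv b ζ * (schwarz b ζ - M.1 / polyMap b ζ - principalDeriv M (polyMap b ζ))

variable {b M : Coord N} {Λ : ℂ → ℂ} {ρ : ℝ}

theorem polyMap_ne_zero_of_exp (hexp : ∀ ζ ∈ ball (0 : ℂ) ρ, exp (Λ ζ) = polyQuot b ζ) {ζ : ℂ}
    (hζ : ζ ∈ ball (0 : ℂ) ρ) (h0 : ζ ≠ 0) : polyMap b ζ ≠ 0 := by
  rw [polyMap_eq_mul, ← hexp ζ hζ]
  exact mul_ne_zero h0 (Complex.exp_ne_zero _)

theorem hasDerivAt_log_polyQuot (hΛ : DifferentiableOn ℂ Λ (ball 0 ρ))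
    (hexp : ∀ ζ ∈ ball (0 : ℂ) ρ, exp (Λ ζ) = polyQuot b ζ) {ζ : ℂ}
    (hζ : ζ ∈ ball (0 : ℂ) ρ) (h0 : ζ ≠ 0) :
    HasDerivAt Λ (polyDeriv b ζ / polyMap b ζ - 1 / ζ) ζ := by
  have h1 := (hΛ.differentiableAt (isOpen_ball.mem_nhds hζ)).hasDerivAt
  have h2 : HasDerivAt (fun z => z * exp (Λ z)) (polyDeriv b ζ) ζ :=
    (hasDerivAt_polyMap b ζ).congr_of_eventuallyEq (by
      filter_upwards [isOpen_ball.mem_nhds hζ] with z hz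
      rw [hexp z hz, polyMap_eq_mul])
  have h3 := (HasDerivAt.fun_mul (hasDerivAt_id ζ) h1.cexp).unique h2
  refine h1.congr_deriv ?_
  have he := Complex.exp_ne_zero (Λ ζ)
  rw [polyMap_eq_mul, ← hexp ζ hζ, ← h3]
  simp only [id]
  field_simp
  ring

/-- Since log f = log ζ + Λ, the residue term of the Laurent primitive combines with the derivative
of M_0 Λ to give M_0 f'/f. -/
theorem hasDerivAt_regularPart (hp : pairing b b = M.1) (hΛ : DifferentiableOn ℂ Λ (ball 0 ρ))
    (hexp : ∀ ζ ∈ ball (0 : ℂ) ρ, exp (Λ ζ) = polyQuot b ζ) {ζ : ℂ}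
    (hζ : ζ ∈ ball (0 : ℂ) ρ) (h0 : ζ ≠ 0) :
    HasDerivAt (regularPart b M Λ) (regularDeriv b M ζ) ζ := by
  have hf := polyMap_ne_zero_of_exp hexp hζ h0
  have h1 := (hasDerivAt_principal M hf).comp ζ (hasDerivAt_polyMap b ζ)
  refine ((((hasDerivAt_log_polyQuot hΛ hexp hζ h0).const_mul (-(M.1 : ℂ))).add
    (hasDerivAt_laurentPot b b h0)).add h1).congr_deriv ?_
  rw [hp, regularDeriv]
  field_simp
  ring

end Regular

theorem eventually_eq_of_eq_on_circle {F G : ℂ → ℂ} (hF : AnalyticAt ℂ F 1) (hG : AnalyticAt ℂ G 1)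
    (h : ∀ ζ : ℂ, ‖ζ‖ = 1 → F ζ = G ζ) : F =ᶠ[𝓝 1] G := by
  refine (hF.frequently_eq_iff_eventually_eq hG).1 ?_
  have h1 : HasDerivAt (circleMap 0 1) (circleMap 0 1 0 * I) 0 := hasDerivAt_circleMap 0 1 0
  have h2 := h1.tendsto_nhdsNE (by simp [circleMap])
  have h3 : circleMap 0 1 0 = (1 : ℂ) := by simp [circleMap]
  rw [h3] at h2
  refine h2.frequently (Eventually.frequently (Eventually.of_forall fun θ => ?_))
  exact h _ (by simp)

section Uniqueness

variable {U : Set (Coord N)} {a : Coord N → Coord N} {𝒟 : Set (ℂ × Coord N)}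
  {S R Γ : ℂ → Coord N → ℂ} {M : Coord N} {ρ : ℝ} {Λ : ℂ → ℂ}

/-- A potential is known to be a primitive of S only near the boundary. There S∘f agrees with
`schwarz` by the identity theorem, so R∘f and `regularPart` have equal derivatives near ζ = 1; their
difference then stays constant throughout the punctured disk. -/
theorem exists_const_regularPart (hU : IsMomentChart U a) (h𝒟 : IsOpen 𝒟)
    (hS : ∀ M ∈ U, IsSchwarzFunction (imageDomain (a M)) (fun z => S z M))
    (hR : IsSchwarzPrimitive U a 𝒟 S R) (hM : M ∈ U) (hρ : 1 < ρ)
    (hinj : InjOn (polyMap (a M)) (ball 0 ρ)) (hdom : ∀ ζ ∈ ball (0 : ℂ) ρ, (polyMap (a M) ζ, M) ∈ 𝒟)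
    (hΛ : DifferentiableOn ℂ Λ (ball 0 ρ))
    (hexp : ∀ ζ ∈ ball (0 : ℂ) ρ, exp (Λ ζ) = polyQuot (a M) ζ) :
    DifferentiableOn ℂ (fun ζ => R (polyMap (a M) ζ) M) (ball 0 ρ) ∧
    ∃ C : ℂ, ∀ ζ ∈ ball (0 : ℂ) ρ, ζ ≠ 0 →
      R (polyMap (a M) ζ) M = regularPart (a M) M Λ ζ + C := by
  set b := a M with hb
  have hslice : IsOpen {z | (z, M) ∈ 𝒟} := h𝒟.preimage (by fun_prop : Continuous fun z : ℂ => (z, M))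
  have hr : DifferentiableOn ℂ (fun ζ => R (polyMap b ζ) M) (ball 0 ρ) :=
    (hR.holo M hM).comp (differentiable_polyMap b).differentiableOn hdom
  refine ⟨hr, ?_⟩
  have h1mem : (1 : ℂ) ∈ ball (0 : ℂ) ρ := by simpa using hρ
  have hf1 := polyMap_ne_zero_of_exp hexp h1mem one_ne_zero
  have hfront : ∀ ζ : ℂ, ‖ζ‖ = 1 → polyMap b ζ ∈ frontier (imageDomain b) := fun ζ hζ => by
    rw [frontier_imageDomain hρ hinj]; exact ⟨ζ, by simpa using hζ, rfl⟩
  have hP : pairing b b = M.1 := hU.pairing_eq hM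
  obtain ⟨V, hV, hVf, hSV, hSeq⟩ := hS M hM
  obtain ⟨V', hV', hV'f, hprim⟩ := hR.primitive M hM
  obtain ⟨O, ℓ, hℓ, h1O⟩ := exists_logBranch hf1
  have hSan : (fun ζ => S (polyMap b ζ) M) =ᶠ[𝓝 1] schwarz b := by
    apply eventually_eq_of_eq_on_circle
    · have : AnalyticAt ℂ (fun z => S z M) (polyMap b 1) :=
        hSV.analyticAt (hV.mem_nhds (hVf (hfront 1 (by simp))))
      exact this.comp ((differentiable_polyMap b).analyticAt 1)
    · have : DifferentiableOn ℂ (schwarz b) {z | z ≠ 0} := fun z hz =>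
        (hasDerivAt_schwarz b hz).differentiableAt.differentiableWithinAt
      exact this.analyticAt (isOpen_ne.mem_nhds one_ne_zero)
    · intro ζ hζ
      simp only [hSeq _ (hfront ζ hζ), schwarz_eq_conj b hζ]
  set T : ℂ → ℂ := fun ζ => R (polyMap b ζ) M - regularPart b M Λ ζ with hT
  have hTd : ∀ ζ ∈ ball (0 : ℂ) ρ, ζ ≠ 0 → DifferentiableAt ℂ T ζ := fun ζ hζ h0 =>
    (hr.differentiableAt (isOpen_ball.mem_nhds hζ)).sub
      (hasDerivAt_regularPart hP hΛ hexp hζ h0).differentiableAt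
  have hT0 : ∀ᶠ ζ in 𝓝 (1 : ℂ), HasDerivAt T 0 ζ := by
    have hc := (differentiable_polyMap b).continuous
    filter_upwards [hSan, isOpen_ball.mem_nhds h1mem, isOpen_ne.mem_nhds one_ne_zero,
      (hc.tendsto 1).eventually (hV'.mem_nhds (hV'f (hfront 1 (by simp)))),
      (hc.tendsto 1).eventually (hℓ.isOpen.mem_nhds h1O)] with ζ e1 e2 e3 e4 e5
    have hfz := hℓ.ne_zero e5
    have d1 := hprim O ℓ hℓ _ ⟨e5, e4⟩
    have d2 : HasDerivAt (fun z => R z M) (S (polyMap b ζ) M - M.1 * (1 / polyMap b ζ) +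
        -principalDeriv M (polyMap b ζ)) (polyMap b ζ) := by
      have := (d1.sub ((hℓ.hasDerivAt e5).const_mul (M.1 : ℂ))).add (hasDerivAt_principal M hfz)
      refine this.congr_of_eventuallyEq (Eventually.of_forall fun z => ?_)
      simp only [potential_eq, Pi.add_apply, Pi.sub_apply]
      ring
    have d3 := d2.comp ζ (hasDerivAt_polyMap b ζ)
    refine (d3.sub (hasDerivAt_regularPart hP hΛ hexp e2 e3)).congr_deriv ?_
    rw [e1, regularDeriv]
    ring
  -- Local constancy near 1 extends by the identity theorem on the connected punctured disk. The
  -- point 0 is left out because `regularPart` is a sum of terms singular there.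
  obtain ⟨ε, hε, hball⟩ := Metric.eventually_nhds_iff_ball.1 hT0
  have hTc : T =ᶠ[𝓝 1] fun _ => T 1 := by
    filter_upwards [ball_mem_nhds (1 : ℂ) hε] with ζ hζ
    exact isOpen_ball.is_const_of_deriv_eq_zero (convex_ball _ _).isPreconnected
      (fun x hx => (hball x hx).differentiableAt.differentiableWithinAt)
      (fun x hx => (hball x hx).deriv) hζ (mem_ball_self hε)
  have ho : IsOpen (ball (0 : ℂ) ρ \ {0}) := isOpen_ball.sdiff isClosed_singleton
  have hTon : DifferentiableOn ℂ T (ball (0 : ℂ) ρ \ {0}) := fun ζ hζ =>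
    (hTd ζ hζ.1 hζ.2).differentiableWithinAt
  have heq := (hTon.analyticOnNhd ho).eqOn_of_preconnected_of_eventuallyEq
    (g := fun _ => T 1) analyticOnNhd_const (isPreconnected_ball_diff_zero ρ)
    (z₀ := 1) ⟨h1mem, by simp⟩ hTc
  refine ⟨T 1, fun ζ hζ h0 => ?_⟩
  have := heq (x := ζ) ⟨hζ, h0⟩
  simp only [hT] at this ⊢
  rw [← this]; ring

/-- Γ∘f - Λ is holomorphic. Its real part vanishes on the circle because g tends to 0 at the
boundary, where Re Λ = log|f|. So it is an imaginary constant, and the normalization at 0 makes it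
zero. -/
theorem green_eq_log (h𝒟 : IsOpen 𝒟) (hΓ : IsComplexGreen U a 𝒟 Γ) (hM : M ∈ U) (hρ : 1 < ρ)
    (hinj : InjOn (polyMap (a M)) (ball 0 ρ)) (hdom : ∀ ζ ∈ ball (0 : ℂ) ρ, (polyMap (a M) ζ, M) ∈ 𝒟)
    (hΛ : DifferentiableOn ℂ Λ (ball 0 ρ))
    (hexp : ∀ ζ ∈ ball (0 : ℂ) ρ, exp (Λ ζ) = polyQuot (a M) ζ) (him : (Λ 0).im = 0) :
    ∀ ζ ∈ ball (0 : ℂ) ρ, Γ (polyMap (a M) ζ) M = Λ ζ := by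
  set b := a M with hb
  have hslice : IsOpen {z | (z, M) ∈ 𝒟} := h𝒟.preimage (by fun_prop : Continuous fun z : ℂ => (z, M))
  have hF : DifferentiableOn ℂ (fun ζ => Γ (polyMap b ζ) M - Λ ζ) (ball 0 ρ) :=
    ((hΓ.holo M hM).comp (differentiable_polyMap b).differentiableOn hdom).sub hΛ
  have hsub := closedBall_subset_ball (x := (0 : ℂ)) hρ
  obtain ⟨g, ⟨-, hg0⟩, hre⟩ := hΓ.re_eq M hM
  have key := eq_center_of_re_sphere_eq_zero hρ hF (fun ζ hζ => by
    have hζρ : ζ ∈ ball (0 : ℂ) ρ := by simpa [hζ] using hρ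
    have hfz := polyMap_ne_zero_of_exp hexp hζρ (ne_zero_of_norm_eq_one hζ)
    have hfr : polyMap b ζ ∈ frontier (imageDomain b) := by
      rw [frontier_imageDomain hρ hinj]; exact ⟨ζ, by simpa using hζ, rfl⟩
    have hne : (𝓝[imageDomain b] (polyMap b ζ)).NeBot :=
      mem_closure_iff_nhdsWithin_neBot.1 (frontier_subset_closure hfr)
    have hcont : ContinuousAt (fun z => -Real.log ‖z‖ + (Γ z M).re) (polyMap b ζ) := by
      have c1 : ContinuousAt (fun z => Γ z M) (polyMap b ζ) :=
        ((hΓ.holo M hM).differentiableAt (hslice.mem_nhds (hdom ζ hζρ))).continuousAt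
      have c2 : ContinuousAt (fun z : ℂ => Real.log ‖z‖) (polyMap b ζ) :=
        continuousAt_id.norm.log (by simpa using hfz)
      exact c2.neg.add (Complex.continuous_re.continuousAt.comp c1)
    have hlim := hcont.tendsto.mono_left (nhdsWithin_le_nhds (s := imageDomain b))
    have heq : (fun z => -Real.log ‖z‖ + (Γ z M).re) =ᶠ[𝓝[imageDomain b] (polyMap b ζ)] g := by
      filter_upwards [self_mem_nhdsWithin, nhdsWithin_le_nhds (isOpen_ne.mem_nhds hfz)] with z hz hz0
      obtain ⟨O, ℓ, hℓ, hzO⟩ := exists_logBranch hz0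
      rw [← hre O ℓ hℓ z ⟨hzO, hz⟩, greenBranch, add_re, neg_re, hℓ.re_eq hzO]
    have h0 := tendsto_nhds_unique hlim ((hg0 _ hfr).congr' heq.symm)
    have h1 : (Λ ζ).re = Real.log ‖polyMap b ζ‖ := by
      rw [re_eq_log_norm_of_exp_eq (hexp ζ hζρ), polyMap_eq_mul, norm_mul, hζ, one_mul]
    rw [sub_re, h1]
    linarith)
  intro ζ hζ
  have h00 : (0 : ℂ) ∈ ball (0 : ℂ) ρ := by simp; linarith
  have h1 := (key ζ hζ).1
  have h2 : Γ (polyMap b 0) M - Λ 0 = 0 := by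
    refine Complex.ext (key 0 h00).2 ?_
    rw [sub_im, him, polyMap_zero, hΓ.imag M hM]; simp
  rw [h2] at h1
  exact sub_eq_zero.1 h1

end Uniqueness

end MomentEvolution

/-! ### Local frames: uniform univalence and a smooth family of logarithms -/

namespace MomentEvolution

open Complex Metric Set Filter Real MeasureTheory

variable {N : ℕ}

/-- A neighbourhood `𝒰` of moments and a disk of radius `ρ > 1` on which the conformal maps are
univalent with images in `𝒟`, with a smooth family `Λ` of logarithms of `f(ζ;M)/ζ`. -/
structure IsLocalFrame (U : Set (Coord N)) (a : Coord N → Coord N) (𝒟 : Set (ℂ × Coord N)) (ρ : ℝ)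
    (𝒰 : Set (Coord N)) (Λ : ℂ → Coord N → ℂ) : Prop where
  one_lt : 1 < ρ
  isOpen : IsOpen 𝒰
  subset : 𝒰 ⊆ U
  inj : ∀ M ∈ 𝒰, InjOn (polyMap (a M)) (ball 0 ρ)
  dom : ∀ M ∈ 𝒰, ∀ ζ ∈ ball (0 : ℂ) ρ, (polyMap (a M) ζ, M) ∈ 𝒟
  holo : ∀ M ∈ 𝒰, DifferentiableOn ℂ (fun ζ => Λ ζ M) (ball 0 ρ)
  exp_eq : ∀ M ∈ 𝒰, ∀ ζ ∈ ball (0 : ℂ) ρ, exp (Λ ζ M) = polyQuot (a M) ζ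
  im_zero : ∀ M ∈ 𝒰, (Λ 0 M).im = 0
  smooth : ContDiffOn ℝ ∞ (fun p : ℂ × Coord N => Λ p.1 p.2) (ball 0 ρ ×ˢ 𝒰)

variable {U : Set (Coord N)} {a : Coord N → Coord N} {𝒟 : Set (ℂ × Coord N)}

/-- The logarithm at the base point M is continued to nearby M' by adding the principal logarithm of
the quotient of the two values of f/ζ. This quotient is 1 at M' = M, hence in the slit plane nearby,
and compactness of the closed disk makes this uniform in ζ. -/
theorem IsMomentChart.exists_localFrame (hU : IsMomentChart U a) (h𝒟 : IsDomainNhd U a 𝒟)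
    {M : Coord N} (hM : M ∈ U) :
    ∃ (ρ : ℝ) (𝒰 : Set (Coord N)) (Λ : ℂ → Coord N → ℂ), M ∈ 𝒰 ∧ IsLocalFrame U a 𝒟 ρ 𝒰 Λ := by
  have hadm := hU.admissible M hM
  obtain ⟨ρ₀, hρ₀, hinj₀⟩ := hadm.exists_ball
  obtain ⟨ρ₁, hρ₁, hρ₁₀⟩ := exists_between hρ₀
  have hac : ContinuousAt a M := (hU.contDiffAt hM).continuousAt
  have hinj₁ : ∀ᶠ M' in 𝓝 M, InjOn (polyMap (a M')) (ball 0 ρ₁) :=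
    hac.eventually (eventually_injOn_ball hinj₀ hρ₁₀)
  have hu0 : ∀ ζ ∈ ball (0 : ℂ) ρ₁, polyQuot (a M) ζ ≠ 0 := fun ζ hζ =>
    polyQuot_ne_zero_of_injOn hadm.1.ne' (by simp; linarith) hinj₀ (ball_subset_ball hρ₁₀.le hζ)
  obtain ⟨l, hl, hl0, hlexp⟩ := exists_log_on_ball (by linarith : 0 < ρ₁)
    (differentiable_polyQuot (a M)).differentiableOn hu0 (c := (Real.log (a M).1 : ℂ)) (by
      rw [← Complex.ofReal_exp, Real.exp_log hadm.1, polyQuot_zero])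
  have hquot : ∀ ζ : ℂ, ContinuousAt (fun p : ℂ × Coord N => polyQuot (a p.2) p.1) (ζ, M) :=
    fun ζ => ContinuousAt.comp (g := fun q : Coord N × ℂ => polyQuot q.1 q.2)
      (f := fun p : ℂ × Coord N => (a p.2, p.1))
      (contDiff_polyQuot (n := 0)).continuous.continuousAt
      ((ContinuousAt.comp (f := Prod.snd) (g := a) hac continuousAt_snd).prodMk continuousAt_fst)
  have hmap : ∀ ζ : ℂ, ContinuousAt (fun p : ℂ × Coord N => polyMap (a p.2) p.1) (ζ, M) :=
    fun ζ => ContinuousAt.comp (g := fun q : Coord N × ℂ => polyMap q.1 q.2)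
      (f := fun p : ℂ × Coord N => (a p.2, p.1))
      (contDiff_polyMap (n := 0)).continuous.continuousAt
      ((ContinuousAt.comp (f := Prod.snd) (g := a) hac continuousAt_snd).prodMk continuousAt_fst)
  have hn : {p : ℂ × Coord N | (polyMap (a p.2) p.1, p.2) ∈ 𝒟 ∧
      polyQuot (a p.2) p.1 / polyQuot (a M) p.1 ∈ slitPlane} ∈ 𝓝ˢ (closedBall (0 : ℂ) 1 ×ˢ {M}) := by
    rw [mem_nhdsSet_iff_forall]
    rintro ⟨ζ, M'⟩ ⟨hζ, hM'⟩
    obtain rfl : M' = M := hM'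
    have hζ1 : ζ ∈ ball (0 : ℂ) ρ₁ := closedBall_subset_ball hρ₁ hζ
    refine Filter.inter_mem ?_ ?_
    · refine ((hmap ζ).prodMk continuousAt_snd).preimage_mem_nhds (h𝒟.1.mem_nhds ?_)
      exact h𝒟.2 M' hM _ (by rw [closure_imageDomain]; exact ⟨ζ, hζ, rfl⟩)
    · have hc : ContinuousAt (fun p : ℂ × Coord N => polyQuot (a M') p.1) (ζ, M') :=
        ((differentiable_polyQuot (a M')).continuous.comp continuous_fst).continuousAt
      refine ((hquot ζ).div hc (hu0 ζ hζ1)).preimage_mem_nhds (isOpen_slitPlane.mem_nhds ?_)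
      simp [div_self (hu0 ζ hζ1)]
  rw [(isCompact_closedBall (0 : ℂ) 1).nhdsSet_prod_eq isCompact_singleton, nhdsSet_singleton,
    Filter.mem_prod_iff] at hn
  obtain ⟨V, hV, W, hW, hVW⟩ := hn
  obtain ⟨ρ₂, hρ₂, hρ₂V⟩ := exists_ball_subset isOpen_interior (subset_interior_iff_mem_nhdsSet.2 hV)
  set ρ := min ρ₁ ρ₂ with hρdef
  have hρ : 1 < ρ := lt_min hρ₁ hρ₂
  have hsub₁ : ball (0 : ℂ) ρ ⊆ ball 0 ρ₁ := ball_subset_ball (min_le_left _ _)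
  have hsubV : ball (0 : ℂ) ρ ⊆ V :=
    (ball_subset_ball (min_le_right _ _)).trans (hρ₂V.trans interior_subset)
  set 𝒰 := interior (W ∩ U ∩ {M' | InjOn (polyMap (a M')) (ball 0 ρ₁)}) with h𝒰
  have h𝒰sub : 𝒰 ⊆ W ∩ U ∩ {M' | InjOn (polyMap (a M')) (ball 0 ρ₁)} := interior_subset
  have hslit : ∀ M' ∈ 𝒰, ∀ ζ ∈ ball (0 : ℂ) ρ,
      polyQuot (a M') ζ / polyQuot (a M) ζ ∈ slitPlane := fun M' hM' ζ hζ => by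
    have hm : (ζ, M') ∈ V ×ˢ W := ⟨hsubV hζ, (h𝒰sub hM').1.1⟩
    exact (hVW hm).2
  refine ⟨ρ, 𝒰, fun ζ M' => l ζ + log (polyQuot (a M') ζ / polyQuot (a M) ζ), ?_,
    ⟨hρ, isOpen_interior, fun M' hM' => (h𝒰sub hM').1.2, ?_, ?_, ?_, ?_, ?_, ?_⟩⟩
  · exact mem_interior_iff_mem_nhds.2 (inter_mem (inter_mem hW (hU.isOpen.mem_nhds hM)) hinj₁)
  · exact fun M' hM' => (h𝒰sub hM').2.mono hsub₁
  · intro M' hM' ζ hζ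
    have hm : (ζ, M') ∈ V ×ˢ W := ⟨hsubV hζ, (h𝒰sub hM').1.1⟩
    exact (hVW hm).1
  · intro M' hM'
    exact (hl.mono hsub₁).add (((differentiable_polyQuot (a M')).differentiableOn.div
      (differentiable_polyQuot (a M)).differentiableOn fun ζ hζ => hu0 ζ (hsub₁ hζ)).clog
        (hslit M' hM'))
  · intro M' hM' ζ hζ
    rw [Complex.exp_add, hlexp ζ (hsub₁ hζ), exp_log (slitPlane_ne_zero (hslit M' hM' ζ hζ)),
      mul_div_cancel₀ _ (hu0 ζ (hsub₁ hζ))]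
  · intro M' hM'
    have hpos := (hU.admissible M' (h𝒰sub hM').1.2).1
    simp only [hl0, polyQuot_zero, add_im, ofReal_im, zero_add, log_im]
    rw [← ofReal_div]
    exact Complex.arg_ofReal_of_nonneg (div_nonneg hpos.le hadm.1.le)
  · rintro ⟨ζ, M'⟩ ⟨hζ, hM'⟩
    have hζ : ζ ∈ ball (0 : ℂ) ρ := hζ
    have hM' : M' ∈ 𝒰 := hM'
    have c1 : ContDiffAt ℝ ∞ (fun p : ℂ × Coord N => l p.1) (ζ, M') := by
      have : ContDiffAt ℝ ∞ l ζ :=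
        ((hl.contDiffOn (n := ∞) isOpen_ball).contDiffAt
          (isOpen_ball.mem_nhds (hsub₁ hζ))).restrict_scalars ℝ
      exact ContDiffAt.comp (f := Prod.fst) (g := l) (ζ, M') this contDiffAt_fst
    have c2 : ContDiffAt ℝ ∞ (fun p : ℂ × Coord N => polyQuot (a p.2) p.1) (ζ, M') :=
      ContDiffAt.comp (g := fun q : Coord N × ℂ => polyQuot q.1 q.2)
        (f := fun p : ℂ × Coord N => (a p.2, p.1)) (ζ, M') contDiff_polyQuot.contDiffAt
        ((ContDiffAt.comp (f := Prod.snd) (g := a) (ζ, M') (hU.contDiffAt (h𝒰sub hM').1.2)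
          contDiffAt_snd).prodMk contDiffAt_fst)
    have c3 : ContDiffAt ℝ ∞ (fun p : ℂ × Coord N => polyQuot (a M) p.1) (ζ, M') :=
      ContDiffAt.comp (g := fun q : Coord N × ℂ => polyQuot q.1 q.2)
        (f := fun p : ℂ × Coord N => (a M, p.1)) (ζ, M') contDiff_polyQuot.contDiffAt
        (contDiffAt_const.prodMk contDiffAt_fst)
    have c4 : ContDiffAt ℝ ∞ Complex.log (polyQuot (a M') ζ / polyQuot (a M) ζ) :=
      (Complex.contDiffAt_log (hslit M' hM' ζ hζ)).restrict_scalars ℝ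
    have c5 : ContDiffAt ℝ ∞ (fun p : ℂ × Coord N => polyQuot (a p.2) p.1 / polyQuot (a M) p.1)
        (ζ, M') := by
      simp only [div_eq_mul_inv]
      exact c2.mul (c3.inv (hu0 ζ (hsub₁ hζ)))
    exact (c1.add (ContDiffAt.comp (ζ, M') (g := Complex.log) c4 c5)).contDiffWithinAt

end MomentEvolution

/-! ### The additive constant of the potential and its derivatives -/

namespace MomentEvolution

open Complex Metric Set Filter Real MeasureTheory

variable {N : ℕ} {U : Set (Coord N)} {a : Coord N → Coord N} {𝒟 : Set (ℂ × Coord N)}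
  {S R Γ : ℂ → Coord N → ℂ} {ρ : ℝ} {𝒰 : Set (Coord N)} {Λ : ℂ → Coord N → ℂ}

theorem contDiffAt_principal {p : Coord N × ℂ} (hp : p.2 ≠ 0) :
    ContDiffAt ℝ ∞ (fun p : Coord N × ℂ => principal p.1 p.2) p := by
  unfold principal
  refine ContDiffAt.sum fun k _ => ?_
  simp only [div_eq_mul_inv]
  have h1 : ContDiff ℝ ∞ (fun p : Coord N × ℂ => p.1.2 k) := by fun_prop
  have hk : (((k : ℕ) + 1 : ℕ) : ℂ) ≠ 0 := by exact_mod_cast Nat.succ_ne_zero (k : ℕ)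
  exact h1.contDiffAt.mul ((contDiffAt_const.mul (contDiffAt_snd.pow _)).inv
    (mul_ne_zero hk (pow_ne_zero _ hp)))

theorem IsMomentChart.hasFDerivAt_polyMap (hU : IsMomentChart U a) {M : Coord N} (hM : M ∈ U)
    (ζ : ℂ) : HasFDerivAt (fun M => polyMap (a M) ζ) ((polyMapL ζ).comp (fderiv ℝ a M)) M :=
  (polyMapL ζ).hasFDerivAt.comp M (hU.hasFDerivAt hM)

theorem IsMomentChart.hasFDerivAt_schwarz (hU : IsMomentChart U a) {M : Coord N} (hM : M ∈ U)
    (ζ : ℂ) : HasFDerivAt (fun M => schwarz (a M) ζ) ((schwarzL ζ).comp (fderiv ℝ a M)) M :=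
  (schwarzL ζ).hasFDerivAt.comp M (hU.hasFDerivAt hM)

theorem IsMomentChart.contDiffOn_polyMap (hU : IsMomentChart U a) (ζ : ℂ) :
    ContDiffOn ℝ ∞ (fun M => polyMap (a M) ζ) U :=
  (polyMapL ζ).contDiff.comp_contDiffOn hU.smooth

theorem IsMomentChart.contDiffOn_laurentPot (hU : IsMomentChart U a) (ζ : ℂ) :
    ContDiffOn ℝ ∞ (fun M => laurentPot (a M) (a M) ζ) U :=
  (contDiff_laurentPot_diag ζ).comp_contDiffOn hU.smooth

theorem IsMomentChart.fderiv_laurentPot (hU : IsMomentChart U a) {M : Coord N} (hM : M ∈ U)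
    (v : Coord N) (ζ : ℂ) : fderiv ℝ (fun M => laurentPot (a M) (a M) ζ) M v =
      laurentPot (a M) (fderiv ℝ a M v) ζ + laurentPot (fderiv ℝ a M v) (a M) ζ := by
  have h1 := (((contDiff_laurentPot_diag (n := 1) ζ).differentiable one_ne_zero).differentiableAt
    (x := a M)).hasFDerivAt.comp M (hU.hasFDerivAt hM)
  have h2 : HasFDerivAt (fun M => laurentPot (a M) (a M) ζ) _ M := h1
  rw [h2.fderiv, ContinuousLinearMap.comp_apply, fderiv_laurentPot_diag]

namespace IsLocalFrame

theorem polyMap_ne_zero (hF : IsLocalFrame U a 𝒟 ρ 𝒰 Λ) {M : Coord N} (hM : M ∈ 𝒰) {ζ : ℂ}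
    (hζ : ζ ∈ ball (0 : ℂ) ρ) (h0 : ζ ≠ 0) : polyMap (a M) ζ ≠ 0 :=
  polyMap_ne_zero_of_exp (hF.exp_eq M hM) hζ h0

theorem mem_ball_of_norm_eq_one (hF : IsLocalFrame U a 𝒟 ρ 𝒰 Λ) {ζ : ℂ} (hζ : ‖ζ‖ = 1) :
    ζ ∈ ball (0 : ℂ) ρ := by
  simpa [hζ] using hF.one_lt

theorem one_mem (hF : IsLocalFrame U a 𝒟 ρ 𝒰 Λ) : (1 : ℂ) ∈ ball (0 : ℂ) ρ :=
  hF.mem_ball_of_norm_eq_one (by simp)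

/-- The circle average of the principal part is smooth, with the expected derivative. -/
theorem circleAverage_principal (hU : IsMomentChart U a) (hF : IsLocalFrame U a 𝒟 ρ 𝒰 Λ) :
    ContDiffOn ℝ ∞ (fun M => circleAverage (fun ζ => principal M (polyMap (a M) ζ)) 0 1) 𝒰 ∧
    ∀ M ∈ 𝒰, fderiv ℝ (fun M => circleAverage (fun ζ => principal M (polyMap (a M) ζ)) 0 1) M
      (1, 0) = -circleAverage (fun ζ => principalDeriv M (polyMap (a M) ζ) *
        polyMap (fderiv ℝ a M (1, 0)) ζ) 0 1 := by
  set φ : Coord N → ℂ → ℂ := fun M ζ => principal M (polyMap (a M) ζ) with hφ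
  have hsm : ContDiffOn ℝ ∞ (fun p : Coord N × ℝ => φ p.1 (circleMap 0 1 p.2)) (𝒰 ×ˢ univ) := by
    rintro ⟨M, θ⟩ ⟨hM, -⟩
    have hM : M ∈ 𝒰 := hM
    have hn : ‖circleMap 0 1 θ‖ = 1 := by simp
    have h1 : ContDiffAt ℝ ∞ (fun p : Coord N × ℝ => polyMap (a p.1) (circleMap 0 1 p.2)) (M, θ) :=
      ContDiffAt.comp (g := fun q : Coord N × ℂ => polyMap q.1 q.2)
        (f := fun p : Coord N × ℝ => (a p.1, circleMap 0 1 p.2)) (M, θ) contDiff_polyMap.contDiffAt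
        ((ContDiffAt.comp (f := Prod.fst) (g := a) (M, θ) (hU.contDiffAt (hF.subset hM))
          contDiffAt_fst).prodMk ((contDiff_circleMap 0 1).comp contDiff_snd).contDiffAt)
    exact (ContDiffAt.comp (g := fun q : Coord N × ℂ => principal q.1 q.2)
      (f := fun p : Coord N × ℝ => (p.1, polyMap (a p.1) (circleMap 0 1 p.2))) (M, θ)
      (contDiffAt_principal (hF.polyMap_ne_zero hM (hF.mem_ball_of_norm_eq_one hn)
        (ne_zero_of_norm_eq_one hn))) (contDiffAt_fst.prodMk h1)).contDiffWithinAt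
  obtain ⟨h1, h2⟩ := circleAverage_hasFDerivAt (φ := φ) hF.isOpen hsm
  refine ⟨h1, fun M hM => ?_⟩
  rw [h2 M hM, ← neg_one_smul ℂ, ← circleAverage_fun_smul]
  apply circleAverage_congr_sphere
  intro ζ hζ
  have hn : ‖ζ‖ = 1 := by simpa using hζ
  have hfz := hF.polyMap_ne_zero hM (hF.mem_ball_of_norm_eq_one hn) (ne_zero_of_norm_eq_one hn)
  have hMU := hF.subset hM
  have e1 := hU.hasFDerivAt_polyMap hMU ζ
  have e2 : HasFDerivAt (fun q : Coord N × ℂ => principal q.1 q.2)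
      (fderiv ℝ (fun q : Coord N × ℂ => principal q.1 q.2) (M, polyMap (a M) ζ))
      (M, polyMap (a M) ζ) :=
    ((contDiffAt_principal (p := (M, polyMap (a M) ζ)) hfz).differentiableAt (by simp)).hasFDerivAt
  have e3 : HasFDerivAt (fun y => φ y ζ) _ M :=
    HasFDerivAt.comp (f := fun M => (M, polyMap (a M) ζ)) M e2 ((hasFDerivAt_id M).prodMk e1)
  simp only [e3.fderiv]
  have e4 : HasFDerivAt (fun z : ℂ => principal M z)
      ((fderiv ℝ (fun q : Coord N × ℂ => principal q.1 q.2) (M, polyMap (a M) ζ)).comp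
        (ContinuousLinearMap.inr ℝ (Coord N) ℂ)) (polyMap (a M) ζ) :=
    HasFDerivAt.comp (f := fun z => (M, z)) _ e2 ((hasFDerivAt_const _ _).prodMk (hasFDerivAt_id _))
  have e5 := e4.unique ((hasDerivAt_principal M hfz).hasFDerivAt.restrictScalars ℝ)
  have e6 : HasFDerivAt (fun t : ℝ => principal ((t, M.2) : Coord N) (polyMap (a M) ζ))
      ((fderiv ℝ (fun q : Coord N × ℂ => principal q.1 q.2) (M, polyMap (a M) ζ)).comp
        ((ContinuousLinearMap.inl ℝ (Coord N) ℂ).comp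
          (ContinuousLinearMap.inl ℝ ℝ (Fin N → ℂ)))) M.1 :=
    HasFDerivAt.comp (f := fun t : ℝ => (((t, M.2) : Coord N), polyMap (a M) ζ)) M.1 e2
      (HasFDerivAt.comp (g := fun M' : Coord N => (M', polyMap (a M) ζ))
        (f := fun t : ℝ => ((t, M.2) : Coord N)) M.1
        (hasFDerivAt_prodMk_left M (polyMap (a M) ζ)) (hasFDerivAt_prodMk_left M.1 M.2))
  -- The principal part involves only M_1, ..., M_N, so along ∂/∂M_0 it varies only through f.
  have e7 := e6.unique (hasFDerivAt_const (principal M (polyMap (a M) ζ)) M.1)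
  have e5' := congrArg (fun L : ℂ →L[ℝ] ℂ => L (polyMap (fderiv ℝ a M (1, 0)) ζ)) e5
  have e7' := congrArg (fun L : ℝ →L[ℝ] ℂ => L 1) e7
  simp only [ContinuousLinearMap.comp_apply, ContinuousLinearMap.inr_apply,
    ContinuousLinearMap.inl_apply, ContinuousLinearMap.coe_restrictScalars',
    ContinuousLinearMap.toSpanSingleton_apply, zero_apply, smul_eq_mul] at e5' e7'
  have e8 : (((1 : ℝ), (0 : Fin N → ℂ)), polyMap (fderiv ℝ a M (1, 0)) ζ) =
      ((((1 : ℝ), (0 : Fin N → ℂ)), (0 : ℂ)) : Coord N × ℂ) +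
        ((0 : Coord N), polyMap (fderiv ℝ a M (1, 0)) ζ) := by simp
  simp only [ContinuousLinearMap.comp_apply, ContinuousLinearMap.prod_apply,
    ContinuousLinearMap.id_apply, polyMapL_apply]
  rw [e8, map_add, e7', e5']
  ring

end IsLocalFrame

/-- The additive constant of the potential in the uniformizing coordinate. -/
noncomputable def normConst (a : Coord N → Coord N) (R Λ : ℂ → Coord N → ℂ) (M : Coord N) : ℂ :=
  R (polyMap (a M) 1) M - regularPart (a M) M (fun ζ => Λ ζ M) 1

namespace IsLocalFrame

section

variable (hU : IsMomentChart U a) (h𝒟 : IsDomainNhd U a 𝒟)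
  (hS : ∀ M ∈ U, IsSchwarzFunction (imageDomain (a M)) (fun z => S z M))
  (hR : IsSchwarzPrimitive U a 𝒟 S R) (hF : IsLocalFrame U a 𝒟 ρ 𝒰 Λ)

include hU h𝒟 hS hR hF

theorem regular_eq {M : Coord N} (hM : M ∈ 𝒰) :
    DifferentiableOn ℂ (fun ζ => R (polyMap (a M) ζ) M) (ball 0 ρ) ∧
    ∀ ζ ∈ ball (0 : ℂ) ρ, ζ ≠ 0 → R (polyMap (a M) ζ) M =
      regularPart (a M) M (fun ζ => Λ ζ M) ζ + normConst a R Λ M := by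
  obtain ⟨h1, C, hC⟩ := exists_const_regularPart hU h𝒟.1 hS hR (hF.subset hM) hF.one_lt
    (hF.inj M hM) (hF.dom M hM) (hF.holo M hM) (hF.exp_eq M hM)
  refine ⟨h1, fun ζ hζ h0 => ?_⟩
  rw [normConst, hC ζ hζ h0, hC 1 hF.one_mem one_ne_zero]
  ring

/-- The normalization of Re W at the boundary point f(1); there Re Λ = log|f|, so the logarithms
cancel. -/
theorem normConst_re {M : Coord N} (hM : M ∈ 𝒰) : (normConst a R Λ M).re =
    ‖polyMap (a M) 1‖ ^ 2 / 2 - (laurentPot (a M) (a M) 1).re := by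
  have hf := hF.polyMap_ne_zero hM hF.one_mem one_ne_zero
  obtain ⟨O, ℓ, hℓ, h1O⟩ := exists_logBranch hf
  have h1 := hR.normalized M (hF.subset hM) O ℓ hℓ (polyMap (a M) 1) ⟨h1O, by
    rw [frontier_imageDomain hF.one_lt (hF.inj M hM)]; exact ⟨1, by simp, rfl⟩⟩
  rw [potential_eq, (hF.regular_eq hU h𝒟 hS hR hM).2 1 hF.one_mem one_ne_zero, regularPart] at h1
  have h2 := hℓ.re_eq h1O
  have h3 : (Λ 1 M).re = Real.log ‖polyMap (a M) 1‖ := by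
    rw [re_eq_log_norm_of_exp_eq (hF.exp_eq M hM 1 hF.one_mem), polyMap_eq_mul, one_mul]
  simp only [add_re, sub_re, neg_mul, neg_re, re_ofReal_mul, h2, h3] at h1
  linarith

/-- Average the formula for R∘f over the circle: the left side gives R(0), Λ gives the real number
Λ(0), and the Laurent polynomial has mean zero. -/
theorem normConst_im {M : Coord N} (hM : M ∈ 𝒰) : (normConst a R Λ M).im =
    (R 0 M).im - (circleAverage (fun ζ => principal M (polyMap (a M) ζ)) 0 1).im := by
  obtain ⟨h1, h2⟩ := hF.regular_eq hU h𝒟 hS hR hM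
  have h3 := circleAverage_eq_center hF.one_lt h1
  have hmem : ∀ ζ ∈ sphere (0 : ℂ) 1, ζ ∈ ball (0 : ℂ) ρ ∧ ζ ≠ 0 := fun ζ hζ => by
    have hn : ‖ζ‖ = 1 := by simpa using hζ
    exact ⟨hF.mem_ball_of_norm_eq_one hn, ne_zero_of_norm_eq_one hn⟩
  have c1 : CircleIntegrable (fun ζ => -(M.1 : ℂ) * Λ ζ M) 0 1 :=
    circleIntegrable_of_continuousOn (continuousOn_const.mul
      ((hF.holo M hM).continuousOn.mono fun ζ hζ => (hmem ζ hζ).1))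
  have c2 : CircleIntegrable (laurentPot (a M) (a M)) 0 1 :=
    circleIntegrable_of_continuousOn fun ζ hζ =>
      (hasDerivAt_laurentPot _ _ (hmem ζ hζ).2).continuousAt.continuousWithinAt
  have c3 : CircleIntegrable (fun ζ => principal M (polyMap (a M) ζ)) 0 1 :=
    circleIntegrable_of_continuousOn fun ζ hζ =>
      (((hasDerivAt_principal M (hF.polyMap_ne_zero hM (hmem ζ hζ).1 (hmem ζ hζ).2)).comp ζ
        (hasDerivAt_polyMap (a M) ζ)).continuousAt).continuousWithinAt
  have h4 : circleAverage (fun ζ => R (polyMap (a M) ζ) M) 0 1 =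
      circleAverage (fun ζ => -(M.1 : ℂ) * Λ ζ M + laurentPot (a M) (a M) ζ +
        principal M (polyMap (a M) ζ) + normConst a R Λ M) 0 1 :=
    circleAverage_congr_sphere fun ζ hζ => by
      rw [abs_one] at hζ
      exact h2 ζ (hmem ζ hζ).1 (hmem ζ hζ).2
  have c12 : CircleIntegrable (fun ζ => -(M.1 : ℂ) * Λ ζ M + laurentPot (a M) (a M) ζ) 0 1 :=
    c1.add c2
  have c123 : CircleIntegrable (fun ζ => -(M.1 : ℂ) * Λ ζ M + laurentPot (a M) (a M) ζ +
    principal M (polyMap (a M) ζ)) 0 1 := c12.add c3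
  rw [circleAverage_fun_add c123 (circleIntegrable_const _ _ _),
    circleAverage_fun_add c12 c3, circleAverage_fun_add c1 c2, circleAverage_const] at h4
  have h7 : circleAverage (fun ζ => laurentPot (a M) (a M) ζ) 0 1 = 0 :=
    circleAverage_laurentPot _ _
  have h5 : circleAverage (fun ζ => -(M.1 : ℂ) * Λ ζ M) 0 1 = -(M.1 : ℂ) * Λ 0 M :=
    circleAverage_eq_center hF.one_lt ((hF.holo M hM).const_mul _)
  rw [h3, h5, h7, polyMap_zero] at h4
  have h6 := congrArg Complex.im h4
  simp only [add_im, neg_mul, neg_im, im_ofReal_mul, hF.im_zero M hM, zero_im] at h6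
  linarith

/-- This is where regularity of R in M comes from: both parts of the constant are determined by f
and the prescribed Im R(0). -/
theorem contDiffOn_normConst : ContDiffOn ℝ ∞ (normConst a R Λ) 𝒰 := by
  obtain ⟨c, hc, hcR⟩ := hR.imag
  have h1 : ContDiffOn ℝ ∞ (fun M => ‖polyMap (a M) 1‖ ^ 2 / 2 -
      Complex.reCLM (laurentPot (a M) (a M) 1)) 𝒰 :=
    (((hU.contDiffOn_polyMap 1).mono hF.subset).norm_sq ℝ).div_const 2 |>.sub
      (Complex.reCLM.contDiff.comp_contDiffOn ((hU.contDiffOn_laurentPot 1).mono hF.subset))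
  have h2 : ContDiffOn ℝ ∞ (fun M => c M.2 - Complex.imCLM
      (circleAverage (fun ζ => principal M (polyMap (a M) ζ)) 0 1)) 𝒰 :=
    (hc.mono hF.subset).sub
      (Complex.imCLM.contDiff.comp_contDiffOn (hF.circleAverage_principal hU).1)
  refine ((Complex.ofRealCLM.contDiff.comp_contDiffOn h1).add
    ((Complex.ofRealCLM.contDiff.comp_contDiffOn h2).mul (contDiffOn_const (c := I)))).congr
      fun M hM => ?_
  refine Complex.ext ?_ ?_
  · simp [hF.normConst_re hU h𝒟 hS hR hM, -ofReal_pow]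
  · simp [hF.normConst_im hU h𝒟 hS hR hM, hcR M (hF.subset hM), -ofReal_pow]

theorem hasFDerivAt_normConst {M : Coord N} (hM : M ∈ 𝒰) :
    HasFDerivAt (normConst a R Λ) (fderiv ℝ (normConst a R Λ) M) M :=
  (((hF.contDiffOn_normConst hU h𝒟 hS hR).contDiffAt (hF.isOpen.mem_nhds hM)).differentiableAt
    (by simp)).hasFDerivAt

theorem fderiv_normConst_re {M : Coord N} (hM : M ∈ 𝒰) (v : Coord N) :
    (fderiv ℝ (normConst a R Λ) M v).re =
      (starRingEnd ℂ (polyMap (a M) 1) * polyMap (fderiv ℝ a M v) 1).re -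
        (fderiv ℝ (fun M => laurentPot (a M) (a M) 1) M v).re := by
  have hMU := hF.subset hM
  have h1 := Complex.reCLM.hasFDerivAt.comp M (hF.hasFDerivAt_normConst hU h𝒟 hS hR hM)
  have h2 : (Complex.reCLM ∘ normConst a R Λ) =ᶠ[𝓝 M] fun M => ‖polyMap (a M) 1‖ ^ 2 * 2⁻¹ -
      Complex.reCLM (laurentPot (a M) (a M) 1) := by
    filter_upwards [hF.isOpen.mem_nhds hM] with M' hM'
    exact hF.normConst_re hU h𝒟 hS hR hM'
  have h3 : HasFDerivAt (fun M => laurentPot (a M) (a M) 1) _ M :=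
    (((hU.contDiffOn_laurentPot 1).contDiffAt (hU.isOpen.mem_nhds hMU)).differentiableAt
      (by simp)).hasFDerivAt
  have h4 := ((hU.hasFDerivAt_polyMap hMU 1).norm_sq.mul_const (2⁻¹ : ℝ)).fun_sub
    (Complex.reCLM.hasFDerivAt.comp M h3)
  have h5 := (h1.congr_of_eventuallyEq h2.symm).unique h4
  have h6 := congrArg (fun L : Coord N →L[ℝ] ℝ => L v) h5
  simp only [ContinuousLinearMap.comp_apply, Complex.reCLM_apply, sub_apply, smul_apply,
    innerSL_apply_apply, polyMapL_apply, Complex.inner] at h6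
  rw [h6]
  simp
  ring

theorem fderiv_normConst_im {M : Coord N} (hM : M ∈ 𝒰) :
    (fderiv ℝ (normConst a R Λ) M (1, 0)).im = (circleAverage (fun ζ =>
      principalDeriv M (polyMap (a M) ζ) * polyMap (fderiv ℝ a M (1, 0)) ζ) 0 1).im := by
  obtain ⟨c, hc, hcR⟩ := hR.imag
  have hMU := hF.subset hM
  obtain ⟨p1, p2⟩ := hF.circleAverage_principal hU
  have h1 := Complex.imCLM.hasFDerivAt.comp M (hF.hasFDerivAt_normConst hU h𝒟 hS hR hM)
  have h2 : (Complex.imCLM ∘ normConst a R Λ) =ᶠ[𝓝 M] fun M => c M.2 -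
      Complex.imCLM (circleAverage (fun ζ => principal M (polyMap (a M) ζ)) 0 1) := by
    filter_upwards [hF.isOpen.mem_nhds hM] with M' hM'
    have := hF.normConst_im hU h𝒟 hS hR hM'
    rw [hcR M' (hF.subset hM')] at this
    exact this
  have h3 : HasFDerivAt (fun M =>
      circleAverage (fun ζ => principal M (polyMap (a M) ζ)) 0 1) _ M :=
    ((p1.contDiffAt (hF.isOpen.mem_nhds hM)).differentiableAt (by simp)).hasFDerivAt
  have h4 : HasFDerivAt (fun M : Coord N => c M.2) _ M :=
    ((hc.contDiffAt (hU.isOpen.mem_nhds hMU)).differentiableAt (by simp)).hasFDerivAt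
  have h5 : HasFDerivAt (fun t : ℝ => c ((t, M.2) : Coord N).2) _ M.1 :=
    HasFDerivAt.comp (g := fun M : Coord N => c M.2) (f := fun t : ℝ => ((t, M.2) : Coord N)) M.1 h4
      ((hasFDerivAt_id M.1).prodMk (hasFDerivAt_const M.2 M.1))
  -- Im R(0) does not depend on M_0, so its derivative along ∂/∂M_0 is zero.
  have h6 := congrArg (fun L : ℝ →L[ℝ] ℝ => L 1) (h5.unique (hasFDerivAt_const (c M.2) M.1))
  have h7 := (h1.congr_of_eventuallyEq h2.symm).unique
    (h4.fun_sub (Complex.imCLM.hasFDerivAt.comp M h3))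
  have h8 := congrArg (fun L : Coord N →L[ℝ] ℝ => L (1, 0)) h7
  simp only [ContinuousLinearMap.comp_apply, Complex.imCLM_apply, sub_apply,
    ContinuousLinearMap.prod_apply, ContinuousLinearMap.id_apply, zero_apply] at h6 h8
  rw [h8, h6, p2 M hM]
  simp

end

end IsLocalFrame

end MomentEvolution

/-! ### The single valued part of the moment derivatives of W -/

namespace MomentEvolution

open Complex Metric Set Filter Real MeasureTheory

variable {N : ℕ} {U : Set (Coord N)} {a : Coord N → Coord N} {𝒟 : Set (ℂ × Coord N)} {ρ : ℝ}
  {𝒰 : Set (Coord N)} {S R Λ : ℂ → Coord N → ℂ}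

/-- The single valued part of the derivative of the potential with respect to the moments, in the
uniformizing coordinate; `C` is the additive constant of the potential. -/
noncomputable def momentDeriv (a : Coord N → Coord N) (C : Coord N → ℂ) (v : Coord N) (ζ : ℂ)
    (M : Coord N) : ℂ :=
  fderiv ℝ (fun M => laurentPot (a M) (a M) ζ) M v + fderiv ℝ C M v -
    schwarz (a M) ζ * polyMap (fderiv ℝ a M v) ζ

/-- The terms S f_v' cancel, leaving f'S_v - f_v S' minus the residue term; by the differentiated
area formula the residue is v.1. -/
theorem IsMomentChart.hasDerivAt_momentDeriv (hU : IsMomentChart U a) {M : Coord N} (hM : M ∈ U)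
    (C : Coord N → ℂ) (v : Coord N) {ζ : ℂ} (hζ : ζ ≠ 0) :
    HasDerivAt (fun ζ => momentDeriv a C v ζ M)
      ((variation (a M) (fderiv ℝ a M v) ζ - v.1) / ζ) ζ := by
  have h1 : (fun ζ => momentDeriv a C v ζ M) = fun ζ =>
      (laurentPot (a M) (fderiv ℝ a M v) ζ + laurentPot (fderiv ℝ a M v) (a M) ζ) +
        fderiv ℝ C M v - schwarz (a M) ζ * polyMap (fderiv ℝ a M v) ζ := by
    funext ζ
    rw [momentDeriv, hU.fderiv_laurentPot hM]
  rw [h1]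
  have h2 := ((((hasDerivAt_laurentPot (a M) (fderiv ℝ a M v) hζ).fun_add
    (hasDerivAt_laurentPot (fderiv ℝ a M v) (a M) hζ)).add_const (fderiv ℝ C M v))).fun_sub
      ((hasDerivAt_schwarz (a M) hζ).fun_mul (hasDerivAt_polyMap (fderiv ℝ a M v) ζ))
  refine h2.congr_deriv ?_
  rw [← hU.pairing_fderiv hM v, variation]
  field_simp
  ring

namespace IsLocalFrame

section

variable (hU : IsMomentChart U a) (h𝒟 : IsDomainNhd U a 𝒟)
  (hS : ∀ M ∈ U, IsSchwarzFunction (imageDomain (a M)) (fun z => S z M))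
  (hR : IsSchwarzPrimitive U a 𝒟 S R) (hF : IsLocalFrame U a 𝒟 ρ 𝒰 Λ)

include hU h𝒟 hS hR hF

/-- After the principal part is removed, S∘f is R'∘f + M_0/f. Times the variation of f this extends
holomorphically to the disk, with value M_0 b_0/a_0 at 0, a real number. -/
theorem im_circleAverage_schwarz_sub {M : Coord N} (hM : M ∈ 𝒰) (b : Coord N) :
    (circleAverage (fun ζ => (schwarz (a M) ζ - principalDeriv M (polyMap (a M) ζ)) *
      polyMap b ζ) 0 1).im = 0 := by
  obtain ⟨h1, h2⟩ := hF.regular_eq hU h𝒟 hS hR hM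
  have hMU := hF.subset hM
  have hapos := (hU.admissible M hMU).1
  set r : ℂ → ℂ := fun ζ => R (polyMap (a M) ζ) M with hr
  have hd : ∀ ζ ∈ ball (0 : ℂ) ρ, polyDeriv (a M) ζ ≠ 0 := fun ζ hζ =>
    polyDeriv_ne_zero_of_injOn isOpen_ball (hF.inj M hM) hζ
  have hq : ∀ ζ ∈ ball (0 : ℂ) ρ, polyQuot (a M) ζ ≠ 0 := fun ζ hζ => by
    rw [← hF.exp_eq M hM ζ hζ]; exact Complex.exp_ne_zero _
  have h3 : ∀ ζ ∈ ball (0 : ℂ) ρ, ζ ≠ 0 → deriv r ζ = regularDeriv (a M) M ζ := fun ζ hζ h0 => by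
    have e := (hasDerivAt_regularPart (hU.pairing_eq hMU) (hF.holo M hM) (hF.exp_eq M hM) hζ
      h0).add_const (normConst a R Λ M)
    refine (e.congr_of_eventuallyEq ?_).deriv
    filter_upwards [isOpen_ball.mem_nhds hζ, isOpen_ne.mem_nhds h0] with z hz hz0
    exact h2 z hz hz0
  set F : ℂ → ℂ := fun ζ => deriv r ζ / polyDeriv (a M) ζ * polyMap b ζ +
    M.1 * (polyQuot b ζ / polyQuot (a M) ζ) with hFdef
  have hFd : DifferentiableOn ℂ F (ball 0 ρ) :=
    (((h1.deriv isOpen_ball).div (differentiable_polyDeriv _).differentiableOn hd).mul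
      (differentiable_polyMap b).differentiableOn).add
      (((differentiable_polyQuot b).differentiableOn.div
        (differentiable_polyQuot _).differentiableOn hq).const_mul _)
  have h4 : circleAverage (fun ζ => (schwarz (a M) ζ - principalDeriv M (polyMap (a M) ζ)) *
      polyMap b ζ) 0 1 = F 0 := by
    refine Eq.trans ?_ (circleAverage_eq_center hF.one_lt hFd)
    apply circleAverage_congr_sphere
    intro ζ hζ
    have hn : ‖ζ‖ = 1 := by simpa using hζ
    have hb := hF.mem_ball_of_norm_eq_one hn
    have h0 := ne_zero_of_norm_eq_one hn
    simp only [hFdef, h3 ζ hb h0, regularDeriv]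
    rw [mul_div_cancel_left₀ _ (hd ζ hb)]
    have := hq ζ hb
    rw [show (M.1 : ℂ) / polyMap (a M) ζ = M.1 / (ζ * polyQuot (a M) ζ) by rw [polyMap_eq_mul],
      polyMap_eq_mul b]
    field_simp
    ring
  rw [h4]
  simp only [hFdef, polyMap_zero, mul_zero, polyQuot_zero, zero_add]
  norm_cast

/-- The potential has no single valued part in its derivative with respect to `M₀`. -/
theorem momentDeriv_zero {M : Coord N} (hM : M ∈ 𝒰) {ζ : ℂ} (hζ : ζ ∈ ball (0 : ℂ) ρ)
    (h0 : ζ ≠ 0) : momentDeriv a (normConst a R Λ) (1, 0) ζ M = 0 := by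
  have hMU := hF.subset hM
  set κ := momentDeriv a (normConst a R Λ) (1, 0) 1 M with hκ
  have hconst : ∀ z ∈ ball (0 : ℂ) ρ, z ≠ 0 →
      momentDeriv a (normConst a R Λ) (1, 0) z M = κ := fun z hz hz0 => by
    refine eq_of_hasDerivAt_zero_punctured
      (F := fun z => momentDeriv a (normConst a R Λ) (1, 0) z M) (ρ := ρ) (fun w hw hw0 => ?_)
      hz hz0 hF.one_mem one_ne_zero
    have := hU.hasDerivAt_momentDeriv hMU (normConst a R Λ) (1, 0) hw0
    rw [hU.variation_eq_one hMU hw0] at this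
    simpa using this
  rw [hconst ζ hζ h0]
  -- At ζ = 1 the real part is the derivative of Re W = |z|²/2 along the moving boundary point.
  have hre : κ.re = 0 := by
    rw [hκ, momentDeriv, schwarz_eq_conj _ (by simp), sub_re, add_re,
      hF.fderiv_normConst_re hU h𝒟 hS hR hM]
    ring
  -- The constant is its own circle average. The Laurent terms average to zero, and the derivative
  -- of Im C cancels the principal part of S f_v up to an average that is real.
  have him : κ.im = 0 := by
    set b := fderiv ℝ a M (1, 0) with hb
    have hcs : ContinuousOn (fun z => schwarz (a M) z * polyMap b z) (sphere 0 1) := fun z hz =>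
      ((hasDerivAt_schwarz (a M) (ne_zero_of_norm_eq_one (by simpa using hz))).continuousAt.mul
        (hasDerivAt_polyMap b z).continuousAt).continuousWithinAt
    have hcp : ContinuousOn (fun z => principalDeriv M (polyMap (a M) z) * polyMap b z)
        (sphere 0 1) := fun z hz => by
      have hn : ‖z‖ = 1 := by simpa using hz
      have hf := hF.polyMap_ne_zero hM (hF.mem_ball_of_norm_eq_one hn) (ne_zero_of_norm_eq_one hn)
      have hc : ContinuousAt (principalDeriv M) (polyMap (a M) z) := by
        unfold principalDeriv
        exact tendsto_finsetSum _ fun k _ =>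
          ContinuousAt.div continuousAt_const (continuousAt_id.pow _) (pow_ne_zero _ hf)
      exact ((ContinuousAt.comp hc (hasDerivAt_polyMap (a M) z).continuousAt).mul
        (hasDerivAt_polyMap b z).continuousAt).continuousWithinAt
    have hcl : ∀ c d : Coord N, ContinuousOn (fun z => laurentPot c d z) (sphere 0 1) :=
      fun c d z hz => (hasDerivAt_laurentPot c d
        (ne_zero_of_norm_eq_one (by simpa using hz))).continuousAt.continuousWithinAt
    have e1 : circleAverage (fun z => momentDeriv a (normConst a R Λ) (1, 0) z M) 0 1 = κ := by
      rw [← circleAverage_const κ 0 1]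
      apply circleAverage_congr_sphere
      intro z hz
      have hn : ‖z‖ = 1 := by simpa using hz
      exact hconst z (hF.mem_ball_of_norm_eq_one hn) (ne_zero_of_norm_eq_one hn)
    simp only [momentDeriv, hU.fderiv_laurentPot hMU, ← hb] at e1
    have i1 := circleIntegrable_of_continuousOn (hcl (a M) b)
    have i2 := circleIntegrable_of_continuousOn (hcl b (a M))
    have i12 : CircleIntegrable (fun z => laurentPot (a M) b z + laurentPot b (a M) z) 0 1 :=
      i1.add i2
    have i3 := circleIntegrable_of_continuousOn hcs
    have i4 : CircleIntegrable (fun z => laurentPot (a M) b z + laurentPot b (a M) z +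
      fderiv ℝ (normConst a R Λ) M (1, 0)) 0 1 := i12.add (circleIntegrable_const _ _ _)
    have z1 : circleAverage (fun z => laurentPot (a M) b z) 0 1 = 0 := circleAverage_laurentPot _ _
    have z2 : circleAverage (fun z => laurentPot b (a M) z) 0 1 = 0 := circleAverage_laurentPot _ _
    rw [circleAverage_fun_sub i4 i3, circleAverage_fun_add i12 (circleIntegrable_const _ _ _),
      circleAverage_fun_add i1 i2, circleAverage_const, z1, z2] at e1
    have e2 := hF.im_circleAverage_schwarz_sub hU h𝒟 hS hR hM b
    simp only [sub_mul] at e2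
    rw [circleAverage_fun_sub i3 (circleIntegrable_of_continuousOn hcp), sub_im] at e2
    have e3 := congrArg Complex.im e1
    rw [sub_im, add_im, hF.fderiv_normConst_im hU h𝒟 hS hR hM] at e3
    simp only [add_im, zero_im, ← hb] at e3
    linarith
  exact Complex.ext hre him

end

end IsLocalFrame

end MomentEvolution

/-! ### Joint regularity of W and its derivatives at fixed z -/

namespace MomentEvolution

open Complex Metric Set Filter Real MeasureTheory

variable {N : ℕ} {U : Set (Coord N)} {a : Coord N → Coord N} {𝒟 : Set (ℂ × Coord N)} {ρ : ℝ}
  {𝒰 : Set (Coord N)} {S R Λ : ℂ → Coord N → ℂ} {O : Set ℂ} {ℓ : ℂ → ℂ}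

/-- The map `(ζ, M) ↦ (f(ζ;M), M)`. -/
noncomputable def famMap (a : Coord N → Coord N) (p : ℂ × Coord N) : ℂ × Coord N :=
  (polyMap (a p.2) p.1, p.2)

theorem IsMomentChart.contDiffAt_famMap (hU : IsMomentChart U a) {M : Coord N} (hM : M ∈ U)
    (ζ : ℂ) : ContDiffAt ℝ ∞ (famMap a) (ζ, M) :=
  (ContDiffAt.comp (g := fun q : Coord N × ℂ => polyMap q.1 q.2)
    (f := fun p : ℂ × Coord N => (a p.2, p.1)) (ζ, M) contDiff_polyMap.contDiffAt
    ((ContDiffAt.comp (f := Prod.snd) (g := a) (ζ, M) (hU.contDiffAt hM)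
      contDiffAt_snd).prodMk contDiffAt_fst)).prodMk contDiffAt_snd

theorem IsMomentChart.fderiv_famMap (hU : IsMomentChart U a) {M : Coord N} (hM : M ∈ U)
    (ζ : ℂ) : (∀ h : ℂ, fderiv ℝ (famMap a) (ζ, M) (h, 0) = (polyDeriv (a M) ζ * h, 0)) ∧
      ∀ v, fderiv ℝ (famMap a) (ζ, M) (0, v) = (polyMap (fderiv ℝ a M v) ζ, v) := by
  have h1 := ((hU.contDiffAt_famMap hM ζ).differentiableAt (by simp)).hasFDerivAt
  refine ⟨fun h => ?_, fun v => ?_⟩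
  · have h2 : HasFDerivAt (fun z => famMap a (z, M)) _ ζ :=
      HasFDerivAt.comp (f := fun z => (z, M)) ζ h1 (hasFDerivAt_prodMk_left ζ M)
    have h3 : HasFDerivAt (fun z => famMap a (z, M)) _ ζ :=
      ((hasDerivAt_polyMap (a M) ζ).hasFDerivAt.restrictScalars ℝ).prodMk (hasFDerivAt_const M ζ)
    have h4 := congrArg (fun L : ℂ →L[ℝ] ℂ × Coord N => L h) (h2.unique h3)
    simpa [mul_comm] using h4
  · have h2 : HasFDerivAt (fun M => famMap a (ζ, M)) _ M :=
      HasFDerivAt.comp (f := fun M => (ζ, M)) M h1 (hasFDerivAt_prodMk_right ζ M)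
    have h3 : HasFDerivAt (fun M => famMap a (ζ, M)) _ M :=
      (hU.hasFDerivAt_polyMap hM ζ).prodMk (hasFDerivAt_id M)
    have h4 := congrArg (fun L : Coord N →L[ℝ] ℂ × Coord N => L v) (h2.unique h3)
    simpa using h4

theorem IsMomentChart.exists_equiv_famMap (hU : IsMomentChart U a) {M : Coord N} (hM : M ∈ U)
    {ζ : ℂ} (hζ : polyDeriv (a M) ζ ≠ 0) : ∃ e : (ℂ × Coord N) ≃L[ℝ] (ℂ × Coord N),
      HasFDerivAt (famMap a) (e : (ℂ × Coord N) →L[ℝ] (ℂ × Coord N)) (ζ, M) := by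
  obtain ⟨h1, h2⟩ := hU.fderiv_famMap hM ζ
  have hinj : Function.Injective
      (fderiv ℝ (famMap a) (ζ, M) : (ℂ × Coord N) →ₗ[ℝ] (ℂ × Coord N)) := by
    rw [← LinearMap.ker_eq_bot, LinearMap.ker_eq_bot']
    rintro ⟨h, v⟩ hv
    have hv : fderiv ℝ (famMap a) (ζ, M) (h, v) = 0 := hv
    have e1 : (h, v) = (h, 0) + ((0 : ℂ), v) := by simp
    rw [e1, map_add, h1, h2, Prod.mk_add_mk, zero_add] at hv
    obtain ⟨e2, e3⟩ := Prod.mk_eq_zero.1 hv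
    subst e3
    rw [map_zero] at e2
    have e4 : polyMap (0 : Coord N) ζ = 0 := by simp [polyMap]
    rw [e4, add_zero] at e2
    rw [(mul_eq_zero.1 e2).resolve_left hζ]; rfl
  refine ⟨(LinearEquiv.ofInjectiveEndo _ hinj).toContinuousLinearEquiv, ?_⟩
  exact ((hU.contDiffAt_famMap hM ζ).differentiableAt (by simp)).hasFDerivAt.congr_fderiv
    (ContinuousLinearMap.ext fun v => rfl)

/-- Passing from fixed ζ to fixed z: the derivative of (ζ, M) ↦ (f(ζ;M), M) is block triangular with
f' and the identity on the diagonal. -/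
theorem IsMomentChart.exists_localInverse_famMap (hU : IsMomentChart U a) {M : Coord N}
    (hM : M ∈ U) {ζ : ℂ} (hζ : polyDeriv (a M) ζ ≠ 0) : ∃ ψ : ℂ × Coord N → ℂ × Coord N,
      ContDiffAt ℝ ∞ ψ (polyMap (a M) ζ, M) ∧ ψ (polyMap (a M) ζ, M) = (ζ, M) ∧
      ∀ᶠ q in 𝓝 (polyMap (a M) ζ, M), famMap a (ψ q) = q := by
  obtain ⟨e, he⟩ := hU.exists_equiv_famMap hM hζ
  have hc := hU.contDiffAt_famMap hM ζ
  exact ⟨hc.localInverse he (by simp), hc.to_localInverse he (by simp),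
    hc.localInverse_apply_image he (by simp),
    (hc.hasStrictFDerivAt' he (by simp)).eventually_right_inverse⟩

theorem IsMomentChart.map_nhds_famMap (hU : IsMomentChart U a) {M : Coord N}
    (hM : M ∈ U) {ζ : ℂ} (hζ : polyDeriv (a M) ζ ≠ 0) :
    map (famMap a) (𝓝 (ζ, M)) = 𝓝 (polyMap (a M) ζ, M) := by
  obtain ⟨e, he⟩ := hU.exists_equiv_famMap hM hζ
  exact ((hU.contDiffAt_famMap hM ζ).hasStrictFDerivAt' he (by simp)).map_nhds_eq_of_equiv

namespace IsLocalFrame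

theorem polyDeriv_ne_zero (hF : IsLocalFrame U a 𝒟 ρ 𝒰 Λ) {M : Coord N} (hM : M ∈ 𝒰) {ζ : ℂ}
    (hζ : ζ ∈ ball (0 : ℂ) ρ) : polyDeriv (a M) ζ ≠ 0 :=
  polyDeriv_ne_zero_of_injOn isOpen_ball (hF.inj M hM) hζ

theorem contDiffAt_log (hF : IsLocalFrame U a 𝒟 ρ 𝒰 Λ) {M : Coord N} (hM : M ∈ 𝒰) {ζ : ℂ}
    (hζ : ζ ∈ ball (0 : ℂ) ρ) : ContDiffAt ℝ ∞ (fun p : ℂ × Coord N => Λ p.1 p.2) (ζ, M) := by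
  have hm : (ζ, M) ∈ ball (0 : ℂ) ρ ×ˢ 𝒰 := ⟨hζ, hM⟩
  exact hF.smooth.contDiffAt ((isOpen_ball.prod hF.isOpen).mem_nhds hm)

theorem eventually_mem (hF : IsLocalFrame U a 𝒟 ρ 𝒰 Λ) {M : Coord N} (hM : M ∈ 𝒰) {ζ : ℂ}
    (hζ : ζ ∈ ball (0 : ℂ) ρ) (h0 : ζ ≠ 0) :
    ∀ᶠ p : ℂ × Coord N in 𝓝 (ζ, M), p.1 ∈ ball (0 : ℂ) ρ ∧ p.1 ≠ 0 ∧ p.2 ∈ 𝒰 := by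
  have h1 : ∀ᶠ p : ℂ × Coord N in 𝓝 (ζ, M), p.1 ∈ ball (0 : ℂ) ρ :=
    continuousAt_fst.eventually (isOpen_ball.mem_nhds hζ)
  have h2 : ∀ᶠ p : ℂ × Coord N in 𝓝 (ζ, M), p.1 ≠ 0 :=
    continuousAt_fst.eventually_ne h0
  have h3 : ∀ᶠ p : ℂ × Coord N in 𝓝 (ζ, M), p.2 ∈ 𝒰 :=
    continuousAt_snd.eventually (hF.isOpen.mem_nhds hM)
  filter_upwards [h1, h2, h3] with p e1 e2 e3 using ⟨e1, e2, e3⟩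

section

variable (hU : IsMomentChart U a) (h𝒟 : IsDomainNhd U a 𝒟)
  (hS : ∀ M ∈ U, IsSchwarzFunction (imageDomain (a M)) (fun z => S z M))
  (hR : IsSchwarzPrimitive U a 𝒟 S R) (hF : IsLocalFrame U a 𝒟 ρ 𝒰 Λ)

include hU h𝒟 hS hR hF

/-- The regular part of the potential is jointly smooth. -/
theorem contDiffAt_regular {M : Coord N} (hM : M ∈ 𝒰) {ζ : ℂ} (hζ : ζ ∈ ball (0 : ℂ) ρ)
    (h0 : ζ ≠ 0) :
    ContDiffAt ℝ ∞ (fun p : ℂ × Coord N => R p.1 p.2) (polyMap (a M) ζ, M) := by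
  have hMU := hF.subset hM
  obtain ⟨ψ, h1, h2, h3⟩ := hU.exists_localInverse_famMap hMU (hF.polyDeriv_ne_zero hM hζ)
  -- T is the explicit formula for R(f(ζ;M);M); composed with the local inverse it represents R near
  -- the given point.
  set T : ℂ × Coord N → ℂ := fun p => -(p.2.1 : ℂ) * Λ p.1 p.2 + laurentPot (a p.2) (a p.2) p.1 +
    principal p.2 (polyMap (a p.2) p.1) + normConst a R Λ p.2 with hT
  have ca : ContDiffAt ℝ ∞ (fun p : ℂ × Coord N => a p.2) (ζ, M) :=
    ContDiffAt.comp (f := Prod.snd) (g := a) (ζ, M) (hU.contDiffAt hMU) contDiffAt_snd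
  have hTs : ContDiffAt ℝ ∞ T (ζ, M) := by
    refine ContDiffAt.add (ContDiffAt.add (ContDiffAt.add (ContDiffAt.mul ?_
      (hF.contDiffAt_log hM hζ)) ?_) ?_) ?_
    · exact (Complex.ofRealCLM.contDiff.comp (contDiff_fst.comp contDiff_snd)).neg.contDiffAt
    · exact ContDiffAt.comp (g := fun q : Coord N × ℂ => laurentPot q.1 q.1 q.2)
        (f := fun p : ℂ × Coord N => (a p.2, p.1)) (ζ, M)
        (contDiffAt_laurentPot_diag (p := (a M, ζ)) h0) (ca.prodMk contDiffAt_fst)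
    · refine ContDiffAt.comp (g := fun q : Coord N × ℂ => principal q.1 q.2)
        (f := fun p : ℂ × Coord N => (p.2, polyMap (a p.2) p.1)) (ζ, M)
        (contDiffAt_principal (hF.polyMap_ne_zero hM hζ h0))
        (contDiffAt_snd.prodMk (ContDiffAt.comp (g := fun q : Coord N × ℂ => polyMap q.1 q.2)
        (f := fun p : ℂ × Coord N => (a p.2, p.1)) (ζ, M) contDiff_polyMap.contDiffAt
          (ca.prodMk contDiffAt_fst)))
    · exact ContDiffAt.comp (g := normConst a R Λ) (f := Prod.snd) (ζ, M)
        ((hF.contDiffOn_normConst hU h𝒟 hS hR).contDiffAt (hF.isOpen.mem_nhds hM)) contDiffAt_snd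
  have h4 : ContDiffAt ℝ ∞ (T ∘ ψ) (polyMap (a M) ζ, M) :=
    ContDiffAt.comp (g := T) (f := ψ) _ (by rw [h2]; exact hTs) h1
  refine h4.congr_of_eventuallyEq ?_
  have h5 := h1.continuousAt
  rw [ContinuousAt, h2] at h5
  filter_upwards [h3, h5.eventually (hF.eventually_mem hM hζ h0)] with q e1 ⟨e2, e3, e4⟩
  have e5 : q = (polyMap (a (ψ q).2) (ψ q).1, (ψ q).2) := e1.symm
  have e6 := (hF.regular_eq hU h𝒟 hS hR e4).2 _ e2 e3
  rw [Function.comp_apply, hT]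
  simp only
  have e7 : R q.1 q.2 = R (polyMap (a (ψ q).2) (ψ q).1) (ψ q).2 := by
    conv_lhs => rw [e5]
  rw [e7, e6, regularPart]

omit h𝒟 hS hR in
/-- The logarithm of `ζ` induced by a branch of the logarithm of `f(ζ;M)`. -/
theorem log_sub (hℓ : IsLogBranch O ℓ) {M : Coord N} (hM : M ∈ 𝒰) {ζ : ℂ}
    (hζ : ζ ∈ ball (0 : ℂ) ρ) (hO : polyMap (a M) ζ ∈ O) :
    exp (ℓ (polyMap (a M) ζ) - Λ ζ M) = ζ ∧
    HasDerivAt (fun ζ => ℓ (polyMap (a M) ζ) - Λ ζ M) (1 / ζ) ζ ∧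
    HasFDerivAt (fun M => ℓ (polyMap (a M) ζ) - Λ ζ M) (0 : Coord N →L[ℝ] ℂ) M := by
  have hMU := hF.subset hM
  have hexp : ∀ M' ∈ 𝒰, polyMap (a M') ζ ∈ O → exp (ℓ (polyMap (a M') ζ) - Λ ζ M') = ζ :=
    fun M' hM' hO' => by
      rw [Complex.exp_sub, hℓ.exp_eq _ hO', hF.exp_eq M' hM' ζ hζ, polyMap_eq_mul,
        mul_div_cancel_right₀]
      rw [← hF.exp_eq M' hM' ζ hζ]; exact Complex.exp_ne_zero _
  have h0 : ζ ≠ 0 := by rw [← hexp M hM hO]; exact Complex.exp_ne_zero _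
  refine ⟨hexp M hM hO, ?_, ?_⟩
  · refine (((hℓ.hasDerivAt hO).comp ζ (hasDerivAt_polyMap (a M) ζ)).sub
      (hasDerivAt_log_polyQuot (hF.holo M hM) (hF.exp_eq M hM) hζ h0)).congr_deriv ?_
    ring
  · have h1 : HasFDerivAt (fun M => ℓ (polyMap (a M) ζ)) _ M :=
      HasFDerivAt.comp (g := ℓ) (f := fun M => polyMap (a M) ζ) M
        ((hℓ.hasDerivAt hO).hasFDerivAt.restrictScalars ℝ) (hU.hasFDerivAt_polyMap hMU ζ)
    have h2 : HasFDerivAt (fun M => Λ ζ M) _ M :=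
      HasFDerivAt.comp (g := fun p : ℂ × Coord N => Λ p.1 p.2) (f := fun M => (ζ, M)) M
        ((hF.contDiffAt_log hM hζ).differentiableAt (by simp)).hasFDerivAt
        (hasFDerivAt_prodMk_right ζ M)
    have h3 := h1.fun_sub h2
    have h4 : (fun M => exp (ℓ (polyMap (a M) ζ) - Λ ζ M)) =ᶠ[𝓝 M] fun _ => ζ := by
      filter_upwards [hF.isOpen.mem_nhds hM,
        (hU.hasFDerivAt_polyMap hMU ζ).continuousAt.eventually (hℓ.isOpen.mem_nhds hO)] with M' e1 e2
      exact hexp M' e1 e2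
    -- The exponential of the branch is the constant ζ, so its M-derivative vanishes; dividing by
    -- the exponential gives the claim.
    have h5 := (h3.cexp.congr_of_eventuallyEq h4.symm).unique (hasFDerivAt_const ζ M)
    refine h3.congr_fderiv (ContinuousLinearMap.ext fun v => ?_)
    have h6 := congrArg (fun L : Coord N →L[ℝ] ℂ => L v) h5
    simp only [smul_apply, zero_apply, smul_eq_mul] at h6
    exact (mul_eq_zero.1 h6).resolve_left (Complex.exp_ne_zero _)

/-- The derivatives of the potential with respect to the moments. -/
theorem fderiv_potential (hℓ : IsLogBranch O ℓ) {M : Coord N} (hM : M ∈ 𝒰) {ζ : ℂ}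
    (hζ : ζ ∈ ball (0 : ℂ) ρ) (hO : polyMap (a M) ζ ∈ O) :
    DifferentiableAt ℝ (potential ℓ R (polyMap (a M) ζ)) M ∧
    ∀ v, fderiv ℝ (potential ℓ R (polyMap (a M) ζ)) M v =
      v.1 * (ℓ (polyMap (a M) ζ) - Λ ζ M) + momentDeriv a (normConst a R Λ) v ζ M := by
  have hMU := hF.subset hM
  obtain ⟨l1, l2, l3⟩ := hF.log_sub hU hℓ hM hζ hO
  have h0 : ζ ≠ 0 := by rw [← l1]; exact Complex.exp_ne_zero _
  have hf := hℓ.ne_zero hO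
  set W : ℂ × Coord N → ℂ := fun p => potential ℓ R p.1 p.2 with hW
  have hWs : DifferentiableAt ℝ W (polyMap (a M) ζ, M) := by
    have c1 : DifferentiableAt ℝ (fun p : ℂ × Coord N => ℓ p.1) (polyMap (a M) ζ, M) :=
      DifferentiableAt.comp (g := ℓ) (f := Prod.fst) (polyMap (a M) ζ, M)
        ((hℓ.hasDerivAt hO).differentiableAt.restrictScalars ℝ) differentiableAt_fst
    have c2 : DifferentiableAt ℝ (fun p : ℂ × Coord N => (p.2.1 : ℂ)) (polyMap (a M) ζ, M) :=
      (Complex.ofRealCLM.contDiff.comp (contDiff_fst.comp contDiff_snd) :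
        ContDiff ℝ ∞ fun p : ℂ × Coord N => (p.2.1 : ℂ)).contDiffAt.differentiableAt (by simp)
    have c3 : DifferentiableAt ℝ (fun p : ℂ × Coord N => principal p.2 p.1) (polyMap (a M) ζ, M) :=
      DifferentiableAt.comp (g := fun q : Coord N × ℂ => principal q.1 q.2)
        (f := fun p : ℂ × Coord N => (p.2, p.1)) (polyMap (a M) ζ, M)
        ((contDiffAt_principal (p := (M, polyMap (a M) ζ)) hf).differentiableAt (by simp))
        (differentiableAt_snd.prodMk differentiableAt_fst)
    exact ((c2.mul c1).sub c3).add
      ((hF.contDiffAt_regular hU h𝒟 hS hR hM hζ h0).differentiableAt (by simp))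
  have hW1 := hWs.hasFDerivAt
  have hWM : HasFDerivAt (potential ℓ R (polyMap (a M) ζ)) ((fderiv ℝ W (polyMap (a M) ζ, M)).comp
      (ContinuousLinearMap.inr ℝ ℂ (Coord N))) M :=
    HasFDerivAt.comp (g := W) (f := fun M' => (polyMap (a M) ζ, M')) M hW1
      (hasFDerivAt_prodMk_right _ _)
  refine ⟨hWM.differentiableAt, fun v => ?_⟩
  have hWeq : ∀ ζ' ∈ ball (0 : ℂ) ρ, ζ' ≠ 0 → ∀ M' ∈ 𝒰, W (polyMap (a M') ζ', M') =
      M'.1 * (ℓ (polyMap (a M') ζ') - Λ ζ' M') + laurentPot (a M') (a M') ζ' +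
        normConst a R Λ M' := fun ζ' h1 h2 M' h3 => by
    simp only [hW, potential_eq, (hF.regular_eq hU h𝒟 hS hR h3).2 ζ' h1 h2, regularPart]
    ring
  have d1 : HasFDerivAt (fun ζ' => W (polyMap (a M) ζ', M)) _ ζ :=
    HasFDerivAt.comp (g := W) (f := fun ζ' => (polyMap (a M) ζ', M)) ζ hW1
      (((hasDerivAt_polyMap (a M) ζ).hasFDerivAt.restrictScalars ℝ).prodMk (hasFDerivAt_const M ζ))
  have d2 : HasDerivAt (fun ζ' => W (polyMap (a M) ζ', M)) (polyDeriv (a M) ζ * schwarz (a M) ζ) ζ := by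
    have e := ((l2.const_mul (M.1 : ℂ)).fun_add (hasDerivAt_laurentPot (a M) (a M) h0)).add_const
      (normConst a R Λ M)
    rw [hU.pairing_eq hMU] at e
    refine (e.congr_of_eventuallyEq ?_).congr_deriv (by ring)
    filter_upwards [isOpen_ball.mem_nhds hζ, isOpen_ne.mem_nhds h0] with ζ' e1 e2
    exact hWeq ζ' e1 e2 M hM
  have d3 := d1.unique (d2.hasFDerivAt.restrictScalars ℝ)
  have hd := hF.polyDeriv_ne_zero hM hζ
  -- The increment f_v/f' of ζ moves z by f_v, so this evaluates the z-derivative of W on f_v as S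
  -- f_v, the term by which fixed ζ and fixed z differ.
  have d4 := congrArg (fun L : ℂ →L[ℝ] ℂ =>
    L (polyMap (fderiv ℝ a M v) ζ / polyDeriv (a M) ζ)) d3
  simp only [ContinuousLinearMap.comp_apply, ContinuousLinearMap.prod_apply,
    ContinuousLinearMap.coe_restrictScalars', ContinuousLinearMap.toSpanSingleton_apply,
    zero_apply, smul_eq_mul, div_mul_cancel₀ _ hd] at d4
  have m1 : HasFDerivAt (fun M' => W (polyMap (a M') ζ, M')) _ M :=
    HasFDerivAt.comp (g := W) (f := fun M' => (polyMap (a M') ζ, M')) M hW1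
      ((hU.hasFDerivAt_polyMap hMU ζ).prodMk (hasFDerivAt_id M))
  have m0 : HasFDerivAt (fun M' : Coord N => (M'.1 : ℂ))
      (Complex.ofRealCLM.comp (ContinuousLinearMap.fst ℝ ℝ (Fin N → ℂ))) M :=
    (Complex.ofRealCLM.comp (ContinuousLinearMap.fst ℝ ℝ (Fin N → ℂ))).hasFDerivAt
  have m2 : HasFDerivAt (fun M => laurentPot (a M) (a M) ζ) _ M :=
    (((hU.contDiffOn_laurentPot ζ).contDiffAt (hU.isOpen.mem_nhds hMU)).differentiableAt
      (by simp)).hasFDerivAt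
  have m3 := ((HasFDerivAt.fun_mul m0 l3).fun_add m2).fun_add
    (hF.hasFDerivAt_normConst hU h𝒟 hS hR hM)
  have m4 := m1.unique (m3.congr_of_eventuallyEq (by
    filter_upwards [hF.isOpen.mem_nhds hM] with M' hM'
    exact hWeq ζ hζ h0 M' hM'))
  have m5 := congrArg (fun L : Coord N →L[ℝ] ℂ => L v) m4
  simp only [ContinuousLinearMap.comp_apply, ContinuousLinearMap.prod_apply, add_apply, smul_apply,
    ContinuousLinearMap.id_apply, zero_apply, polyMapL_apply, smul_eq_mul,
    ContinuousLinearMap.coe_fst', Complex.ofRealCLM_apply] at m5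
  have e8 : (polyMap (fderiv ℝ a M v) ζ, v) = (polyMap (fderiv ℝ a M v) ζ, (0 : Coord N)) +
    ((0 : ℂ), v) := by simp
  rw [e8, map_add, d4, mul_zero, zero_add] at m5
  rw [hWM.fderiv, ContinuousLinearMap.comp_apply, ContinuousLinearMap.inr_apply, momentDeriv]
  have d5 : polyMap (fderiv ℝ a M v) ζ / polyDeriv (a M) ζ * (polyDeriv (a M) ζ * schwarz (a M) ζ) =
    schwarz (a M) ζ * polyMap (fderiv ℝ a M v) ζ := by field_simp
  rw [d5] at m5
  linear_combination m5

end

end IsLocalFrame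

end MomentEvolution

/-! ### The evolution equations -/

namespace MomentEvolution

open Complex Metric Set Filter Real MeasureTheory

variable {N : ℕ} {U : Set (Coord N)} {a : Coord N → Coord N} {𝒟 : Set (ℂ × Coord N)} {ρ : ℝ}
  {𝒰 : Set (Coord N)} {S R Γ Λ : ℂ → Coord N → ℂ} {O : Set ℂ} {ℓ : ℂ → ℂ}

theorem hasFDerivAt_fderiv_apply {E F : Type*} [NormedAddCommGroup E] [NormedSpace ℝ E]
    [NormedAddCommGroup F] [NormedSpace ℝ F] {g : E → F} {x : E} (hg : ContDiffAt ℝ ∞ g x) (v : E) :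
    HasFDerivAt (fun y => fderiv ℝ g y v)
      ((ContinuousLinearMap.apply ℝ F v).comp (fderiv ℝ (fderiv ℝ g) x)) x := by
  have h1 : ContDiffAt ℝ 1 (fderiv ℝ g) x := hg.fderiv_right (m := 1) (by norm_cast)
  exact (ContinuousLinearMap.apply ℝ F v).hasFDerivAt.comp x
    (h1.differentiableAt (by simp)).hasFDerivAt

theorem fderiv_fderiv_apply_comm {E F : Type*} [NormedAddCommGroup E] [NormedSpace ℝ E]
    [NormedAddCommGroup F] [NormedSpace ℝ F] {g : E → F} {x : E} (hg : ContDiffAt ℝ ∞ g x)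
    (v w : E) : fderiv ℝ (fderiv ℝ g) x v w = fderiv ℝ (fderiv ℝ g) x w v :=
  (hg.isSymmSndFDerivAt (by
    simpa using (WithTop.coe_le_coe.2 le_top : ((2 : ℕ∞) : WithTop ℕ∞) ≤ ∞))) v w

theorem IsMomentChart.fderiv_momentDeriv (hU : IsMomentChart U a) {M : Coord N} (hM : M ∈ U)
    {C : Coord N → ℂ} (hC : ContDiffAt ℝ ∞ C M) (v : Coord N) (ζ : ℂ) :
    DifferentiableAt ℝ (momentDeriv a C v ζ) M ∧ ∀ w, fderiv ℝ (momentDeriv a C v ζ) M w =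
      fderiv ℝ (fderiv ℝ fun M => laurentPot (a M) (a M) ζ) M w v + fderiv ℝ (fderiv ℝ C) M w v -
      (schwarz (a M) ζ * polyMap (fderiv ℝ (fderiv ℝ a) M w v) ζ +
        polyMap (fderiv ℝ a M v) ζ * schwarz (fderiv ℝ a M w) ζ) := by
  have h1 := hasFDerivAt_fderiv_apply
    ((hU.contDiffOn_laurentPot ζ).contDiffAt (hU.isOpen.mem_nhds hM)) v
  have h2 := hasFDerivAt_fderiv_apply hC v
  have h3 := (polyMapL ζ).hasFDerivAt.comp M (hasFDerivAt_fderiv_apply (hU.contDiffAt hM) v)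
  have h4 : HasFDerivAt (momentDeriv a C v ζ) _ M :=
    (h1.fun_add h2).fun_sub (HasFDerivAt.fun_mul (hU.hasFDerivAt_schwarz hM ζ) h3)
  refine ⟨h4.differentiableAt, fun w => ?_⟩
  rw [h4.fderiv]
  rfl

namespace IsLocalFrame

section

variable (hU : IsMomentChart U a) (h𝒟 : IsDomainNhd U a 𝒟)
  (hS : ∀ M ∈ U, IsSchwarzFunction (imageDomain (a M)) (fun z => S z M))
  (hR : IsSchwarzPrimitive U a 𝒟 S R) (hF : IsLocalFrame U a 𝒟 ρ 𝒰 Λ)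

include hU h𝒟 hS hR hF

/-- The expression for direction ∂/∂M_0 vanishes identically in M. Differentiating it along v and
exchanging the order of the second derivatives of L, C and the coefficients leaves only the
antisymmetric terms from S f_v. -/
theorem fderiv_momentDeriv_zero {M : Coord N} (hM : M ∈ 𝒰) {ζ : ℂ} (hζ : ζ ∈ ball (0 : ℂ) ρ)
    (h0 : ζ ≠ 0) (v : Coord N) :
    DifferentiableAt ℝ (momentDeriv a (normConst a R Λ) v ζ) M ∧
    dM0 (momentDeriv a (normConst a R Λ) v ζ) M =
      schwarz (fderiv ℝ a M v) ζ * polyMap (fderiv ℝ a M (1, 0)) ζ -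
        schwarz (fderiv ℝ a M (1, 0)) ζ * polyMap (fderiv ℝ a M v) ζ := by
  have hMU := hF.subset hM
  have hC := (hF.contDiffOn_normConst hU h𝒟 hS hR).contDiffAt (hF.isOpen.mem_nhds hM)
  obtain ⟨h1, h2⟩ := hU.fderiv_momentDeriv hMU hC v ζ
  obtain ⟨-, h3⟩ := hU.fderiv_momentDeriv hMU hC (1, 0) ζ
  have h4 : momentDeriv a (normConst a R Λ) (1, 0) ζ =ᶠ[𝓝 M] fun _ => 0 := by
    filter_upwards [hF.isOpen.mem_nhds hM] with M' hM'
    exact hF.momentDeriv_zero hU h𝒟 hS hR hM' hζ h0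
  have h5 := h3 v
  rw [h4.fderiv_eq, fderiv_fun_const] at h5
  refine ⟨h1, ?_⟩
  rw [dM0, h2, fderiv_fderiv_apply_comm hC, fderiv_fderiv_apply_comm (hU.contDiffAt hMU),
    fderiv_fderiv_apply_comm ((hU.contDiffOn_laurentPot ζ).contDiffAt (hU.isOpen.mem_nhds hMU))]
  simp only [Pi.zero_apply, zero_apply] at h5
  linear_combination -h5

/-- The directions of M_k with k ≥ 1 have no M_0-component, so the logarithm drops out. -/
theorem hamiltonian_eq (hℓ : IsLogBranch O ℓ) {M : Coord N} (hM : M ∈ 𝒰) {ζ : ℂ}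
    (hζ : ζ ∈ ball (0 : ℂ) ρ) (hO : polyMap (a M) ζ ∈ O) (k : Fin N) :
    hamiltonian a (potential ℓ R) k ζ M = -(1 / 2) *
      (momentDeriv a (normConst a R Λ) (0, Pi.single k 1) ζ M -
        I * momentDeriv a (normConst a R Λ) (0, Pi.single k I) ζ M) := by
  have h1 := (hF.fderiv_potential hU h𝒟 hS hR hℓ hM hζ hO).2
  rw [hamiltonian, dMoment, confMap, h1, h1]
  simp

theorem evolution_hamiltonian (hℓ : IsLogBranch O ℓ) {M : Coord N} (hM : M ∈ 𝒰) {ζ : ℂ}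
    (hζ : ζ ∈ ball (0 : ℂ) ρ) (hO : polyMap (a M) ζ ∈ O) (k : Fin N) :
    DifferentiableAt ℂ (fun ξ => hamiltonian a (potential ℓ R) k ξ M) ζ ∧
    DifferentiableAt ℝ (hamiltonian a (potential ℓ R) k ζ) M ∧
    dMoment k (confMap a ζ) M =
      poissonBracket (confMap a) (hamiltonian a (potential ℓ R) k) ζ M := by
  have hMU := hF.subset hM
  obtain ⟨l1, l2, l3⟩ := hF.log_sub hU hℓ hM hζ hO
  have h0 : ζ ≠ 0 := by rw [← l1]; exact Complex.exp_ne_zero _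
  set C := normConst a R Λ with hC
  have hfM := hU.hasFDerivAt_polyMap hMU ζ
  have e1 : (fun ξ => hamiltonian a (potential ℓ R) k ξ M) =ᶠ[𝓝 ζ] fun ξ => -(1 / 2) *
      (momentDeriv a C (0, Pi.single k 1) ξ M - I * momentDeriv a C (0, Pi.single k I) ξ M) := by
    filter_upwards [isOpen_ball.mem_nhds hζ, (hasDerivAt_polyMap (a M) ζ).continuousAt.eventually
      (hℓ.isOpen.mem_nhds hO)] with ξ h1 h2
    exact hF.hamiltonian_eq hU h𝒟 hS hR hℓ hM h1 h2 k
  have e2 : hamiltonian a (potential ℓ R) k ζ =ᶠ[𝓝 M] fun M => -(1 / 2) *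
      (momentDeriv a C (0, Pi.single k 1) ζ M - I * momentDeriv a C (0, Pi.single k I) ζ M) := by
    filter_upwards [hF.isOpen.mem_nhds hM, hfM.continuousAt.eventually
      (hℓ.isOpen.mem_nhds hO)] with M' h1 h2
    exact hF.hamiltonian_eq hU h𝒟 hS hR hℓ h1 hζ h2 k
  have d1 := (((hU.hasDerivAt_momentDeriv hMU C (0, Pi.single k 1) h0).fun_sub
    ((hU.hasDerivAt_momentDeriv hMU C (0, Pi.single k I) h0).const_mul I)).const_mul
      (-(1 / 2) : ℂ)).congr_of_eventuallyEq e1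
  obtain ⟨m1, m2⟩ := hF.fderiv_momentDeriv_zero hU h𝒟 hS hR hM hζ h0 (0, Pi.single k 1)
  obtain ⟨m3, m4⟩ := hF.fderiv_momentDeriv_zero hU h𝒟 hS hR hM hζ h0 (0, Pi.single k I)
  have d2 := ((m1.hasFDerivAt.fun_sub (m3.hasFDerivAt.const_mul I)).const_mul
    (-(1 / 2) : ℂ)).congr_of_eventuallyEq e2
  refine ⟨d1.differentiableAt, d2.differentiableAt, ?_⟩
  have hfM' : HasFDerivAt (confMap a ζ) _ M := hfM
  have hfζ : HasDerivAt (fun ξ => confMap a ξ M) _ ζ := hasDerivAt_polyMap (a M) ζ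
  have hV := hU.variation_eq_one hMU h0
  rw [poissonBracket, d1.deriv, hfζ.deriv, dMoment]
  simp only [dM0] at m2 m4 ⊢
  rw [d2.fderiv, hfM'.fderiv]
  simp only [smul_apply, sub_apply, m2, m4, smul_eq_mul, ContinuousLinearMap.comp_apply,
    polyMapL_apply, ofReal_zero, sub_zero]
  rw [variation] at hV
  simp only [variation]
  field_simp
  -- The terms with S_v cancel in the bracket; what remains is a multiple of the string equation B_0
  -- = 1.
  linear_combination (-(polyMap (fderiv ℝ a M (0, Pi.single k 1)) ζ -
    I * polyMap (fderiv ℝ a M (0, Pi.single k I)) ζ)) * hV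

/-- Both -∂W/∂M_0 and G equal -log ζ for the same branch. As H_0 has ζ-derivative -1/ζ and no
M-derivative, its bracket with φ is ∂φ/∂M_0. -/
theorem evolution_green (hΓ : IsComplexGreen U a 𝒟 Γ) (hℓ : IsLogBranch O ℓ) {M : Coord N}
    (hM : M ∈ 𝒰) {ζ : ℂ} (hζ : ζ ∈ ball (0 : ℂ) ρ) (hO : polyMap (a M) ζ ∈ O) :
    greenBranch ℓ Γ (confMap a ζ M) M = -dM0 (potential ℓ R (confMap a ζ M)) M ∧
    exp (-hamiltonianZero a (greenBranch ℓ Γ) ζ M) = ζ ∧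
    DifferentiableAt ℂ (fun ξ => hamiltonianZero a (greenBranch ℓ Γ) ξ M) ζ ∧
    DifferentiableAt ℝ (hamiltonianZero a (greenBranch ℓ Γ) ζ) M ∧
    ∀ φ : ℂ → Coord N → ℂ, dM0 (φ ζ) M =
      poissonBracket φ (hamiltonianZero a (greenBranch ℓ Γ)) ζ M := by
  obtain ⟨l1, l2, l3⟩ := hF.log_sub hU hℓ hM hζ hO
  have h0 : ζ ≠ 0 := by rw [← l1]; exact Complex.exp_ne_zero _
  have hG : ∀ M' ∈ 𝒰, ∀ ξ ∈ ball (0 : ℂ) ρ, hamiltonianZero a (greenBranch ℓ Γ) ξ M' =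
      -(ℓ (polyMap (a M') ξ) - Λ ξ M') := fun M' hM' ξ hξ => by
    rw [hamiltonianZero, greenBranch, confMap, green_eq_log h𝒟.1 hΓ (hF.subset hM') hF.one_lt
      (hF.inj M' hM') (hF.dom M' hM') (hF.holo M' hM') (hF.exp_eq M' hM') (hF.im_zero M' hM') ξ hξ]
    ring
  have d1 : HasDerivAt (fun ξ => hamiltonianZero a (greenBranch ℓ Γ) ξ M) (-(1 / ζ)) ζ :=
    l2.fun_neg.congr_of_eventuallyEq (by
      filter_upwards [isOpen_ball.mem_nhds hζ] with ξ hξ using hG M hM ξ hξ)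
  have d2 : HasFDerivAt (hamiltonianZero a (greenBranch ℓ Γ) ζ) (-0 : Coord N →L[ℝ] ℂ) M :=
    l3.fun_neg.congr_of_eventuallyEq (by
      filter_upwards [hF.isOpen.mem_nhds hM] with M' hM' using hG M' hM' ζ hζ)
  refine ⟨?_, ?_, d1.differentiableAt, d2.differentiableAt, fun φ => ?_⟩
  · have h1 := (hF.fderiv_potential hU h𝒟 hS hR hℓ hM hζ hO).2 (1, 0)
    rw [hF.momentDeriv_zero hU h𝒟 hS hR hM hζ h0] at h1
    have h2 := hG M hM ζ hζ
    rw [hamiltonianZero] at h2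
    rw [h2, dM0, confMap, h1]
    simp
  · rw [hG M hM ζ hζ, neg_neg, l1]
  · rw [poissonBracket, d1.deriv, dM0, dM0, d2.fderiv]
    simp only [neg_zero, zero_apply]
    field_simp
    ring

end

end IsLocalFrame

theorem IsMomentChart.evolution (hU : IsMomentChart U a) (h𝒟 : IsDomainNhd U a 𝒟)
    (hS : ∀ M ∈ U, IsSchwarzFunction (imageDomain (a M)) (fun z => S z M))
    (hR : IsSchwarzPrimitive U a 𝒟 S R) (hΓ : IsComplexGreen U a 𝒟 Γ) {M : Coord N} (hM : M ∈ U) :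
    ∀ᶠ ζ in 𝓝ˢ (Metric.closedBall (0 : ℂ) 1),
      ∀ (O : Set ℂ) (ℓ : ℂ → ℂ), IsLogBranch O ℓ → confMap a ζ M ∈ O →
        (DifferentiableAt ℝ (confMap a ζ) M ∧
          DifferentiableAt ℝ (potential ℓ R (confMap a ζ M)) M ∧
          ∀ k : Fin N,
            DifferentiableAt ℂ (fun ξ => hamiltonian a (potential ℓ R) k ξ M) ζ ∧
            DifferentiableAt ℝ (hamiltonian a (potential ℓ R) k ζ) M ∧
            dMoment k (confMap a ζ) M =
              poissonBracket (confMap a) (hamiltonian a (potential ℓ R) k) ζ M) ∧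
        greenBranch ℓ Γ (confMap a ζ M) M = -dM0 (potential ℓ R (confMap a ζ M)) M ∧
        exp (-hamiltonianZero a (greenBranch ℓ Γ) ζ M) = ζ ∧
        DifferentiableAt ℂ (fun ξ => hamiltonianZero a (greenBranch ℓ Γ) ξ M) ζ ∧
        DifferentiableAt ℝ (hamiltonianZero a (greenBranch ℓ Γ) ζ) M ∧
        ∀ φ : ℂ → Coord N → ℂ, DifferentiableAt ℂ (fun ξ => φ ξ M) ζ →
          DifferentiableAt ℝ (φ ζ) M →
          dM0 (φ ζ) M =
            poissonBracket φ (hamiltonianZero a (greenBranch ℓ Γ)) ζ M := by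
  obtain ⟨ρ, 𝒰, Λ, hM𝒰, hF⟩ := hU.exists_localFrame h𝒟 hM
  filter_upwards [isOpen_ball.mem_nhdsSet.2 (closedBall_subset_ball (x := (0 : ℂ)) hF.one_lt)]
    with ζ hζ O ℓ hℓ hO
  obtain ⟨g1, g2, g3, g4, g5⟩ := hF.evolution_green hU h𝒟 hS hR hΓ hℓ hM𝒰 hζ hO
  exact ⟨⟨(hU.hasFDerivAt_polyMap hM ζ).differentiableAt,
    (hF.fderiv_potential hU h𝒟 hS hR hℓ hM𝒰 hζ hO).1,
    hF.evolution_hamiltonian hU h𝒟 hS hR hℓ hM𝒰 hζ hO⟩, g1, g2, g3, g4, fun φ _ _ => g5 φ⟩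

end MomentEvolution

/-! ### Existence of the regular part of the potential -/

namespace MomentEvolution

open Complex Metric Set Filter Real MeasureTheory

variable {N : ℕ} {b M : Coord N} {ρ : ℝ}

/-- A residue: the integral of z^(k-m-1) dz/(2πi) along the image of the circle. For k ≠ m the form
is exact; for k = m the average is the value of f'/(f/ζ) at 0, which is 1. -/
theorem circleAverage_pow_mul_deriv_div (hρ : 1 < ρ) (hb : b.1 ≠ 0)
    (hq : ∀ ζ ∈ ball (0 : ℂ) ρ, polyQuot b ζ ≠ 0) (k m : ℕ) :
    circleAverage (fun ζ => polyMap b ζ ^ k * (ζ * polyDeriv b ζ) / polyMap b ζ ^ (m + 1)) 0 1 =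
      if k = m then 1 else 0 := by
  have hf : ∀ ζ : ℂ, ‖ζ‖ = 1 → ζ ≠ 0 ∧ polyQuot b ζ ≠ 0 ∧ polyMap b ζ ≠ 0 := fun ζ hn => by
    have h1 := hq ζ (by simpa [hn] using hρ)
    have h2 := ne_zero_of_norm_eq_one hn
    exact ⟨h2, h1, by rw [polyMap_eq_mul]; exact mul_ne_zero h2 h1⟩
  split_ifs with hkm
  · subst hkm
    have h1 := circleAverage_eq_center hρ
      ((differentiable_polyDeriv b).differentiableOn.div (differentiable_polyQuot b).differentiableOn hq)
    rw [Pi.div_apply, polyDeriv_zero, polyQuot_zero, div_self (by exact_mod_cast hb)] at h1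
    refine Eq.trans ?_ h1
    apply circleAverage_congr_sphere
    intro ζ hζ
    obtain ⟨h2, h3, h4⟩ := hf ζ (by simpa using hζ)
    simp only [Pi.div_apply]
    rw [pow_succ, mul_div_mul_left _ _ (pow_ne_zero _ h4), polyMap_eq_mul]
    field_simp
  · set n : ℤ := (k : ℤ) - m with hn
    have hn0 : (n : ℂ) ≠ 0 := by
      rw [hn]; push_cast; exact sub_ne_zero.2 (by exact_mod_cast hkm)
    have h1 := circleAverage_mul_deriv_eq_zero (F := fun ζ => polyMap b ζ ^ n / n)
      (F' := fun ζ => polyMap b ζ ^ (n - 1) * polyDeriv b ζ) (fun ζ hζ => by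
        refine (((hasDerivAt_zpow n _ (Or.inl (hf ζ hζ).2.2)).comp ζ
          (hasDerivAt_polyMap b ζ)).div_const (n : ℂ)).congr_deriv ?_
        field_simp)
    refine Eq.trans ?_ h1
    apply circleAverage_congr_sphere
    intro ζ hζ
    obtain ⟨h2, h3, h4⟩ := hf ζ (by simpa using hζ)
    simp only
    rw [zpow_sub_one₀ h4, hn, zpow_sub₀ h4, zpow_natCast, zpow_natCast, pow_succ]
    field_simp

/-- The derivative of the regular part of the potential is orthogonal to the powers of `f`. -/
theorem circleAverage_pow_mul_regularDeriv (hρ : 1 < ρ) (hb : b.1 ≠ 0)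
    (hq : ∀ ζ ∈ ball (0 : ℂ) ρ, polyQuot b ζ ≠ 0) (h0 : momentFun 0 b = M.1)
    (hs : ∀ j : Fin N, momentFun ((j : ℕ) + 1) b = M.2 j) {k : ℕ} (hk : k ≤ N) :
    circleAverage (fun ζ => polyMap b ζ ^ k * (ζ * regularDeriv b M ζ)) 0 1 = 0 := by
  have c1 := (differentiable_polyMap b).continuous
  have c2 := (differentiable_polyDeriv b).continuous
  have hf : ∀ ζ ∈ sphere (0 : ℂ) 1, ζ ≠ 0 ∧ polyMap b ζ ≠ 0 := fun ζ hζ => by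
    have hn : ‖ζ‖ = 1 := by simpa using hζ
    have h2 := ne_zero_of_norm_eq_one hn
    exact ⟨h2, by rw [polyMap_eq_mul]; exact mul_ne_zero h2 (hq ζ (by simpa [hn] using hρ))⟩
  set T : ℕ → ℂ → ℂ := fun m ζ =>
    polyMap b ζ ^ k * (ζ * polyDeriv b ζ) / polyMap b ζ ^ (m + 1) with hT
  have hTi : ∀ m, CircleIntegrable (T m) 0 1 := fun m => by
    apply circleIntegrable_of_continuousOn
    exact (by fun_prop : Continuous fun ζ => polyMap b ζ ^ k *
      (ζ * polyDeriv b ζ)).continuousOn.div (by fun_prop) fun ζ hζ => pow_ne_zero _ (hf ζ hζ).2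
  have hTi' : ∀ (c : ℂ) m, CircleIntegrable (fun ζ => c • T m ζ) 0 1 := fun c m =>
    (hTi m).const_fun_smul
  have hTa : ∀ m, circleAverage (T m) 0 1 = if k = m then 1 else 0 :=
    circleAverage_pow_mul_deriv_div hρ hb hq k
  have e1 : circleAverage (fun ζ => polyMap b ζ ^ k * (ζ * regularDeriv b M ζ)) 0 1 =
      circleAverage (fun ζ => polyMap b ζ ^ k * (ζ * polyDeriv b ζ) *
        starRingEnd ℂ (polyMap b ζ) - (M.1 : ℂ) • T 0 ζ -
          ∑ j : Fin N, M.2 j • T ((j : ℕ) + 1) ζ) 0 1 := by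
    apply circleAverage_congr_sphere
    intro ζ hζ
    rw [abs_one] at hζ
    have hn : ‖ζ‖ = 1 := by simpa using hζ
    have e2 : ∑ j : Fin N, M.2 j • T ((j : ℕ) + 1) ζ =
        polyMap b ζ ^ k * (ζ * polyDeriv b ζ) * principalDeriv M (polyMap b ζ) := by
      rw [principalDeriv, Finset.mul_sum]
      refine Finset.sum_congr rfl fun j _ => ?_
      simp only [hT, smul_eq_mul]
      ring
    beta_reduce
    rw [e2, ← schwarz_eq_conj b hn, regularDeriv]
    simp only [hT, smul_eq_mul]
    ring
  have i1 : CircleIntegrable (fun ζ => polyMap b ζ ^ k * (ζ * polyDeriv b ζ) *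
      starRingEnd ℂ (polyMap b ζ)) 0 1 := circleIntegrable_of_continuousOn (by fun_prop)
  have i2 : CircleIntegrable (fun ζ => polyMap b ζ ^ k * (ζ * polyDeriv b ζ) *
      starRingEnd ℂ (polyMap b ζ) - (M.1 : ℂ) • T 0 ζ) 0 1 := i1.sub (hTi' _ _)
  rw [e1, circleAverage_fun_sub i2 (CircleIntegrable.fun_sum _ fun j _ => hTi' _ _),
    circleAverage_fun_sub i1 (hTi' _ _), circleAverage_fun_sum fun j _ => hTi' _ _,
    circleAverage_fun_smul, hTa]
  simp only [circleAverage_fun_smul, hTa]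
  rw [← momentFun]
  rcases Nat.eq_zero_or_pos k with rfl | hk0
  · simp [h0]
  · obtain ⟨j, rfl⟩ : ∃ j, k = j + 1 := ⟨k - 1, by omega⟩
    rw [Finset.sum_eq_single ⟨j, by omega⟩]
    · simp [hs ⟨j, by omega⟩]
    · intro i _ hi
      rw [if_neg fun h => hi (Fin.ext (by simpa using h.symm))]; simp
    · simp

/-- The derivative has at worst a pole of order N + 1 at 0. Its orthogonality to f^0, ..., f^N,
which expresses the values of the moments, removes this pole by the triangular step, and the
extension has a primitive on the disk. -/
theorem exists_primitive_regularDeriv (hρ : 1 < ρ) (hb : b.1 ≠ 0)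
    (hq : ∀ ζ ∈ ball (0 : ℂ) ρ, polyQuot b ζ ≠ 0) (h0 : momentFun 0 b = M.1)
    (hs : ∀ j : Fin N, momentFun ((j : ℕ) + 1) b = M.2 j) :
    ∃ r : ℂ → ℂ, DifferentiableOn ℂ r (ball 0 ρ) ∧
      ∀ ζ ∈ ball (0 : ℂ) ρ, ζ ≠ 0 → HasDerivAt r (regularDeriv b M ζ) ζ := by
  obtain ⟨P, hP, hPS⟩ := differentiable_pow_mul_schwarz b
  -- ζ^(N+1) times the derivative, with f = ζ · `polyQuot` substituted so that it is visibly
  -- holomorphic at 0.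
  set q : ℂ → ℂ := fun ζ => polyDeriv b ζ * (P ζ - M.1 * ζ ^ N / polyQuot b ζ -
    ∑ k : Fin N, M.2 k * ζ ^ (N - 1 - (k : ℕ)) / polyQuot b ζ ^ ((k : ℕ) + 2)) with hqdef
  have hu := (differentiable_polyQuot b).differentiableOn (s := ball 0 ρ)
  have hqd : DifferentiableOn ℂ q (ball 0 ρ) := by
    refine (differentiable_polyDeriv b).differentiableOn.mul ((hP.differentiableOn.sub
      (DifferentiableOn.div (by fun_prop) hu hq)).sub (DifferentiableOn.fun_sum fun k _ => ?_))
    exact DifferentiableOn.div (by fun_prop) (hu.pow _) fun ζ hζ => pow_ne_zero _ (hq ζ hζ)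
  have hqe : ∀ ζ ∈ ball (0 : ℂ) ρ, ζ ≠ 0 → q ζ = ζ ^ (N + 1) * regularDeriv b M ζ := by
    intro ζ hζ hz
    have hqz := hq ζ hζ
    have e1 : ζ ^ (N + 1) * (M.1 / polyMap b ζ) = M.1 * ζ ^ N / polyQuot b ζ := by
      rw [polyMap_eq_mul]; field_simp; ring
    have e2 : ζ ^ (N + 1) * principalDeriv M (polyMap b ζ) =
        ∑ k : Fin N, M.2 k * ζ ^ (N - 1 - (k : ℕ)) / polyQuot b ζ ^ ((k : ℕ) + 2) := by
      rw [principalDeriv, Finset.mul_sum]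
      refine Finset.sum_congr rfl fun k _ => ?_
      rw [polyMap_eq_mul, mul_pow]
      have : ζ ^ (N + 1) = ζ ^ (N - 1 - (k : ℕ)) * ζ ^ ((k : ℕ) + 2) := by
        rw [← pow_add]; congr 1; omega
      rw [this]
      field_simp
    simp only [hqdef, regularDeriv, ← e1, ← e2, ← hPS ζ hz]
    ring
  obtain ⟨p, hp, hpq⟩ := exists_eq_pow_mul_of_circleAverage_eq_zero hρ hu
    (by simpa using hb) N q hqd fun k hk => by
      refine Eq.trans ?_ (circleAverage_pow_mul_regularDeriv hρ hb hq h0 hs hk)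
      apply circleAverage_congr_sphere
      intro ζ hζ
      have hn : ‖ζ‖ = 1 := by simpa using hζ
      have hz := ne_zero_of_norm_eq_one hn
      simp only [hqe ζ (by simpa [hn] using hρ) hz, ← polyMap_eq_mul]
      field_simp
      ring
  obtain ⟨r, -, hr⟩ := hp.isExactOn_ball.with_val_at 0 0
  refine ⟨r, fun ζ hζ => (hr ζ hζ).differentiableAt.differentiableWithinAt, fun ζ hζ hz => ?_⟩
  refine (hr ζ hζ).congr_deriv ?_
  have := (hqe ζ hζ hz).symm.trans (hpq ζ hζ)
  exact (mul_left_cancel₀ (pow_ne_zero _ hz) this).symm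

/-- On the circle conjugation exchanges j and k, so this identity makes twice the real part of the
Laurent polynomial equal to |f/ζ|² minus its diagonal terms. -/
theorem laurentCoeff_add_swap (j k : ℕ) :
    laurentCoeff j k + laurentCoeff k j = if j = k then 0 else 1 := by
  unfold laurentCoeff
  rcases eq_or_ne j k with rfl | h
  · simp
  · have : (j : ℂ) - k ≠ 0 := sub_ne_zero.2 (by exact_mod_cast h)
    have h2 : (k : ℂ) - j ≠ 0 := sub_ne_zero.2 (by exact_mod_cast h.symm)
    rw [if_neg h, if_neg h.symm, if_neg h]
    field_simp
    ring

theorem conj_laurentCoeff (j k : ℕ) : starRingEnd ℂ (laurentCoeff j k) = laurentCoeff j k := by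
  unfold laurentCoeff
  split_ifs <;> simp

/-- On the unit circle the real part of the Laurent polynomial is `|f|² / 2` up to a constant. -/
theorem laurentPot_re {ζ : ℂ} (hζ : ‖ζ‖ = 1) :
    (laurentPot b b ζ).re = ‖polyMap b ζ‖ ^ 2 / 2 - (∑ j : Fin (N + 1), ‖coef b j‖ ^ 2) / 2 := by
  have hinv : ζ⁻¹ = starRingEnd ℂ ζ := (conj_eq_inv hζ).symm
  have h1 : laurentPot b b ζ + starRingEnd ℂ (laurentPot b b ζ) =
      polyQuot b ζ * starRingEnd ℂ (polyQuot b ζ) -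
        ∑ j : Fin (N + 1), coef b j * starRingEnd ℂ (coef b j) := by
    have e1 : starRingEnd ℂ (laurentPot b b ζ) = ∑ j : Fin (N + 1), ∑ k : Fin (N + 1),
        coef b j * starRingEnd ℂ (coef b k) *
          (laurentCoeff k j * (ζ ^ (j : ℕ) * (ζ⁻¹) ^ (k : ℕ))) := by
      rw [laurentPot, Finset.sum_comm, map_sum]
      refine Finset.sum_congr rfl fun j _ => ?_
      rw [map_sum]
      refine Finset.sum_congr rfl fun k _ => ?_
      simp only [map_mul, conj_laurentCoeff, map_pow, hinv, Complex.conj_conj]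
      ring
    have e2 : ∑ j : Fin (N + 1), coef b j * starRingEnd ℂ (coef b j) =
        ∑ j : Fin (N + 1), ∑ k : Fin (N + 1), coef b j * starRingEnd ℂ (coef b k) *
          ((if (j : ℕ) = k then 1 else 0) * (ζ ^ (j : ℕ) * (ζ⁻¹) ^ (k : ℕ))) := by
      refine Finset.sum_congr rfl fun j _ => ?_
      rw [Finset.sum_eq_single j]
      · rw [if_pos rfl, ← mul_pow, mul_inv_cancel₀ (ne_zero_of_norm_eq_one hζ)]; simp
      · intro k _ hk
        rw [if_neg fun h => hk (Fin.ext h.symm)]; simp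
      · simp
    rw [e1, e2, laurentPot, polyQuot, map_sum, Finset.sum_mul_sum, ← Finset.sum_add_distrib,
      ← Finset.sum_sub_distrib]
    refine Finset.sum_congr rfl fun j _ => ?_
    rw [← Finset.sum_add_distrib, ← Finset.sum_sub_distrib]
    refine Finset.sum_congr rfl fun k _ => ?_
    rw [← mul_add, ← add_mul, laurentCoeff_add_swap, map_mul, map_pow, ← hinv]
    split_ifs <;> ring
  have h2 : ‖polyMap b ζ‖ = ‖polyQuot b ζ‖ := by rw [polyMap_eq_mul, norm_mul, hζ, one_mul]
  have h3 := congrArg Complex.re h1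
  simp only [Complex.mul_conj, add_re, conj_re, sub_re, re_sum, ofReal_re,
    Complex.normSq_eq_norm_sq] at h3
  rw [h2]
  linarith

/-- The logarithm of `f(ζ)/ζ` and the normalized regular part of the potential. -/
theorem exists_log_regular (hρ : 1 < ρ) (hb : 0 < b.1)
    (hinj : InjOn (polyMap b) (ball 0 ρ)) (h0 : momentFun 0 b = M.1)
    (hs : ∀ j : Fin N, momentFun ((j : ℕ) + 1) b = M.2 j) :
    ∃ Λ r : ℂ → ℂ, DifferentiableOn ℂ Λ (ball 0 ρ) ∧
      (∀ ζ ∈ ball (0 : ℂ) ρ, exp (Λ ζ) = polyQuot b ζ) ∧ (Λ 0).im = 0 ∧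
      DifferentiableOn ℂ r (ball 0 ρ) ∧
      (∀ ζ ∈ ball (0 : ℂ) ρ, ζ ≠ 0 → HasDerivAt r (regularDeriv b M ζ) ζ) ∧ (r 0).im = 0 ∧
      ∀ ζ : ℂ, ‖ζ‖ = 1 → (r ζ).re = ‖polyMap b ζ‖ ^ 2 / 2 -
        M.1 * Real.log ‖polyMap b ζ‖ + (principal M (polyMap b ζ)).re := by
  have h00 : (0 : ℂ) ∈ ball (0 : ℂ) ρ := by simp; linarith
  have h1mem : (1 : ℂ) ∈ ball (0 : ℂ) ρ := by simpa using hρ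
  have hq : ∀ ζ ∈ ball (0 : ℂ) ρ, polyQuot b ζ ≠ 0 := fun ζ hζ =>
    polyQuot_ne_zero_of_injOn hb.ne' h00 hinj hζ
  obtain ⟨Λ, hΛ, hΛ0, hexp⟩ := exists_log_on_ball (by linarith : 0 < ρ)
    (differentiable_polyQuot b).differentiableOn hq (c := (Real.log b.1 : ℂ)) (by
      rw [← Complex.ofReal_exp, Real.exp_log hb, polyQuot_zero])
  obtain ⟨r, hr, hrd⟩ := exists_primitive_regularDeriv hρ hb.ne' hq h0 hs
  have hconst : ∀ ζ ∈ ball (0 : ℂ) ρ, ζ ≠ 0 →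
      r ζ - regularPart b M Λ ζ = r 1 - regularPart b M Λ 1 := fun ζ hζ hz =>
    eq_of_hasDerivAt_zero_punctured (F := fun ζ => r ζ - regularPart b M Λ ζ) (ρ := ρ)
      (fun w hw hw0 => by
        have hp : pairing b b = M.1 := by rw [pairing_self_eq_momentFun, h0]
        exact ((hrd w hw hw0).fun_sub
          (hasDerivAt_regularPart hp hΛ hexp hw hw0)).congr_deriv (sub_self _))
      hζ hz h1mem one_ne_zero
  -- The real part of c gives the boundary normalization, using the constant term of Re L on the
  -- circle; its imaginary part makes r(0) real.
  set c : ℂ := (((∑ j : Fin (N + 1), ‖coef b j‖ ^ 2) / 2 -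
    (r 1 - regularPart b M Λ 1).re : ℝ) : ℂ) - ((r 0).im : ℂ) * I with hc
  refine ⟨Λ, fun ζ => r ζ + c, hΛ, hexp, by rw [hΛ0, ofReal_im], hr.add_const c,
    fun ζ hζ hz => (hrd ζ hζ hz).add_const c, by simp [hc, -ofReal_sub], fun ζ hζ => ?_⟩
  have hζm : ζ ∈ ball (0 : ℂ) ρ := by simpa [hζ] using hρ
  have e1 := congrArg Complex.re (hconst ζ hζm (ne_zero_of_norm_eq_one hζ))
  have e2 : (Λ ζ).re = Real.log ‖polyMap b ζ‖ := by
    rw [re_eq_log_norm_of_exp_eq (hexp ζ hζm), polyMap_eq_mul, norm_mul, hζ, one_mul]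
  have e3 : c.re = (∑ j : Fin (N + 1), ‖coef b j‖ ^ 2) / 2 - (r 1 - regularPart b M Λ 1).re := by
    simp [hc, -ofReal_sub]
  have e4 : (regularPart b M Λ ζ).re = -(M.1 * Real.log ‖polyMap b ζ‖) +
      (laurentPot b b ζ).re + (principal M (polyMap b ζ)).re := by
    simp [regularPart, e2]
  rw [sub_re, e4, laurentPot_re hζ] at e1
  rw [add_re, e3]
  linarith

end MomentEvolution

/-! ### Existence of the Schwarz function, its primitive and the Green's function -/

namespace MomentEvolution

open Complex Metric Set Filter Real MeasureTheory

variable {N : ℕ}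

/-- The largest radius, at most `2`, of a disk on which the polynomial is univalent. -/
noncomputable def univalenceRadius (b : Coord N) : ℝ :=
  sSup {ρ : ℝ | ρ ≤ 2 ∧ InjOn (polyMap b) (ball 0 ρ)}

theorem bddAbove_univalence (b : Coord N) :
    BddAbove {ρ : ℝ | ρ ≤ 2 ∧ InjOn (polyMap b) (ball 0 ρ)} := ⟨2, fun _ h => h.1⟩

/-- The supremum is attained, since two points of the open disk already lie in a common smaller disk
of univalence. The cap 2 keeps it finite for linear polynomials. -/
theorem injOn_ball_univalenceRadius (b : Coord N) :
    InjOn (polyMap b) (ball 0 (univalenceRadius b)) := by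
  have key : ∀ ζ ∈ ball (0 : ℂ) (univalenceRadius b), ∃ ρ : ℝ, InjOn (polyMap b) (ball 0 ρ) ∧
      ‖ζ‖ < ρ := fun ζ hζ => by
    have hne : {ρ : ℝ | ρ ≤ 2 ∧ InjOn (polyMap b) (ball 0 ρ)}.Nonempty := ⟨0, by simp⟩
    obtain ⟨ρ, hρ, h⟩ := exists_lt_of_lt_csSup hne (mem_ball_zero_iff.1 hζ)
    exact ⟨ρ, hρ.2, h⟩
  intro ζ hζ ξ hξ h
  obtain ⟨ρ₁, h1, h2⟩ := key ζ hζ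
  obtain ⟨ρ₂, h3, h4⟩ := key ξ hξ
  rcases le_total ρ₁ ρ₂ with h5 | h5
  · exact h3 (mem_ball_zero_iff.2 (h2.trans_le h5)) (mem_ball_zero_iff.2 h4) h
  · exact h1 (mem_ball_zero_iff.2 h2) (mem_ball_zero_iff.2 (h4.trans_le h5)) h

theorem le_univalenceRadius {b : Coord N} {ρ : ℝ} (hρ : ρ ≤ 2)
    (h : InjOn (polyMap b) (ball 0 ρ)) : ρ ≤ univalenceRadius b :=
  le_csSup (bddAbove_univalence b) ⟨hρ, h⟩

theorem univalenceRadius_le (b : Coord N) : univalenceRadius b ≤ 2 :=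
  csSup_le ⟨0, by simp⟩ fun _ h => h.1

theorem IsAdmissible.one_lt_univalenceRadius {b : Coord N} (hb : IsAdmissible b) :
    1 < univalenceRadius b := by
  obtain ⟨ρ, hρ, h⟩ := hb.exists_ball
  exact (lt_min hρ (by norm_num : (1 : ℝ) < 2)).trans_le (le_univalenceRadius (min_le_right _ _)
    (h.mono (ball_subset_ball (min_le_left _ _))))

/-- The images of the disks of univalence. -/
def univalenceDomain (U : Set (Coord N)) (a : Coord N → Coord N) : Set (ℂ × Coord N) :=
  {p | p.2 ∈ U ∧ p.1 ∈ polyMap (a p.2) '' ball 0 (univalenceRadius (a p.2))}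

/-- Openness in (z, M): the family map is open where f' ≠ 0, and any radius below the univalence
radius stays admissible for nearby M. -/
theorem IsMomentChart.isDomainNhd_univalenceDomain {U : Set (Coord N)} {a : Coord N → Coord N}
    (hU : IsMomentChart U a) : IsDomainNhd U a (univalenceDomain U a) := by
  refine ⟨?_, fun M hM z hz => ⟨hM, ?_⟩⟩
  · have key : ∀ M ∈ U, ∀ ζ ∈ ball (0 : ℂ) (univalenceRadius (a M)),
        univalenceDomain U a ∈ 𝓝 (polyMap (a M) ζ, M) := fun M hM ζ hζ => by
      have hinj := injOn_ball_univalenceRadius (a M)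
      obtain ⟨ρ, hρ, hρ'⟩ := exists_between (mem_ball_zero_iff.1 hζ)
      rw [← hU.map_nhds_famMap hM (polyDeriv_ne_zero_of_injOn isOpen_ball hinj hζ), Filter.mem_map]
      have h1 : ∀ᶠ p : ℂ × Coord N in 𝓝 (ζ, M), p.2 ∈ U :=
        continuousAt_snd.eventually (hU.isOpen.mem_nhds hM)
      have h2 : ∀ᶠ p : ℂ × Coord N in 𝓝 (ζ, M), p.1 ∈ ball (0 : ℂ) ρ :=
        continuousAt_fst.eventually (isOpen_ball.mem_nhds (mem_ball_zero_iff.2 hρ))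
      have h3 : ∀ᶠ p : ℂ × Coord N in 𝓝 (ζ, M), InjOn (polyMap (a p.2)) (ball 0 ρ) :=
        (continuous_snd.tendsto (ζ, M)).eventually
          ((hU.contDiffAt hM).continuousAt.eventually (eventually_injOn_ball hinj hρ'))
      filter_upwards [h1, h2, h3] with p e1 e2 e3
      exact ⟨e1, p.1, ball_subset_ball
        (le_univalenceRadius (hρ'.le.trans (univalenceRadius_le _)) e3) e2, rfl⟩
    rw [isOpen_iff_mem_nhds]
    rintro ⟨z, M⟩ ⟨hM, ζ, hζ, hz⟩
    have := key M hM ζ hζ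
    rwa [show polyMap (a M) ζ = z from hz] at this
  · rw [closure_imageDomain] at hz
    exact image_mono (closedBall_subset_ball (hU.admissible M hM).one_lt_univalenceRadius) hz

section Inverse

variable {b : Coord N} {ρ : ℝ}

/-- The inverse of the conformal map is holomorphic. -/
theorem exists_inverse_polyMap (hinj : InjOn (polyMap b) (ball 0 ρ)) :
    ∃ g : ℂ → ℂ, ∀ ζ ∈ ball (0 : ℂ) ρ, g (polyMap b ζ) = ζ ∧
      HasDerivAt g (polyDeriv b ζ)⁻¹ (polyMap b ζ) := by
  have hleft : ∀ ζ ∈ ball (0 : ℂ) ρ, Function.invFunOn (polyMap b) (ball 0 ρ) (polyMap b ζ) = ζ :=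
    fun ζ hζ => hinj.leftInvOn_invFunOn hζ
  refine ⟨Function.invFunOn (polyMap b) (ball 0 ρ), fun ζ hζ => ⟨hleft ζ hζ, ?_⟩⟩
  have hd := polyDeriv_ne_zero_of_injOn isOpen_ball hinj hζ
  have hs : HasStrictDerivAt (polyMap b) (polyDeriv b ζ) ζ := by
    have := ((differentiable_polyMap b).analyticAt ζ).hasStrictDerivAt
    rwa [(hasDerivAt_polyMap b ζ).deriv] at this
  refine HasDerivAt.of_local_left_inverse (f := polyMap b) ?_ ?_ hd ?_
  · rw [ContinuousAt, hleft ζ hζ, ← hs.map_nhds_eq hd, tendsto_map'_iff]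
    refine tendsto_id.congr' ?_
    filter_upwards [isOpen_ball.mem_nhds hζ] with ξ hξ
    exact (hleft ξ hξ).symm
  · rw [hleft ζ hζ]; exact hasDerivAt_polyMap b ζ
  · rw [← hs.map_nhds_eq hd, eventually_map]
    filter_upwards [isOpen_ball.mem_nhds hζ] with ξ hξ
    rw [hleft ξ hξ]

variable {g Λ : ℂ → ℂ}

/-- With g the inverse of f, the function is -log|g(z)| away from the pole; on the boundary Re Λ =
log|f|. -/
theorem isGreenFunction_of_log (hρ : 1 < ρ) (hinj : InjOn (polyMap b) (ball 0 ρ))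
    (hg : ∀ ζ ∈ ball (0 : ℂ) ρ, g (polyMap b ζ) = ζ ∧
      HasDerivAt g (polyDeriv b ζ)⁻¹ (polyMap b ζ))
    (hΛ : DifferentiableOn ℂ Λ (ball 0 ρ))
    (hexp : ∀ ζ ∈ ball (0 : ℂ) ρ, exp (Λ ζ) = polyQuot b ζ) :
    IsGreenFunction (imageDomain b) 0 (fun z => -Real.log ‖z‖ + (Λ (g z)).re) := by
  have hd : DifferentiableOn ℂ (fun z => Λ (g z)) (polyMap b '' ball 0 ρ) := by
    rintro _ ⟨ζ, hζ, rfl⟩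
    obtain ⟨h1, h2⟩ := hg ζ hζ
    refine (DifferentiableAt.comp (g := Λ) _ ?_ h2.differentiableAt).differentiableWithinAt
    rw [h1]; exact hΛ.differentiableAt (isOpen_ball.mem_nhds hζ)
  have ho := isOpen_polyMap_image hinj isOpen_ball subset_rfl
  refine ⟨⟨fun z => (Λ (g z)).re, ?_, fun z _ _ => by simp⟩, ?_⟩
  · rintro _ ⟨ζ, hζ, rfl⟩
    exact (hd.analyticAt (ho.mem_nhds
      ⟨ζ, ball_subset_ball hρ.le hζ, rfl⟩)).harmonicAt_re
  · intro z hz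
    rw [frontier_imageDomain hρ hinj] at hz
    obtain ⟨ζ, hζ, rfl⟩ := hz
    have hn : ‖ζ‖ = 1 := by simpa using hζ
    have hζρ : ζ ∈ ball (0 : ℂ) ρ := by simpa [hn] using hρ
    have hf := polyMap_ne_zero_of_exp hexp hζρ (ne_zero_of_norm_eq_one hn)
    have h1 : ContinuousAt (fun z => -Real.log ‖z‖ + (Λ (g z)).re) (polyMap b ζ) :=
      (continuousAt_id.norm.log (by simpa using hf)).neg.add
        (Complex.continuous_re.continuousAt.comp
          (hd.differentiableAt (ho.mem_nhds ⟨ζ, hζρ, rfl⟩)).continuousAt)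
    have h2 : -Real.log ‖polyMap b ζ‖ + (Λ (g (polyMap b ζ))).re = 0 := by
      rw [(hg ζ hζρ).1, re_eq_log_norm_of_exp_eq (hexp ζ hζρ), polyMap_eq_mul, norm_mul, hn,
        one_mul, neg_add_cancel]
    rw [ContinuousAt, h2] at h1
    exact h1.mono_left nhdsWithin_le_nhds

end Inverse

theorem IsMomentChart.exists_potential {U : Set (Coord N)} {a : Coord N → Coord N}
    (hU : IsMomentChart U a) : ∃ (𝒟 : Set (ℂ × Coord N)) (S R Γ : ℂ → Coord N → ℂ),
      IsDomainNhd U a 𝒟 ∧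
      (∀ M ∈ U, IsSchwarzFunction (imageDomain (a M)) (fun z => S z M)) ∧
      IsSchwarzPrimitive U a 𝒟 S R ∧ IsComplexGreen U a 𝒟 Γ := by
  have hρ : ∀ M ∈ U, 1 < univalenceRadius (a M) := fun M hM =>
    (hU.admissible M hM).one_lt_univalenceRadius
  have hinj : ∀ M, InjOn (polyMap (a M)) (ball 0 (univalenceRadius (a M))) := fun M =>
    injOn_ball_univalenceRadius (a M)
  choose g hg using fun M => exists_inverse_polyMap (hinj M)
  -- The choices are made separately for each M: the definitions ask only for holomorphy in z, and
  -- Im R(0) = 0 is a smooth normalization.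
  choose! Λ r hΛ hexp him hr hrd hrim hre using fun M (hM : M ∈ U) =>
    exists_log_regular (M := M) (hρ M hM) (hU.admissible M hM).1 (hinj M) (hU.momentFun_zero hM)
      (hU.momentFun_succ hM)
  have hfr : ∀ M ∈ U, frontier (imageDomain (a M)) = polyMap (a M) '' sphere 0 1 := fun M hM =>
    frontier_imageDomain (hρ M hM) (hinj M)
  have hsph : ∀ M ∈ U, ∀ ζ ∈ sphere (0 : ℂ) 1, ‖ζ‖ = 1 ∧ ζ ≠ 0 ∧
      ζ ∈ ball (0 : ℂ) (univalenceRadius (a M)) := fun M hM ζ hζ => by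
    have hn : ‖ζ‖ = 1 := by simpa using hζ
    exact ⟨hn, ne_zero_of_norm_eq_one hn, by simpa [hn] using hρ M hM⟩
  have h00 : ∀ M ∈ U, (0 : ℂ) ∈ ball (0 : ℂ) (univalenceRadius (a M)) := fun M hM =>
    mem_ball_self (by linarith [hρ M hM])
  have hg0 : ∀ M ∈ U, g M 0 = 0 := fun M hM => by
    have := (hg M 0 (h00 M hM)).1
    rwa [polyMap_zero] at this
  set V : Coord N → Set ℂ := fun M => polyMap (a M) '' (ball 0 (univalenceRadius (a M)) \ {0})
    with hV
  have hVo : ∀ M, IsOpen (V M) := fun M =>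
    isOpen_polyMap_image (hinj M) (isOpen_ball.sdiff isClosed_singleton) sdiff_subset
  have hVf : ∀ M ∈ U, frontier (imageDomain (a M)) ⊆ V M := fun M hM => by
    rw [hfr M hM]
    exact image_mono fun ζ hζ => ⟨(hsph M hM ζ hζ).2.2, by simpa using (hsph M hM ζ hζ).2.1⟩
  have hcomp : ∀ M ∈ U, ∀ F : ℂ → ℂ, DifferentiableOn ℂ F (ball 0 (univalenceRadius (a M))) →
      DifferentiableOn ℂ (fun z => F (g M z)) {z | (z, M) ∈ univalenceDomain U a} := by
    rintro M hM F hF z ⟨-, hz⟩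
    have hz : z ∈ polyMap (a M) '' ball 0 (univalenceRadius (a M)) := hz
    obtain ⟨ζ, hζ, rfl⟩ := hz
    obtain ⟨h1, h2⟩ := hg M ζ hζ
    refine (DifferentiableAt.comp (g := F) _ ?_ h2.differentiableAt).differentiableWithinAt
    simp only [h1]; exact hF.differentiableAt (isOpen_ball.mem_nhds hζ)
  refine ⟨univalenceDomain U a, fun z M => schwarz (a M) (g M z), fun z M => r M (g M z),
    fun z M => Λ M (g M z), hU.isDomainNhd_univalenceDomain, fun M hM => ?_, ?_, ?_⟩
  · refine ⟨V M, hVo M, hVf M hM, ?_, ?_⟩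
    · rintro _ ⟨ζ, ⟨hζ, hζ0⟩, rfl⟩
      obtain ⟨h1, h2⟩ := hg M ζ hζ
      refine (DifferentiableAt.comp (g := schwarz (a M)) _ ?_
        h2.differentiableAt).differentiableWithinAt
      rw [h1]; exact (hasDerivAt_schwarz (a M) hζ0).differentiableAt
    · intro z hz
      rw [hfr M hM] at hz
      obtain ⟨ζ, hζ, rfl⟩ := hz
      obtain ⟨h1, h2, h3⟩ := hsph M hM ζ hζ
      simp only [(hg M ζ h3).1, schwarz_eq_conj _ h1]
  · refine ⟨fun M hM => hcomp M hM _ (hr M hM), fun M hM => ⟨V M, hVo M, hVf M hM, ?_⟩,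
      fun M hM => ?_, ⟨fun _ => 0, contDiffOn_const, fun M hM => ?_⟩⟩
    · rintro O ℓ hℓ _ ⟨hO, ζ, ⟨hζ, hζ0⟩, rfl⟩
      obtain ⟨h1, h2⟩ := hg M ζ hζ
      have hf := hℓ.ne_zero hO
      have hd := polyDeriv_ne_zero_of_injOn isOpen_ball (hinj M) hζ
      have h3 : HasDerivAt (r M) (regularDeriv (a M) M ζ) (g M (polyMap (a M) ζ)) := by
        rw [h1]; exact hrd M hM ζ hζ hζ0
      have h4 := (((hℓ.hasDerivAt hO).const_mul (M.1 : ℂ)).fun_sub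
        (hasDerivAt_principal M hf)).fun_add (h3.comp _ h2)
      refine h4.congr_deriv ?_
      rw [regularDeriv, h1]
      field_simp
      ring
    · rintro O ℓ hℓ z ⟨hO, hz⟩
      rw [hfr M hM] at hz
      obtain ⟨ζ, hζ, rfl⟩ := hz
      obtain ⟨h1, h2, h3⟩ := hsph M hM ζ hζ
      rw [potential_eq, (hg M ζ h3).1, add_re, sub_re, re_ofReal_mul, hℓ.re_eq hO,
        hre M hM ζ h1]
      ring
    · simp only [hg0 M hM, hrim M hM]
  · refine ⟨fun M hM => hcomp M hM _ (hΛ M hM), fun M hM => ⟨_, isGreenFunction_of_log (hρ M hM)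
      (hinj M) (hg M) (hΛ M hM) (hexp M hM), ?_⟩, fun M hM => ?_⟩
    · rintro O ℓ hℓ z ⟨hO, -⟩
      rw [greenBranch, add_re, neg_re, hℓ.re_eq hO]
    · simp only [hg0 M hM, him M hM]

end MomentEvolution

theorem mainTheorem7 (N : ℕ) :
    -- the moments are local coordinates near every point of the manifold
    (∀ b : Coord N, IsAdmissible b → ∃ (U : Set (Coord N)) (a : Coord N → Coord N),
      IsMomentChart U a ∧ momentMap b ∈ U ∧ a (momentMap b) = b) ∧
    ∀ (U : Set (Coord N)) (a : Coord N → Coord N), IsMomentChart U a →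
      -- the Schwarz function, its normalized primitive and the complex Green's function exist
      (∃ (𝒟 : Set (ℂ × Coord N)) (S R Γ : ℂ → Coord N → ℂ), IsDomainNhd U a 𝒟 ∧
        (∀ M ∈ U, IsSchwarzFunction (imageDomain (a M)) (fun z => S z M)) ∧
        IsSchwarzPrimitive U a 𝒟 S R ∧ IsComplexGreen U a 𝒟 Γ) ∧
      -- and for all such choices the evolution equations hold
      ∀ (𝒟 : Set (ℂ × Coord N)) (S R Γ : ℂ → Coord N → ℂ), IsDomainNhd U a 𝒟 →
        (∀ M ∈ U, IsSchwarzFunction (imageDomain (a M)) (fun z => S z M)) →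
        IsSchwarzPrimitive U a 𝒟 S R → IsComplexGreen U a 𝒟 Γ →
        ∀ M ∈ U, ∀ᶠ ζ in 𝓝ˢ (Metric.closedBall (0 : ℂ) 1),
          ∀ (O : Set ℂ) (ℓ : ℂ → ℂ), IsLogBranch O ℓ → confMap a ζ M ∈ O →
            -- the evolution equation for `f`, with all derivatives existing
            (DifferentiableAt ℝ (confMap a ζ) M ∧
              DifferentiableAt ℝ (potential ℓ R (confMap a ζ M)) M ∧
              ∀ k : Fin N,
                DifferentiableAt ℂ (fun ξ => hamiltonian a (potential ℓ R) k ξ M) ζ ∧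
                DifferentiableAt ℝ (hamiltonian a (potential ℓ R) k ζ) M ∧
                dMoment k (confMap a ζ) M =
                  poissonBracket (confMap a) (hamiltonian a (potential ℓ R) k) ζ M) ∧
            -- `G = -∂W/∂M₀` and `H₀ = -log ζ`
            greenBranch ℓ Γ (confMap a ζ M) M = -dM0 (potential ℓ R (confMap a ζ M)) M ∧
            Complex.exp (-hamiltonianZero a (greenBranch ℓ Γ) ζ M) = ζ ∧
            -- the evolution equation for arbitrary `φ`
            DifferentiableAt ℂ (fun ξ => hamiltonianZero a (greenBranch ℓ Γ) ξ M) ζ ∧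
            DifferentiableAt ℝ (hamiltonianZero a (greenBranch ℓ Γ) ζ) M ∧
            ∀ φ : ℂ → Coord N → ℂ, DifferentiableAt ℂ (fun ξ => φ ξ M) ζ →
              DifferentiableAt ℝ (φ ζ) M →
              dM0 (φ ζ) M =
                poissonBracket φ (hamiltonianZero a (greenBranch ℓ Γ)) ζ M := by
  refine ⟨fun b hb => exists_momentChart hb, fun U a hU => ⟨hU.exists_potential, ?_⟩⟩
  intro 𝒟 S R Γ h𝒟 hS hR hΓ M hM
  exact hU.evolution h𝒟 hS hR hΓ hM
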